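/- **Setting.** Let $\mathcal S$ be a countable state space and $\mathcal A$ a finite action space, with transition probabilities $P(s'|s,a)$, rewards $\mathcal R(s,a)\in\mathbb R$, a policy $\pi(a|s)$ and feature vectors $\psi(s)\in\mathbb R^d$. Let $P=P_\pi$ be the induced transition matrix, $P(s'|s)=\sum_a\pi(a|s)P(s'|s,a)$, and $\mathcal R_\pi(s)=\sum_a\pi(a|s)\mathcal R(s,a)$. Let $\Psi$ be the matrix with rows $\psi(s)^T$. Fix $\lambda\in[0,1)$ and $c_\alpha>0$. All norms are Euclidean, or spectral norms for matrices. Assume the following. 1. The chain $S_k$ is irreducible and aperiodic with unique stationary distribution $\mu$, and $\mathbb E_\mu[\mathcal R^4(S,A)]=\hat r^2<\infty$ with $\hat r\ge 0$. 2. The columns $\psi_j$ of $\Psi$ are linearly independent, and $\sum_s\mu(s)\psi_j(s)^2\le\hat\psi^2<\infty$ for all $j$, with $\hat\psi\ge0$. Put $\Lambda=\mathrm{diag}(\mu)$, $\bar r=\sum_s\mu(s)\mathcal R_\pi(s)$, $P^{(\lambda)}=(1-\lambda)\sum_{m\ge0}\lambda^mP^{m+1}$ and $\mathcal R^{(\lambda)}=(1-\lambda)\sum_{m\ge0}\lambda^m\sum_{l=0}^mP^l\mathcal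 R_\pi$. Let $E_\Psi=\mathrm{span}\{\theta:\psi(s)^T\theta=1\ \forall s\}$, and let $\Pi$ be the orthogonal projection of $\mathbb R^d$ onto $E_\Psi^\perp$. The process $Y_k=(S_k,A_k,S_{k+1},z_k)$ with $z_{k+1}=\lambda z_k+\psi(S_{k+1})$ is a Markov process on $\mathcal Y=\mathcal S\times\mathcal A\times\mathcal S\times\mathbb R^d$. For $x=(r,\theta)\in\mathbb R\times\mathbb R^d$ and $y=(s,a,s',z)$ let $F(x,y)=T(y)x+b(y)$ with $$T(y)=\begin{bmatrix}-c_\alpha&0\\-\Pi z&\Pi z(\psi(s')-\psi(s))^T\end{bmatrix},\quad b(y)=\begin{bmatrix}c_\alpha\mathcal R(s,a)\\\mathcal R(s,a)\Pi z\end{bmatrix},$$ which is the increment $\big(c_\alpha(\mathcal R(s,a)-r),\ \delta\,\Pi z\big)$, $\delta=\mathcal R(s,a)-r+\psi(s')^T\theta-\psi(s)^T\theta$, of average-reward TD($\lambda$). Let $$\bar T=\begin{bmatrix}-c_\alpha&0\\-\frac1{1-\lambda}\Pi\Psi^T\mu&\Pi\Psi^T\Lambda(P^{(\lambda)}-I)\Psi\end{bmatrix},\quad\bar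 b=\begin{bmatrix}c_\alpha\bar r\\\Pi\Psi^T\Lambda\mathcal R^{(\lambda)}\end{bmatrix}.$$ **Claims (under 1 and 2).** (i) The process $Y_k$ has a unique stationary distribution $\nu$. The functions $T$, $b$ and $F(x,\cdot)$ are $\nu$-integrable with means $\bar T$, $\bar b$ and $\bar F(x):=\mathbb E_\nu[F(x,Y)]=\bar Tx+\bar b$, for every $x$. (ii) There is a unique $\theta^*\in E_\Psi^\perp$ such that $x^*=(\bar r,\theta^*)$ solves $\bar Tx+\bar b=0$. It satisfies the projected Bellman equation $\Psi\theta^*=\Pi_{\Lambda,\Psi}\mathcal B^{(\lambda)}_\pi(\Psi\theta^*)$, where $\Pi_{\Lambda,\Psi}=\Psi(\Psi^T\Lambda\Psi)^{-1}\Psi^T\Lambda$, $\mathcal B_\pi V=\mathcal R_\pi+PV-\bar r$ and $\mathcal B_\pi^{(\lambda)}=(1-\lambda)\sum_{m\ge0}\lambda^m\mathcal B_\pi^{m+1}$. (iii) If $E_\Psi^\perp\ne\{0\}$, then the minimum $\Delta=\min_{\theta\in E_\Psi^\perp,\|\theta\|=1}\theta^T\Pi\Psi^T\Lambda(I-P^{(\lambda)})\Psi\theta$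 exists and is positive. If moreover $c_\alpha\ge\Delta+\sqrt{\frac{d^2\hat\psi^4}{\Delta^2(1-\lambda)^4}-\frac{d\hat\psi^2}{(1-\lambda)^2}}$ (the root of a negative number being read as $0$), then $-x^T\bar Tx\ge\frac\Delta2\|x\|^2$ for all $x\in\mathbb R\times E_\Psi^\perp$. (iv) For all $x$ and $y$, $\|F(x,y)\|\le\|T(y)\|\|x-x^*\|+\|b(y)\|+\|T(y)\|\|x^*\|$. **Further assumption.** 3. There are functions $f_1,f_2,f_3:\mathcal S\to[0,\infty)$ and $\rho\in(0,1)$ such that for all $s_0\in\mathcal S$ and $k,m\ge0$ the four quantities $|\mathbb E_{s_0}[\mathcal R(S_k,A_k)]-\bar r|$, $\|\mathbb E_{s_0}[\psi(S_k)]-\mathbb E_\mu[\psi(S_k)]\|$, $\|\mathbb E_{s_0}[\psi(S_k)\psi(S_{k+m})^T]-\mathbb E_\mu[\psi(S_k)\psi(S_{k+m})^T]\|$ and $\|\mathbb E_{s_0}[\psi(S_k)\mathcal R(S_{k+m},A_{k+m})]-\mathbb E_\mu[\psi(S_k)\mathcal R_\pi(S_{k+m})]\|$ are all at most $\rho^kf_1(s_0)$.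 Moreover $\mathbb E_{s_0}[f_1^4(S_k)]\le f_2(s_0)$, $\mathbb E_{s_0}\|\psi(S_k)\|^4\le f_3(s_0)$ and $\mathbb E_{s_0}[\mathcal R^4(S_k,A_k)]\le f_3(s_0)$. Put $\hat T=c_\alpha^2+\frac{\sqrt\varphi}{(1-\lambda)^2}+\frac{4\varphi}{(1-\lambda)^2}$ with $\varphi=f_3(s_0)+f_3(s_1)$, $\ \hat b[\varphi]=c_\alpha^2\sqrt\varphi+\frac{\varphi}{(1-\lambda)^2}$, $\ \varphi_{a_0}=f_3(s_0)+f_3(s_1)+\mathcal R^4(s_0,a_0)$, $\ \psi'=\|\Psi^T\Lambda\Psi\|$, and $$\hat g=\tfrac{4\rho^{-2}\sqrt{f_2(s_1)}}{(1-\lambda)^2(1-\rho)^2}+\tfrac{16\rho^{-2}\sqrt{\|\psi(s_0)\|^4+f_3(s_1)}\sqrt{f_2(s_0)+f_2(s_1)}}{(1-\lambda\rho)^2(1-\lambda)^2}+\tfrac{4(1+\hat r+\hat\psi\sqrt d)^2\sqrt{\|\psi(s_0)\|^4+f_3(s_1)}}{(1-\lambda)^4}+\tfrac{4(\hat\psi+\psi'+\hat\psi\hat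 r\sqrt d)^2}{(1-\lambda)^4}.$$ **Claims (under 1, 2 and 3).** Let $y_0=(s_0,a_0,s_1,\psi(s_0))$ be any initial value of $Y$ with $z_0=\psi(s_0)$. (v) $\mathbb E_{y_0}\|T(Y_k)\|^2\le\hat T$ for all $k\ge0$; $\ \mathbb E_{y_0}\|b(Y_k)\|^2\le\hat b[\varphi]$ for all $k\ge1$; and $\mathbb E_{y_0}\|b(Y_k)\|^2\le\hat b[\varphi_{a_0}]$ for all $k\ge0$. (vi) There are a family of functions $V_x:\mathcal Y\to\mathbb R^{d+1}$, $x\in\mathbb R^{d+1}$, solving the Poisson equation $V_x(y)=F(x,y)+\mathbb E_y[V_x(Y_1)]-\bar F(x)$ for all $x$ and $y$, and functions $A_2,B_2:\mathcal Y\to[0,\infty)$ with $\|V_{x_2}(y)-V_{x_1}(y)\|\le A_2(y)\|x_2-x_1\|$ and $\|V_{x^*}(y)\|\le B_2(y)$ for all $x_1,x_2,y$, such that for all $k\ge0$ $$\mathbb E_{y_0}[A_2^2(Y_k)]\le9\hat g,\qquad\mathbb E_{y_0}[B_2^2(Y_k)]\le20(\|x^*\|^2+1)\hat g+\frac{8c_\alpha^2\sqrt{f_2(s_0)+f_2(s_1)}}{(1-\rho)^2}+8\,\hat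 b[\varphi_{a_0}].$$ (vii) From every initial value $y_0\in\mathcal Y$ (with arbitrary $z_0$), the second moments of $\|T(Y_k)\|$, $\|b(Y_k)\|+\|T(Y_k)\|\|x^*\|$, $A_2(Y_k)$ and $B_2(Y_k)$ (for $A_2$, $B_2$ as in (vi)) are bounded uniformly in $k$. -/

import Mathlib

open MeasureTheory ProbabilityTheory
open scoped ENNReal NNReal InnerProductSpace

noncomputable section

/-- A Markov decision process with states `S` and actions `A`, together with the policy that is
evaluated and a feature map into `ℝ^d`. -/
structure TDModel (S A : Type*) (d : ℕ) where
  /-- transition probabilities `P(· | s, a)` -/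
  P : S → A → PMF S
  /-- the policy `π(· | s)` -/
  policy : S → PMF A
  /-- the rewards `R(s, a)` -/
  R : S → A → ℝ
  /-- the feature vectors `ψ(s)` -/
  ψ : S → EuclideanSpace ℝ (Fin d)

/-- The state space of the Markov process `Y_k = (S_k, A_k, S_{k+1}, z_k)`. -/
abbrev TDState (S A : Type*) (d : ℕ) : Type _ := S × A × S × EuclideanSpace ℝ (Fin d)

/-- The space `ℝ × ℝ^d = ℝ^{d+1}`, with the Euclidean norm, of the iterates `x = (r, θ)`. -/
abbrev TDParam (d : ℕ) : Type := WithLp 2 (ℝ × EuclideanSpace ℝ (Fin d))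

namespace TDModel

variable {S A : Type*} {d : ℕ} (M : TDModel S A d)

section Algebra

variable [Fintype A]

/-- The average reward `R_π(s)` of a state. -/
def Rpi (s : S) : ℝ := ∑ a, (M.policy s a).toReal * M.R s a

/-- The subspace `E_Ψ`, spanned by the `θ` with `ψ(s)ᵀ θ = 1` for all `s`. -/
def EPsi : Submodule ℝ (EuclideanSpace ℝ (Fin d)) :=
  Submodule.span ℝ {θ | ∀ s, ⟪M.ψ s, θ⟫_ℝ = 1}

/-- The orthogonal projection of `ℝ^d` onto the orthogonal complement of `E_Ψ`. -/
def proj : EuclideanSpace ℝ (Fin d) →L[ℝ] EuclideanSpace ℝ (Fin d) := M.EPsiᗮ.starProjection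

/-- The function `Ψ θ : s ↦ ψ(s)ᵀ θ`. -/
def Psi (θ : EuclideanSpace ℝ (Fin d)) (s : S) : ℝ := ⟪M.ψ s, θ⟫_ℝ

/-- The matrix `T(y)` of the iteration, as a linear map on `ℝ × ℝ^d`. -/
def T (cα : ℝ) (y : TDState S A d) : TDParam d →L[ℝ] TDParam d :=
  LinearMap.toContinuousLinearMap
    { toFun := fun x => WithLp.toLp 2
        (-(cα * x.fst),
          -(x.fst • M.proj y.2.2.2) + ⟪M.ψ y.2.2.1 - M.ψ y.1, x.snd⟫_ℝ • M.proj y.2.2.2)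
      map_add' := by
        intro x x'
        apply WithLp.ofLp_injective
        refine Prod.ext ?_ ?_
        · change -(cα * (x + x').fst) = -(cα * x.fst) + -(cα * x'.fst)
          rw [WithLp.add_fst]; ring
        · change _ = (_ + _) + (_ + _)
          simp only [WithLp.add_fst, WithLp.add_snd, inner_add_right, add_smul]; abel
      map_smul' := by
        intro c x
        apply WithLp.ofLp_injective
        refine Prod.ext ?_ ?_
        · change -(cα * (c • x).fst) = c • -(cα * x.fst)
          rw [WithLp.smul_fst, smul_eq_mul, smul_eq_mul]; ring
        · change _ = c • (_ + _)
          simp only [WithLp.smul_fst, WithLp.smul_snd, inner_smul_right, smul_eq_mul, smul_add,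
            smul_neg, mul_smul] }

/-- The vector `b(y)` of the iteration. -/
def b (cα : ℝ) (y : TDState S A d) : TDParam d :=
  WithLp.toLp 2 (cα * M.R y.1 y.2.1, M.R y.1 y.2.1 • M.proj y.2.2.2)

/-- The operator `F(x, y) = T(y) x + b(y)`. -/
def F (cα : ℝ) (x : TDParam d) (y : TDState S A d) : TDParam d := M.T cα y x + M.b cα y

end Algebra

section Kernels

variable [Countable S] [MeasurableSpace S] [DiscreteMeasurableSpace S]
  [Fintype A] [MeasurableSpace A] [DiscreteMeasurableSpace A]

/-- The policy as a Markov kernel: the law of `A_k` given `S_k`. -/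
def policyKernel : Kernel S A := Kernel.ofFunOfCountable fun s => (M.policy s).toMeasure

/-- The law of `S_{k+1}` given `(S_k, A_k)`. -/
def transKernel : Kernel (S × A) S := Kernel.ofFunOfCountable fun p => (M.P p.1 p.2).toMeasure

instance : IsMarkovKernel M.policyKernel :=
  ⟨fun s => by unfold policyKernel; exact PMF.toMeasure.isProbabilityMeasure _⟩

instance : IsMarkovKernel M.transKernel :=
  ⟨fun p => by unfold transKernel; exact PMF.toMeasure.isProbabilityMeasure _⟩

/-- The law of `(A_k, S_{k+1})` given `S_k`. -/
def stepKernel : Kernel S (A × S) := M.policyKernel ⊗ₖ M.transKernel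

/-- The transition kernel `P_π` of the Markov chain `S_k`. -/
def stateKernel : Kernel S S := M.stepKernel.snd

/-- The law of `(S_n, A_n)` given `S_0`. -/
def stateAction (n : ℕ) : Kernel S (S × A) :=
  (M.stateKernel ^ n) ⊗ₖ (M.policyKernel.prodMkLeft S)

/-- The transition kernel of `Y_k = (S_k, A_k, S_{k+1}, z_k)`: given `Y_k = (s, a, s', z)`, draw
`a' ∼ π(· | s')` and `s'' ∼ P(· | s', a')`; then `Y_{k+1} = (s', a', s'', lam z + ψ(s'))`. The law
of `Y_k` given `Y_0 = y` is `(tdKernel lam ^ k) y`. -/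
def tdKernel (lam : ℝ) : Kernel (TDState S A d) (TDState S A d) :=
  (Kernel.id ×ₖ (M.stepKernel.comap (fun y : TDState S A d => y.2.2.1) (by fun_prop))).map
    fun p => (p.1.2.2.1, p.2.1, p.2.2, lam • p.1.2.2.2 + M.ψ p.1.2.2.1)

/-- `(P^n V)(s) = E_s[V(S_n)]`. -/
def powP (n : ℕ) (V : S → ℝ) (s : S) : ℝ := ∫ t, V t ∂((M.stateKernel ^ n) s)

/-- `P^(λ) = (1 - λ) ∑ₘ λ^m P^{m+1}`, as an operator on functions of the state. -/
def PLam (lam : ℝ) (V : S → ℝ) (s : S) : ℝ := (1 - lam) * ∑' m : ℕ, lam ^ m * M.powP (m + 1) V s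

/-- `R^(λ) = (1 - λ) ∑ₘ λ^m ∑_{l ≤ m} P^l R_π`. -/
def RLam (lam : ℝ) (s : S) : ℝ :=
  (1 - lam) * ∑' m : ℕ, lam ^ m * ∑ l ∈ Finset.range (m + 1), M.powP l M.Rpi s

variable (μ : Measure S)

/-- The stationary average reward `r̄ = ∑ₛ μ(s) R_π(s)`. -/
def rbar : ℝ := ∫ s, M.Rpi s ∂μ

/-- The vector `Ψᵀ Λ V = ∑ₛ μ(s) V(s) ψ(s)`. -/
def PsiTLam (V : S → ℝ) : EuclideanSpace ℝ (Fin d) := ∫ s, V s • M.ψ s ∂μ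

/-- The `d × d` matrix `Ψᵀ Λ L Ψ`, for an operator `L` on functions of the state. -/
def form (L : (S → ℝ) → S → ℝ) : Matrix (Fin d) (Fin d) ℝ :=
  Matrix.of fun i j => ∫ s, M.ψ s i * L (fun t => M.ψ t j) s ∂μ

/-- The matrix `Ψᵀ Λ (P^(λ) - I) Ψ`, acting on the Euclidean space `ℝ^d`. -/
def driftOp (lam : ℝ) : EuclideanSpace ℝ (Fin d) →L[ℝ] EuclideanSpace ℝ (Fin d) :=
  Matrix.toEuclideanCLM (𝕜 := ℝ) (M.form μ fun V s => M.PLam lam V s - V s)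

/-- The matrix `Ψᵀ Λ (I - P^(λ)) Ψ`, acting on the Euclidean space `ℝ^d`. -/
def energyOp (lam : ℝ) : EuclideanSpace ℝ (Fin d) →L[ℝ] EuclideanSpace ℝ (Fin d) :=
  Matrix.toEuclideanCLM (𝕜 := ℝ) (M.form μ fun V s => V s - M.PLam lam V s)

/-- The block matrix `T̄`. -/
def Tbar (lam cα : ℝ) : TDParam d →L[ℝ] TDParam d :=
  LinearMap.toContinuousLinearMap
    { toFun := fun x => WithLp.toLp 2
        (-(cα * x.fst),
          -(x.fst • (1 / (1 - lam)) • M.proj (M.PsiTLam μ fun _ => 1))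
            + M.proj (M.driftOp μ lam x.snd))
      map_add' := by
        intro x x'
        apply WithLp.ofLp_injective
        refine Prod.ext ?_ ?_
        · change -(cα * (x + x').fst) = -(cα * x.fst) + -(cα * x'.fst)
          rw [WithLp.add_fst]; ring
        · change _ = (_ + _) + (_ + _)
          simp only [WithLp.add_fst, WithLp.add_snd, map_add, add_smul]; abel
      map_smul' := by
        intro c x
        apply WithLp.ofLp_injective
        refine Prod.ext ?_ ?_
        · change -(cα * (c • x).fst) = c • -(cα * x.fst)
          rw [WithLp.smul_fst, smul_eq_mul, smul_eq_mul]; ring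
        · change _ = c • (_ + _)
          simp only [WithLp.smul_fst, WithLp.smul_snd, map_smul, smul_eq_mul, smul_add,
            smul_neg, mul_smul] }

/-- The block vector `b̄`. -/
def bbar (lam cα : ℝ) : TDParam d :=
  WithLp.toLp 2 (cα * M.rbar μ, M.proj (M.PsiTLam μ (M.RLam lam)))

/-- The Bellman operator `B_π V = R_π + P V - r̄` of the average reward problem. -/
def bellman (V : S → ℝ) (s : S) : ℝ := M.Rpi s + M.powP 1 V s - M.rbar μ

/-- `B_π^(λ) V = (1 - λ) ∑ₘ λ^m B_π^{m+1} V`. -/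
def bellmanLam (lam : ℝ) (V : S → ℝ) (s : S) : ℝ :=
  (1 - lam) * ∑' m : ℕ, lam ^ m * (M.bellman μ)^[m + 1] V s

/-- `Π_{Λ,Ψ} V = Ψ (Ψᵀ Λ Ψ)⁻¹ Ψᵀ Λ V`, the projection onto the column space of `Ψ`. -/
def projLam (V : S → ℝ) : S → ℝ :=
  M.Psi (Matrix.toEuclideanCLM (𝕜 := ℝ) (M.form μ id)⁻¹ (M.PsiTLam μ V))

/-- The chain `S_k` is irreducible and aperiodic, `μ` is its unique stationary distribution, and
the rewards have the finite stationary fourth moment `rhat ^ 2`. -/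
structure ErgodicChain (rhat : ℝ) : Prop where
  irreducible : ∀ s t : S, ∃ n : ℕ, 0 < (M.stateKernel ^ n) s {t}
  aperiodic : ∀ (s : S) (p : ℕ),
    (∀ n : ℕ, 1 ≤ n → 0 < (M.stateKernel ^ n) s {s} → p ∣ n) → p = 1
  invariant : Kernel.Invariant M.stateKernel μ
  unique : ∀ ν : Measure S, IsProbabilityMeasure ν → Kernel.Invariant M.stateKernel ν → ν = μ
  rhat_nonneg : 0 ≤ rhat
  fourth_moment :
    ∫⁻ p, ENNReal.ofReal (M.R p.1 p.2 ^ 4) ∂(μ ⊗ₘ M.policyKernel) = ENNReal.ofReal (rhat ^ 2)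

/-- The columns of `Ψ` are linearly independent, and `μ`-square integrable with squared norms at
most `psihat ^ 2`. -/
structure FeatureMatrix (psihat : ℝ) : Prop where
  independent : ∀ θ : EuclideanSpace ℝ (Fin d), (∀ s, M.Psi θ s = 0) → θ = 0
  psihat_nonneg : 0 ≤ psihat
  bounded : ∀ j, ∫⁻ s, ENNReal.ofReal (M.ψ s j ^ 2) ∂μ ≤ ENNReal.ofReal (psihat ^ 2)

/-- Geometric convergence of the first and second order statistics of the chain to their
stationary values, with uniform moment bounds, from every initial state. Here
`(stateKernel ^ k) s₀ ⊗ₘ (stateKernel ^ m)` is the joint law of `(S_k, S_{k+m})`, and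
`(stateKernel ^ k) s₀ ⊗ₘ stateAction m` that of `(S_k, (S_{k+m}, A_{k+m}))`; the norm of the
matrix `u vᵀ` (`rankOne`) is the spectral norm. -/
structure StableChain (f₁ f₂ f₃ : S → ℝ) (ρ : ℝ) : Prop where
  rho_pos : 0 < ρ
  rho_lt_one : ρ < 1
  f₁_nonneg : ∀ s, 0 ≤ f₁ s
  f₂_nonneg : ∀ s, 0 ≤ f₂ s
  f₃_nonneg : ∀ s, 0 ≤ f₃ s
  reward : ∀ (s₀ : S) (k : ℕ),
    |∫ p, M.R p.1 p.2 ∂(M.stateAction k s₀) - ∫ s, M.Rpi s ∂μ| ≤ ρ ^ k * f₁ s₀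
  feature : ∀ (s₀ : S) (k : ℕ),
    ‖∫ s, M.ψ s ∂((M.stateKernel ^ k) s₀) - ∫ s, M.ψ s ∂μ‖ ≤ ρ ^ k * f₁ s₀
  feature_feature : ∀ (s₀ : S) (k m : ℕ),
    ‖∫ p, InnerProductSpace.rankOne ℝ (M.ψ p.1) (M.ψ p.2)
          ∂((M.stateKernel ^ k) s₀ ⊗ₘ (M.stateKernel ^ m))
        - ∫ p, InnerProductSpace.rankOne ℝ (M.ψ p.1) (M.ψ p.2) ∂(μ ⊗ₘ (M.stateKernel ^ m))‖
      ≤ ρ ^ k * f₁ s₀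
  feature_reward : ∀ (s₀ : S) (k m : ℕ),
    ‖∫ p, M.R p.2.1 p.2.2 • M.ψ p.1 ∂((M.stateKernel ^ k) s₀ ⊗ₘ M.stateAction m)
        - ∫ p, M.Rpi p.2 • M.ψ p.1 ∂(μ ⊗ₘ (M.stateKernel ^ m))‖ ≤ ρ ^ k * f₁ s₀
  moment_f₁ : ∀ (s₀ : S) (k : ℕ),
    ∫⁻ s, ENNReal.ofReal (f₁ s ^ 4) ∂((M.stateKernel ^ k) s₀) ≤ ENNReal.ofReal (f₂ s₀)
  moment_feature : ∀ (s₀ : S) (k : ℕ),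
    ∫⁻ s, ENNReal.ofReal (‖M.ψ s‖ ^ 4) ∂((M.stateKernel ^ k) s₀) ≤ ENNReal.ofReal (f₃ s₀)
  moment_reward : ∀ (s₀ : S) (k : ℕ),
    ∫⁻ p, ENNReal.ofReal (M.R p.1 p.2 ^ 4) ∂(M.stateAction k s₀) ≤ ENNReal.ofReal (f₃ s₀)

/-- `ψ' = ‖Ψᵀ Λ Ψ‖₂ = ‖E_μ[ψ(S_k) ψ(S_k)ᵀ]‖₂` (spectral norm). -/
def psiPrime : ℝ := ‖Matrix.toEuclideanCLM (𝕜 := ℝ) (M.form μ id)‖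

/-- The constant `ĝ(s₀, s₁)`, for a trace started at `z₀ = ψ(s₀)`. -/
def gHat (lam rhat psihat : ℝ) (f₂ f₃ : S → ℝ) (ρ : ℝ) (s₀ s₁ : S) : ℝ :=
  4 * ρ⁻¹ ^ 2 * √(f₂ s₁) / ((1 - lam) ^ 2 * (1 - ρ) ^ 2)
  + 16 * ρ⁻¹ ^ 2 * √(‖M.ψ s₀‖ ^ 4 + f₃ s₁) * √(f₂ s₀ + f₂ s₁)
      / ((1 - lam * ρ) ^ 2 * (1 - lam) ^ 2)
  + 4 * (1 + rhat + psihat * √d) ^ 2 * √(‖M.ψ s₀‖ ^ 4 + f₃ s₁) / (1 - lam) ^ 4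
  + 4 * (psihat + M.psiPrime μ + psihat * rhat * √d) ^ 2 / (1 - lam) ^ 4

end Kernels

end TDModel

/-- The constant `T̂`, as a function of the fourth moment bound `φ = f₃(s₀) + f₃(s₁)`. -/
def tdTHat (lam cα φ : ℝ) : ℝ := cα ^ 2 + √φ / (1 - lam) ^ 2 + 4 * φ / (1 - lam) ^ 2

/-- The constant `b̂`, as a function of the fourth moment bound `φ`. -/
def tdbHat (lam cα φ : ℝ) : ℝ := cα ^ 2 * √φ + φ / (1 - lam) ^ 2

end

/-! The chain `S_k` evolves without regard to the trace, and the trace obeys an affine recursion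
with factor λ < 1. Two facts follow. First, let φ be a square integrable function of the transition
and g its conditional mean given the current state. The expectation of φ z at time k + 1 unrolls to
λ^(k+1) (P^k g) z₀ + ∑_{i ≤ k} λ^i E[(P^i g)(S_{k-i}) ψ(S_{k-i})], with the chain counted from the
next state of the initial transition (`integral_transition_smul_trace`). Its stationary value is Ψᵀ
Λ ∑ λ^i P^i g, and the weights 1, R and (Ψθ)(s') - (Ψθ)(s) yield the blocks of T̄ and b̄. Second,
the initial trace is forgotten at rate λ^n.

Irreducibility makes every state an atom of μ, so P^n(s, ·) ≤ μ / μ{s} (`pow_le`). Whatever is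
μ-integrable is therefore integrable from every state at every time, and the identities hold at
every state rather than almost everywhere.

Stationary law: bounded functions that are Lipschitz in the trace determine a measure, and
forgetting makes any two invariant laws agree on them. For existence, start with stationary
transitions and zero trace. The laws are tight because the traces have bounded second moments, and
consecutive laws are asymptotically equal on the test functions, so every limit point is invariant.

Drift: the energy of V = Ψθ is (1 - λ) ∑ λ^m (‖V‖² - ⟨P^(m+1) V, V⟩) in L²(μ), with nonnegative
terms. If the first one vanishes, V is harmonic, hence constant by irreducibility, which forces θ =
0 on the complement of E_Ψ. Compactness of the sphere gives Δ, definiteness gives the unique θ*, and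
completing a square handles the coupling with r. The Bellman residual at θ* vanishes after Ψᵀ Λ: the
vector obtained lies in E_Ψ because its projection is zero, and is orthogonal to E_Ψ because the
residual has stationary mean zero.

Poisson equation: V_x is the series of E_y[F(x, Y_k)] - F̄(x). In the unrolled formula a
contribution of age i carries λ^i and its correlation has relaxed by ρ^(k-i), so the bounds sum to 1
/ ((1 - λ)(1 - ρ)). V_x is affine in x, so a bound for its linear part serves as A₂. All second
moments reduce to fourth moments by Cauchy-Schwarz; the trace keeps its fourth moment by convexity.
Stationary constants such as ψ' and r̄² are at most √f₃(s), being limits of expectations from s. -/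

set_option linter.unusedSectionVars false

/-! ### Integrable functions with a bound on the integral -/

/-- `f` is integrable and its integral is at most `c`. -/
def IntegralLE {α : Type*} [MeasurableSpace α] (τ : Measure α) (f : α → ℝ) (c : ℝ) : Prop :=
  Integrable f τ ∧ ∫ x, f x ∂τ ≤ c

namespace IntegralLE

variable {α β : Type*} [MeasurableSpace α] [MeasurableSpace β] {τ : Measure α} {f g : α → ℝ}
  {a b c : ℝ}

/-- The moment assumptions and the final bounds are lower integrals, for which a finite bound
includes integrability. This passage and `lintegral_le` allow Bochner arithmetic in between. -/
theorem of_lintegral (hf : Measurable f) (h0 : ∀ x, 0 ≤ f x) (hc : 0 ≤ c)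
    (h : ∫⁻ x, ENNReal.ofReal (f x) ∂τ ≤ ENNReal.ofReal c) : IntegralLE τ f c := by
  refine ⟨⟨hf.aestronglyMeasurable, ?_⟩, ?_⟩
  · rw [hasFiniteIntegral_iff_ofReal (Filter.Eventually.of_forall h0)]
    exact h.trans_lt ENNReal.ofReal_lt_top
  · rw [integral_eq_lintegral_of_nonneg_ae (Filter.Eventually.of_forall h0)
      hf.aestronglyMeasurable]
    exact ENNReal.toReal_le_of_le_ofReal hc h

theorem lintegral_le (h : IntegralLE τ f c) (h0 : ∀ x, 0 ≤ f x) :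
    ∫⁻ x, ENNReal.ofReal (f x) ∂τ ≤ ENNReal.ofReal c := by
  rw [← ofReal_integral_eq_lintegral_ofReal h.1 (Filter.Eventually.of_forall h0)]
  exact ENNReal.ofReal_le_ofReal h.2

theorem mono_const (h : IntegralLE τ f a) (hab : a ≤ b) : IntegralLE τ f b :=
  ⟨h.1, h.2.trans hab⟩

theorem add (hf : IntegralLE τ f a) (hg : IntegralLE τ g b) :
    IntegralLE τ (fun x => f x + g x) (a + b) :=
  ⟨hf.1.add hg.1, by rw [integral_add hf.1 hg.1]; exact add_le_add hf.2 hg.2⟩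

theorem const_mul (hf : IntegralLE τ f a) (hc : 0 ≤ c) :
    IntegralLE τ (fun x => c * f x) (c * a) :=
  ⟨hf.1.const_mul c, by rw [integral_const_mul]; exact mul_le_mul_of_nonneg_left hf.2 hc⟩

theorem const [IsProbabilityMeasure τ] (c : ℝ) : IntegralLE τ (fun _ => c) c :=
  ⟨integrable_const c, by simp⟩

theorem mono (hg : IntegralLE τ g c) (hf : Measurable f) (h0 : ∀ x, 0 ≤ f x)
    (h : ∀ x, f x ≤ g x) : IntegralLE τ f c := by
  have hi : Integrable f τ := hg.1.mono' hf.aestronglyMeasurable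
    (Filter.Eventually.of_forall fun x => by rw [Real.norm_of_nonneg (h0 x)]; exact h x)
  exact ⟨hi, (integral_mono hi hg.1 h).trans hg.2⟩

theorem nonneg (h : IntegralLE τ f c) (h0 : ∀ x, 0 ≤ f x) : 0 ≤ c :=
  (integral_nonneg h0).trans h.2

/-- The Cauchy-Schwarz inequality. -/
theorem mul (hf : IntegralLE τ (fun x => f x ^ 2) a) (hg : IntegralLE τ (fun x => g x ^ 2) b)
    (hfm : Measurable f) (hgm : Measurable g) (hf0 : ∀ x, 0 ≤ f x) (hg0 : ∀ x, 0 ≤ g x) :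
    IntegralLE τ (fun x => f x * g x) (√a * √b) := by
  have h2f : MemLp f 2 τ := (memLp_two_iff_integrable_sq hfm.aestronglyMeasurable).2 hf.1
  have h2g : MemLp g 2 τ := (memLp_two_iff_integrable_sq hgm.aestronglyMeasurable).2 hg.1
  refine ⟨h2f.integrable_mul h2g, ?_⟩
  have := integral_mul_le_Lp_mul_Lq_of_nonneg (μ := τ) Real.HolderConjugate.two_two
    (Filter.Eventually.of_forall hf0) (Filter.Eventually.of_forall hg0)
    (by simpa using h2f) (by simpa using h2g)
  refine this.trans ?_
  simp only [Real.rpow_two, ← Real.sqrt_eq_rpow]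
  exact mul_le_mul (Real.sqrt_le_sqrt hf.2) (Real.sqrt_le_sqrt hg.2) (Real.sqrt_nonneg _)
    (Real.sqrt_nonneg _)

/-- Every product that occurs later (the trace against a reward, a feature difference or a value of
f₁) has its second moment controlled in this way by two fourth moments. -/
theorem mul_sq (hf : IntegralLE τ (fun x => f x ^ 4) a) (hg : IntegralLE τ (fun x => g x ^ 4) b)
    (hfm : Measurable f) (hgm : Measurable g) :
    IntegralLE τ (fun x => f x ^ 2 * g x ^ 2) (√a * √b) := by
  refine IntegralLE.mul ?_ ?_ (hfm.pow_const 2) (hgm.pow_const 2) (fun _ => by positivity)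
    (fun _ => by positivity)
  · simpa only [← pow_mul] using hf
  · simpa only [← pow_mul] using hg

theorem sq [IsProbabilityMeasure τ] (hf : IntegralLE τ (fun x => f x ^ 4) a)
    (hfm : Measurable f) : IntegralLE τ (fun x => f x ^ 2) (√a) := by
  simpa using hf.mul_sq (IntegralLE.const (τ := τ) 1 |> fun h => by simpa using h :
    IntegralLE τ (fun _ => (1 : ℝ) ^ 4) 1) hfm measurable_const

theorem comp_map {φ : β → α} {σ : Measure β} (hφ : Measurable φ) (hf : Measurable f)
    (h : IntegralLE (σ.map φ) f c) : IntegralLE σ (fun x => f (φ x)) c := by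
  refine ⟨(integrable_map_measure hf.aestronglyMeasurable hφ.aemeasurable).1 h.1, ?_⟩
  rw [← integral_map hφ.aemeasurable hf.aestronglyMeasurable]; exact h.2

end IntegralLE

theorem abs_integral_mul_le_sqrt_mul_sqrt {α : Type*} [MeasurableSpace α] {τ : Measure α}
    {f g : α → ℝ} (hf : MemLp f 2 τ) (hg : MemLp g 2 τ) :
    ∫ x, |f x| * |g x| ∂τ ≤ √(∫ x, f x ^ 2 ∂τ) * √(∫ x, g x ^ 2 ∂τ) := by
  have := integral_mul_norm_le_Lp_mul_Lq (μ := τ) Real.HolderConjugate.two_two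
    (f := f) (g := g) (by simpa using hf) (by simpa using hg)
  simpa [Real.sqrt_eq_rpow] using this

section ToLp

variable {α E F : Type*} [MeasurableSpace α] {τ : Measure α}
  [NormedAddCommGroup E] [NormedSpace ℝ E] [NormedAddCommGroup F] [NormedSpace ℝ F]

theorem integrable_toLp_prod {f : α → E} {g : α → F} (hf : Integrable f τ) (hg : Integrable g τ) :
    Integrable (fun x => WithLp.toLp 2 (f x, g x)) τ :=
  (WithLp.prodContinuousLinearEquiv 2 ℝ E F).symm.toContinuousLinearMap.integrable_comp
    (hf.prodMk hg)

theorem integral_toLp_prod [CompleteSpace E] [CompleteSpace F] {f : α → E} {g : α → F} (hf : Integrable f τ) (hg : Integrable g τ) :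
    ∫ x, WithLp.toLp 2 (f x, g x) ∂τ = WithLp.toLp 2 (∫ x, f x ∂τ, ∫ x, g x ∂τ) := by
  rw [← integral_pair hf hg]
  exact (WithLp.prodContinuousLinearEquiv 2 ℝ E F).symm.integral_comp_comm fun x => (f x, g x)

end ToLp

/-! ### The Poisson equation of a Markov kernel -/

/-- The solution `∑ₖ (K^k G - c)` of the Poisson equation `v = G + K v - c`. -/
theorem poisson_tsum {Y E : Type*} [MeasurableSpace Y] [NormedAddCommGroup E] [NormedSpace ℝ E]
    [CompleteSpace E] (K : Kernel Y Y) [IsMarkovKernel K] {G : Y → E} {c : E}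
    (hG : StronglyMeasurable G) (hint : ∀ k y, Integrable G ((K ^ k) y))
    {κ : ℕ → Y → ℝ} {B : Y → ℝ} (hκ : ∀ k y, ‖∫ y', G y' ∂((K ^ k) y) - c‖ ≤ κ k y)
    (hB : ∀ y, HasSum (fun k => κ k y) (B y)) (hBint : ∀ y, Integrable B (K y)) :
    StronglyMeasurable (fun y => ∑' k, (∫ y', G y' ∂((K ^ k) y) - c)) ∧
    ∀ y, Integrable (fun y => ∑' k, (∫ y', G y' ∂((K ^ k) y) - c)) (K y) ∧
      ∑' k, (∫ y', G y' ∂((K ^ k) y) - c) =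
        G y + ∫ z, (∑' k, (∫ y', G y' ∂((K ^ k) z) - c)) ∂(K y) - c := by
  have hmeas : ∀ k, StronglyMeasurable fun y => ∫ y', G y' ∂((K ^ k) y) - c := fun k =>
    hG.integral_kernel.sub stronglyMeasurable_const
  have hsum : ∀ y, Summable fun k => ∫ y', G y' ∂((K ^ k) y) - c := fun y =>
    Summable.of_norm_bounded (hB y).summable fun k => hκ k y
  have hSM : StronglyMeasurable (fun y => ∑' k, (∫ y', G y' ∂((K ^ k) y) - c)) := by
    refine stronglyMeasurable_of_tendsto Filter.atTop
      (f := fun n y => ∑ k ∈ Finset.range n, (∫ y', G y' ∂((K ^ k) y) - c)) (fun n => ?_) ?_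
    · exact Finset.stronglyMeasurable_fun_sum _ fun k _ => hmeas k
    · rw [tendsto_pi_nhds]
      exact fun y => (hsum y).hasSum.tendsto_sum_nat
  refine ⟨hSM, fun y => ⟨?_, ?_⟩⟩
  · exact (hBint y).mono' hSM.aestronglyMeasurable
      (Filter.Eventually.of_forall fun z => tsum_of_norm_bounded (hB z) fun k => hκ k z)
  · have hle : ∀ z, ∑' k, ‖∫ y', G y' ∂((K ^ k) z) - c‖ₑ ≤ ENNReal.ofReal (B z) := by
      intro z
      have hn : Summable fun k => ‖∫ y', G y' ∂((K ^ k) z) - c‖ :=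
        Summable.of_nonneg_of_le (fun _ => norm_nonneg _) (fun k => hκ k z) (hB z).summable
      simp_rw [← ofReal_norm]
      rw [← ENNReal.ofReal_tsum_of_nonneg (fun _ => norm_nonneg _) hn]
      refine ENNReal.ofReal_le_ofReal ?_
      rw [← (hB z).tsum_eq]
      exact hn.tsum_le_tsum (fun k => hκ k z) (hB z).summable
    -- Integrating the series termwise against K shifts the index by one, so the two series differ
    -- by the term k = 0, which is G y - c. Integrability of B justifies the exchange.
    rw [integral_tsum (fun k => (hmeas k).aestronglyMeasurable), (hsum y).tsum_eq_zero_add]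
    · have h1 : ∀ k, ∫ z, (∫ y', G y' ∂((K ^ k) z) - c) ∂(K y)
          = ∫ y', G y' ∂((K ^ (k + 1)) y) - c := by
        intro k
        have hp : K ^ (k + 1) = (K ^ k) ∘ₖ K := pow_succ K k
        have hi : Integrable G (((K ^ k) ∘ₖ K) y) := hp ▸ hint (k + 1) y
        rw [integral_sub hi.integral_comp (integrable_const c), hp, Kernel.integral_comp hi]
        simp
      simp_rw [h1]
      have h0 : ∫ y', G y' ∂((K ^ 0) y) = G y := by
        have : (K ^ 0) y = Measure.dirac y := by rw [pow_zero]; exact Kernel.id_apply y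
        rw [this, integral_dirac' _ _ hG]
      rw [h0]; abel
    · rw [← lintegral_tsum fun k => (hmeas k).aestronglyMeasurable.enorm]
      refine ((lintegral_mono hle).trans_lt ?_).ne
      exact (hBint y).lintegral_lt_top

/-- The Cauchy product of two geometric series. It is applied with λ, for the age of a contribution
to the trace, and ρ, for the time its correlation has had to relax. -/
theorem hasSum_geometric_conv {a b : ℝ} (ha : 0 ≤ a) (ha1 : a < 1) (hb : 0 ≤ b) (hb1 : b < 1) :
    HasSum (fun n => ∑ i ∈ Finset.range (n + 1), a ^ i * b ^ (n - i)) ((1 - a)⁻¹ * (1 - b)⁻¹) := by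
  have h := hasSum_sum_range_mul_of_summable_norm (f := fun n => a ^ n) (g := fun n => b ^ n)
    (by simpa [abs_of_nonneg ha] using summable_geometric_of_lt_one ha ha1)
    (by simpa [abs_of_nonneg hb] using summable_geometric_of_lt_one hb hb1)
  rwa [tsum_geometric_of_lt_one ha ha1, tsum_geometric_of_lt_one hb hb1] at h

/-! ### Powers of a kernel -/

section KernelPowers

variable {α : Type*} [MeasurableSpace α]

instance instIsMarkovKernelPow (κ : Kernel α α) [IsMarkovKernel κ] (n : ℕ) :
    IsMarkovKernel (κ ^ n) := by
  induction n with
  | zero => rw [pow_zero]; exact inferInstanceAs (IsMarkovKernel Kernel.id)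
  | succ n ih => rw [pow_succ]; exact inferInstanceAs (IsMarkovKernel (_ ∘ₖ _))

theorem kernel_pow_zero_apply (κ : Kernel α α) (a : α) : (κ ^ 0) a = Measure.dirac a := by
  rw [pow_zero]; exact Kernel.id_apply a

theorem kernel_pow_succ_apply (κ : Kernel α α) (n : ℕ) (a : α) :
    (κ ^ (n + 1)) a = ((κ ^ n) a).bind κ := by
  rw [pow_succ']; exact Kernel.comp_apply _ _ _

theorem kernel_pow_add_apply (κ : Kernel α α) (m n : ℕ) (a : α) :
    (κ ^ (m + n)) a = ((κ ^ m) a).bind (κ ^ n) := by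
  rw [add_comm, pow_add]; exact Kernel.comp_apply _ _ _

theorem kernel_invariant_pow {κ : Kernel α α} {μ : Measure α} (h : Kernel.Invariant κ μ)
    (n : ℕ) : Kernel.Invariant (κ ^ n) μ := by
  induction n with
  | zero => rw [pow_zero]; exact Measure.id_comp
  | succ n ih => rw [pow_succ]; exact Kernel.Invariant.comp ih h

theorem integral_bind_kernel {β E : Type*} [MeasurableSpace β] [NormedAddCommGroup E]
    [NormedSpace ℝ E] {τ : Measure α} {κ : Kernel α β} {f : β → E}
    (hf : Integrable f (τ.bind κ)) :
    ∫ x, f x ∂(τ.bind κ) = ∫ a, ∫ x, f x ∂(κ a) ∂τ := by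
  have h : τ.bind κ = (κ ∘ₖ Kernel.const Unit τ) () := by
    rw [Kernel.comp_apply, Kernel.const_apply]
  rw [h] at hf ⊢
  rw [Kernel.integral_comp hf, Kernel.const_apply]

theorem integrable_integral_bind_kernel {β E : Type*} [MeasurableSpace β] [NormedAddCommGroup E]
    [NormedSpace ℝ E] {τ : Measure α} {κ : Kernel α β} {f : β → E}
    (hf : Integrable f (τ.bind κ)) : Integrable (fun a => ∫ x, f x ∂(κ a)) τ := by
  have h : τ.bind κ = (κ ∘ₖ Kernel.const Unit τ) () := by
    rw [Kernel.comp_apply, Kernel.const_apply]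
  rw [h] at hf
  simpa [Kernel.const_apply] using hf.integral_comp

end KernelPowers

/-! ### Laws of the transitions of the process -/

namespace TDModel

variable {S A : Type*} [Countable S] [MeasurableSpace S] [DiscreteMeasurableSpace S]
  [Fintype A] [MeasurableSpace A] [DiscreteMeasurableSpace A] {d : ℕ} (M : TDModel S A d)

instance : IsMarkovKernel M.stepKernel := by unfold stepKernel; infer_instance

instance : IsMarkovKernel M.stateKernel := by unfold stateKernel; infer_instance

/-- The transition `(S_k, A_k, S_{k+1})` of a state of the Markov process. -/
def transition (y : TDState S A d) : S × A × S := (y.1, y.2.1, y.2.2.1)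

omit [Countable S] [DiscreteMeasurableSpace S] [Fintype A] [DiscreteMeasurableSpace A] in
theorem measurable_transition : Measurable (transition : TDState S A d → S × A × S) := by
  unfold transition; fun_prop

theorem measurable_update (lam : ℝ) : Measurable fun p : TDState S A d × A × S =>
    ((p.1.2.2.1, p.2.1, p.2.2, lam • p.1.2.2.2 + M.ψ p.1.2.2.1) : TDState S A d) := by
  have : Measurable M.ψ := .of_discrete
  fun_prop

instance (lam : ℝ) : IsMarkovKernel (M.tdKernel lam) := by
  unfold tdKernel
  exact Kernel.IsMarkovKernel.map _ (M.measurable_update lam)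

theorem tdKernel_apply (lam : ℝ) (y : TDState S A d) :
    M.tdKernel lam y = (M.stepKernel y.2.2.1).map
      fun q => (y.2.2.1, q.1, q.2, lam • y.2.2.2 + M.ψ y.2.2.1) := by
  unfold tdKernel
  rw [Kernel.map_apply _ (M.measurable_update lam), Kernel.prod_apply, Kernel.id_apply,
    Measure.dirac_prod, Measure.map_map (M.measurable_update lam) measurable_prodMk_left,
    Kernel.comap_apply]
  rfl

theorem measurable_update_right (lam : ℝ) (y : TDState S A d) : Measurable fun q : A × S =>
    ((y.2.2.1, q.1, q.2, lam • y.2.2.2 + M.ψ y.2.2.1) : TDState S A d) := by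
  fun_prop

theorem integral_tdKernel {E : Type*} [NormedAddCommGroup E] [NormedSpace ℝ E] (lam : ℝ)
    (y : TDState S A d) {f : TDState S A d → E} (hf : StronglyMeasurable f) :
    ∫ y', f y' ∂(M.tdKernel lam y) = ∫ q, f (y.2.2.1, q.1, q.2, lam • y.2.2.2 + M.ψ y.2.2.1)
      ∂(M.stepKernel y.2.2.1) := by
  rw [tdKernel_apply, integral_map (M.measurable_update_right lam y).aemeasurable
    hf.aestronglyMeasurable]

theorem lintegral_tdKernel (lam : ℝ) (y : TDState S A d) {f : TDState S A d → ℝ≥0∞}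
    (hf : Measurable f) :
    ∫⁻ y', f y' ∂(M.tdKernel lam y) = ∫⁻ q, f (y.2.2.1, q.1, q.2, lam • y.2.2.2 + M.ψ y.2.2.1)
      ∂(M.stepKernel y.2.2.1) := by
  rw [tdKernel_apply, lintegral_map hf (M.measurable_update_right lam y)]

omit [Countable S] [DiscreteMeasurableSpace S] [Fintype A] [DiscreteMeasurableSpace A] in
theorem measurable_next : Measurable fun y : TDState S A d => y.2.2.1 := by fun_prop

/-- The trace does not feed back into the chain: the law of the new transition depends on the old
state only through its third coordinate. All laws of transitions can thus be computed from the chain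
alone. -/
theorem tdKernel_map_transition (lam : ℝ) :
    (M.tdKernel lam).map transition =
      (Kernel.id ×ₖ M.stepKernel).comap (fun y : TDState S A d => y.2.2.1) measurable_next := by
  ext1 y
  rw [Kernel.map_apply _ measurable_transition, tdKernel_apply, Kernel.comap_apply,
    Measure.map_map measurable_transition (M.measurable_update_right lam y), Kernel.prod_apply,
    Kernel.id_apply, Measure.dirac_prod]
  rfl

omit [Countable S] [DiscreteMeasurableSpace S] in
theorem bind_comap {α β γ : Type*} [MeasurableSpace α] [MeasurableSpace β] [MeasurableSpace γ]
    (τ : Measure α) (κ : Kernel β γ) {p : α → β} (hp : Measurable p) :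
    τ.bind (κ.comap p hp) = (τ.map p).bind κ := by
  ext s hs
  rw [Measure.bind_apply hs (Kernel.aemeasurable _), Measure.bind_apply hs (Kernel.aemeasurable _),
    lintegral_map (Kernel.measurable_coe κ hs) hp]
  rfl

theorem bind_tdKernel_map_transition (lam : ℝ) (τ : Measure (TDState S A d)) [SFinite τ] :
    (τ.bind (M.tdKernel lam)).map transition =
      (τ.map fun y => y.2.2.1) ⊗ₘ M.stepKernel := by
  rw [Measure.map_comp _ _ measurable_transition, tdKernel_map_transition, bind_comap,
    Measure.compProd_eq_comp_prod]

theorem bind_tdKernel_map_next (lam : ℝ) (τ : Measure (TDState S A d)) [SFinite τ] :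
    (τ.bind (M.tdKernel lam)).map (fun y => y.2.2.1) =
      (τ.map fun y => y.2.2.1).bind M.stateKernel := by
  have h : (fun y : TDState S A d => y.2.2.1) = (fun t : S × A × S => t.2.2) ∘ transition := rfl
  have h2 : Measurable (fun t : S × A × S => t.2.2) := by fun_prop
  conv_lhs => rw [h]
  rw [← Measure.map_map h2 measurable_transition, bind_tdKernel_map_transition]
  have h3 : (fun t : S × A × S => t.2.2) = Prod.snd ∘ Prod.snd := rfl
  rw [h3, ← Measure.map_map measurable_snd measurable_snd]
  change (((_ ⊗ₘ _ : Measure _)).snd).map Prod.snd = _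
  rw [Measure.snd_compProd, Measure.map_comp _ _ measurable_snd, ← Kernel.snd_eq]
  rfl

theorem tdKernel_pow_map_next (lam : ℝ) (k : ℕ) (y : TDState S A d) :
    ((M.tdKernel lam ^ k) y).map (fun y => y.2.2.1) = (M.stateKernel ^ k) y.2.2.1 := by
  induction k with
  | zero => rw [kernel_pow_zero_apply, kernel_pow_zero_apply, Measure.map_dirac' measurable_next]
  | succ k ih => rw [kernel_pow_succ_apply, kernel_pow_succ_apply, bind_tdKernel_map_next, ih]

/-- The exponent drops by one because the transition at time k + 1 starts k steps after the next
state of y. At time 0 the transition is prescribed, which is why that time is treated apart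
throughout. -/
theorem tdKernel_pow_succ_map_transition (lam : ℝ) (k : ℕ) (y : TDState S A d) :
    ((M.tdKernel lam ^ (k + 1)) y).map transition =
      (M.stateKernel ^ k) y.2.2.1 ⊗ₘ M.stepKernel := by
  rw [kernel_pow_succ_apply, bind_tdKernel_map_transition, tdKernel_pow_map_next]

theorem stateAction_apply (n : ℕ) (s : S) :
    M.stateAction n s = (M.stateKernel ^ n) s ⊗ₘ M.policyKernel := by
  unfold stateAction
  rw [Kernel.compProd_apply_eq_compProd_sectR]
  rfl

theorem compProd_stepKernel_map_stateAction (τ : Measure S) [SFinite τ] :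
    (τ ⊗ₘ M.stepKernel).map (fun t => (t.1, t.2.1)) = τ ⊗ₘ M.policyKernel := by
  have hm : Measurable fun t : S × A × S => (t.1, t.2.1) := by fun_prop
  ext s hs
  rw [Measure.map_apply hm hs, Measure.compProd_apply (hm hs), Measure.compProd_apply hs]
  refine lintegral_congr fun a => ?_
  have h1 : M.stepKernel a = M.policyKernel a ⊗ₘ (M.transKernel.sectR a) := by
    unfold stepKernel; rw [Kernel.compProd_apply_eq_compProd_sectR]
  have h2 := Measure.fst_compProd (M.policyKernel a) (M.transKernel.sectR a)
  conv_rhs => rw [← h2, Measure.fst_apply (measurable_prodMk_left hs)]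
  rw [h1]
  rfl

theorem stepKernel_map_snd (s : S) : (M.stepKernel s).map Prod.snd = M.stateKernel s := by
  unfold stateKernel; rw [Kernel.snd_apply]

theorem stepKernel_map_fst (s : S) : (M.stepKernel s).map Prod.fst = M.policyKernel s := by
  have h1 : M.stepKernel s = M.policyKernel s ⊗ₘ (M.transKernel.sectR s) := by
    unfold stepKernel; rw [Kernel.compProd_apply_eq_compProd_sectR]
  rw [h1]
  exact Measure.fst_compProd (M.policyKernel s) (M.transKernel.sectR s)

theorem compProd_stepKernel_map_next (τ : Measure S) [SFinite τ] :
    (τ ⊗ₘ M.stepKernel).map (fun t => t.2.2) = τ.bind M.stateKernel := by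
  have h3 : (fun t : S × A × S => t.2.2) = Prod.snd ∘ Prod.snd := rfl
  rw [h3, ← Measure.map_map measurable_snd measurable_snd]
  change (((_ ⊗ₘ _ : Measure _)).snd).map Prod.snd = _
  rw [Measure.snd_compProd, Measure.map_comp _ _ measurable_snd, ← Kernel.snd_eq]
  rfl

theorem integral_policyKernel (f : A → ℝ) (s : S) :
    ∫ a, f a ∂(M.policyKernel s) = ∑ a, (M.policy s a).toReal * f a := by
  have : M.policyKernel s = (M.policy s).toMeasure := rfl
  rw [this, PMF.integral_eq_sum]; rfl

theorem integral_reward_policyKernel (s : S) :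
    ∫ a, M.R s a ∂(M.policyKernel s) = M.Rpi s :=
  M.integral_policyKernel _ s

/-! ### Domination by the stationary distribution, and contraction in L² -/

section Invariant

variable {M} {μ : Measure S} [IsProbabilityMeasure μ] {rhat : ℝ}

/-- Some state t has positive mass; irreducibility gives n with P^n(t, s) > 0, and invariance under
P^n carries mass from t to s. -/
theorem ErgodicChain.measure_singleton_pos (h : M.ErgodicChain μ rhat) (s : S) :
    μ {s} ≠ 0 := by
  obtain ⟨t, ht⟩ : ∃ t, μ {t} ≠ 0 := by
    by_contra! hc
    have : μ Set.univ = 0 := by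
      rw [← Set.iUnion_of_singleton S]
      exact measure_iUnion_null hc
    simp at this
  obtain ⟨n, hn⟩ := h.irreducible t s
  have hi := (kernel_invariant_pow h.invariant n).def
  rw [← hi, Measure.bind_apply (measurableSet_singleton s) (Kernel.aemeasurable _)]
  intro h0
  rw [lintegral_eq_zero_iff (Kernel.measurable_coe _ (measurableSet_singleton s))] at h0
  have := (ae_iff.1 h0)
  have h2 : μ {t} = 0 := measure_mono_null (by
    intro x hx; rw [Set.mem_singleton_iff] at hx; subst hx; exact hn.ne') this
  exact ht h2

/-- Keep only the term of s in μ = μ P^n. This domination turns integrability under μ into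
integrability from every initial state, at every time. -/
theorem ErgodicChain.pow_le (h : M.ErgodicChain μ rhat) (n : ℕ) (s : S) :
    (M.stateKernel ^ n) s ≤ (μ {s})⁻¹ • μ := by
  have hs := h.measure_singleton_pos s
  refine Measure.le_iff.2 fun B hB => ?_
  rw [Measure.smul_apply, smul_eq_mul]
  have hi := (kernel_invariant_pow h.invariant n).def
  have h1 : μ {s} * (M.stateKernel ^ n) s B ≤ μ B := by
    conv_rhs => rw [← hi, Measure.bind_apply hB (Kernel.aemeasurable _)]
    calc μ {s} * (M.stateKernel ^ n) s B
        = ∫⁻ x in {s}, (M.stateKernel ^ n) x B ∂μ := by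
          rw [Measure.restrict_singleton, lintegral_smul_measure, lintegral_dirac, smul_eq_mul]
      _ ≤ _ := setLIntegral_le_lintegral _ _
  calc (M.stateKernel ^ n) s B = (μ {s})⁻¹ * (μ {s} * (M.stateKernel ^ n) s B) := by
        rw [← mul_assoc, ENNReal.inv_mul_cancel hs (measure_ne_top _ _), one_mul]
    _ ≤ _ := by gcongr

theorem ErgodicChain.inv_ne_top (h : M.ErgodicChain μ rhat) (s : S) : (μ {s})⁻¹ ≠ ∞ :=
  ENNReal.inv_ne_top.2 (h.measure_singleton_pos s)

theorem ErgodicChain.compProd_le {β : Type*} [MeasurableSpace β] (h : M.ErgodicChain μ rhat)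
    (κ : Kernel S β) [IsSFiniteKernel κ] (n : ℕ) (s : S) :
    (M.stateKernel ^ n) s ⊗ₘ κ ≤ (μ {s})⁻¹ • (μ ⊗ₘ κ) := by
  refine Measure.le_iff.2 fun B hB => ?_
  rw [Measure.smul_apply, Measure.compProd_apply hB, Measure.compProd_apply hB,
    ← lintegral_smul_measure]
  exact lintegral_mono' (h.pow_le n s) le_rfl

theorem ErgodicChain.integrable_pow {E : Type*} [NormedAddCommGroup E]
    (h : M.ErgodicChain μ rhat) {f : S → E} (hf : Integrable f μ) (n : ℕ) (s : S) :
    Integrable f ((M.stateKernel ^ n) s) :=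
  hf.of_measure_le_smul (h.inv_ne_top s) (h.pow_le n s)

theorem ErgodicChain.memLp_pow {E : Type*} [NormedAddCommGroup E] {p : ℝ≥0∞}
    (h : M.ErgodicChain μ rhat) {f : S → E} (hf : MemLp f p μ) (n : ℕ) (s : S) :
    MemLp f p ((M.stateKernel ^ n) s) :=
  hf.of_measure_le_smul (h.inv_ne_top s) (h.pow_le n s)

theorem powP_zero (V : S → ℝ) (s : S) : M.powP 0 V s = V s := by
  unfold powP; rw [kernel_pow_zero_apply, integral_dirac]

theorem ErgodicChain.integrable_powP (h : M.ErgodicChain μ rhat) {V : S → ℝ}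
    (hV : Integrable V μ) (n : ℕ) : Integrable (M.powP n V) μ := by
  have hi := (kernel_invariant_pow h.invariant n).def
  exact integrable_integral_bind_kernel (by rwa [hi])

theorem ErgodicChain.integral_powP (h : M.ErgodicChain μ rhat) {V : S → ℝ}
    (hV : Integrable V μ) (n : ℕ) : ∫ s, M.powP n V s ∂μ = ∫ s, V s ∂μ := by
  have hi := (kernel_invariant_pow h.invariant n).def
  conv_rhs => rw [← hi]
  exact (integral_bind_kernel (by rwa [hi])).symm

theorem ErgodicChain.powP_add (h : M.ErgodicChain μ rhat) {V : S → ℝ}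
    (hV : Integrable V μ) (m n : ℕ) (s : S) : M.powP (m + n) V s = M.powP m (M.powP n V) s := by
  have hi := h.integrable_pow hV (m + n) s
  have : M.powP (m + n) V s = ∫ t, V t ∂((M.stateKernel ^ (m + n)) s) := rfl
  rw [this]
  rw [kernel_pow_add_apply] at hi ⊢
  exact integral_bind_kernel hi

theorem ErgodicChain.powP_sub (h : M.ErgodicChain μ rhat) {V W : S → ℝ}
    (hV : Integrable V μ) (hW : Integrable W μ) (n : ℕ) (s : S) :
    M.powP n (fun t => V t - W t) s = M.powP n V s - M.powP n W s :=
  integral_sub (h.integrable_pow hV n s) (h.integrable_pow hW n s)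

theorem ErgodicChain.powP_add_fun (h : M.ErgodicChain μ rhat) {V W : S → ℝ}
    (hV : Integrable V μ) (hW : Integrable W μ) (n : ℕ) (s : S) :
    M.powP n (fun t => V t + W t) s = M.powP n V s + M.powP n W s :=
  integral_add (h.integrable_pow hV n s) (h.integrable_pow hW n s)

theorem powP_const (c : ℝ) (n : ℕ) (s : S) : M.powP n (fun _ => c) s = c := by
  simp [powP]

/-- The squared `L²`-norm of `P^n V` is at most that of `V`. -/
theorem powP_sq_le {V : S → ℝ} {n : ℕ} {s : S} (hV : MemLp V 2 ((M.stateKernel ^ n) s)) :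
    M.powP n V s ^ 2 ≤ M.powP n (fun t => V t ^ 2) s := by
  have h := variance_nonneg V ((M.stateKernel ^ n) s)
  rw [variance_eq_sub hV] at h
  have h2 : M.powP n (fun t => V t ^ 2) s = ((M.stateKernel ^ n) s)[V ^ 2] := rfl
  rw [h2]; unfold powP; linarith

theorem ErgodicChain.memLp_powP (h : M.ErgodicChain μ rhat) {V : S → ℝ}
    (hV : MemLp V 2 μ) (n : ℕ) : MemLp (M.powP n V) 2 μ := by
  have hsm : AEStronglyMeasurable (M.powP n V) μ := StronglyMeasurable.of_discrete.aestronglyMeasurable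
  rw [memLp_two_iff_integrable_sq hsm]
  refine (h.integrable_powP hV.integrable_sq n).mono' ?_ (Filter.Eventually.of_forall fun s => ?_)
  · exact StronglyMeasurable.of_discrete.aestronglyMeasurable
  · rw [Real.norm_of_nonneg (sq_nonneg _)]
    exact powP_sq_le (h.memLp_pow hV n s)

theorem ErgodicChain.integral_powP_sq_le (h : M.ErgodicChain μ rhat) {V : S → ℝ}
    (hV : MemLp V 2 μ) (n : ℕ) : ∫ s, M.powP n V s ^ 2 ∂μ ≤ ∫ s, V s ^ 2 ∂μ := by
  rw [← h.integral_powP hV.integrable_sq n]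
  exact integral_mono (h.memLp_powP hV n).integrable_sq (h.integrable_powP hV.integrable_sq n)
    fun s => powP_sq_le (h.memLp_pow hV n s)

/-- The functions `P^n V` are bounded at each state, uniformly in `n`. -/
theorem ErgodicChain.abs_powP_le (h : M.ErgodicChain μ rhat) {V : S → ℝ}
    (hV : Integrable V μ) (s : S) : ∃ C, ∀ n, |M.powP n V s| ≤ C := by
  refine ⟨∫ t, ‖V t‖ ∂((μ {s})⁻¹ • μ), fun n => ?_⟩
  refine (norm_integral_le_integral_norm (μ := (M.stateKernel ^ n) s) V).trans ?_
  exact integral_mono_measure (h.pow_le n s) (Filter.Eventually.of_forall fun _ => norm_nonneg _)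
    (hV.norm.smul_measure (h.inv_ne_top s))

end Invariant

end TDModel

/-! ### Conditional expectations and series of integrable functions -/

theorem integrable_integral_compProd {α β E : Type*} [MeasurableSpace α] [MeasurableSpace β]
    [NormedAddCommGroup E] [NormedSpace ℝ E]
    {τ : Measure α} [SFinite τ] {κ : Kernel α β} [IsSFiniteKernel κ]
    {f : α × β → E} (hf : Integrable f (τ ⊗ₘ κ)) :
    Integrable (fun a => ∫ b, f (a, b) ∂(κ a)) τ := by
  rw [Measure.compProd] at hf
  simpa using hf.integral_compProd

/-- Conditional expectations contract the `L²`-norm. -/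
theorem memLp_two_integral_kernel {α β : Type*} [MeasurableSpace α] [MeasurableSpace β]
    {τ : Measure α} [IsProbabilityMeasure τ] {κ : Kernel α β} [IsMarkovKernel κ]
    {f : α × β → ℝ} (hf : MemLp f 2 (τ ⊗ₘ κ)) :
    MemLp (fun a => ∫ b, f (a, b) ∂(κ a)) 2 τ ∧
      ∫ a, (∫ b, f (a, b) ∂(κ a)) ^ 2 ∂τ ≤ ∫ p, f p ^ 2 ∂(τ ⊗ₘ κ) := by
  have h2 := hf.integrable_sq
  have h1 : Integrable f (τ ⊗ₘ κ) := hf.integrable one_le_two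
  have hsm : AEStronglyMeasurable (fun a => ∫ b, f (a, b) ∂(κ a)) τ :=
    (integrable_integral_compProd h1).aestronglyMeasurable
  have hae : ∀ᵐ a ∂τ, (∫ b, f (a, b) ∂(κ a)) ^ 2 ≤ ∫ b, f (a, b) ^ 2 ∂(κ a) := by
    have e1 := ((Measure.integrable_compProd_iff h2.aestronglyMeasurable).1 h2).1
    have e2 := ((Measure.integrable_compProd_iff h1.aestronglyMeasurable).1 h1).1
    filter_upwards [e1, e2] with a ha1 ha2
    have hm : MemLp (fun b => f (a, b)) 2 (κ a) :=
      (memLp_two_iff_integrable_sq ha2.aestronglyMeasurable).2 ha1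
    have h := variance_nonneg (fun b => f (a, b)) (κ a)
    rw [variance_eq_sub hm] at h
    have h3 : (κ a)[(fun b => f (a, b)) ^ 2] = ∫ b, f (a, b) ^ 2 ∂(κ a) := rfl
    rw [h3] at h
    linarith
  have hi : Integrable (fun a => ∫ b, f (a, b) ^ 2 ∂(κ a)) τ := by
    refine ((Measure.integrable_compProd_iff h2.aestronglyMeasurable).1 h2).2.congr ?_
    refine Filter.Eventually.of_forall fun a => ?_
    refine integral_congr_ae (Filter.Eventually.of_forall fun b => ?_)
    simp
  have hi2 : Integrable (fun a => (∫ b, f (a, b) ∂(κ a)) ^ 2) τ := by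
    refine hi.mono' (hsm.pow 2) ?_
    filter_upwards [hae] with a ha
    rwa [Real.norm_of_nonneg (sq_nonneg _)]
  refine ⟨(memLp_two_iff_integrable_sq hsm).2 hi2, ?_⟩
  rw [Measure.integral_compProd h2]
  exact integral_mono_ae hi2 hi hae

theorem integrable_tsum {α E : Type*} [MeasurableSpace α] [NormedAddCommGroup E]
    [NormedSpace ℝ E] [CompleteSpace E] {τ : Measure α} {F : ℕ → α → E}
    (hF : ∀ i, Integrable (F i) τ) (hs : Summable fun i => ∫ a, ‖F i a‖ ∂τ)
    (hp : ∀ a, Summable fun i => F i a) : Integrable (fun a => ∑' i, F i a) τ := by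
  have hsm : AEStronglyMeasurable (fun a => ∑' i, F i a) τ := by
    refine aestronglyMeasurable_of_tendsto_ae Filter.atTop
      (f := fun n a => ∑ k ∈ Finset.range n, F k a) (fun n => ?_)
      (Filter.Eventually.of_forall fun a => (hp a).hasSum.tendsto_sum_nat)
    exact Finset.aestronglyMeasurable_fun_sum _ fun k _ => (hF k).aestronglyMeasurable
  refine ⟨hsm, ?_⟩
  rw [hasFiniteIntegral_iff_enorm]
  calc ∫⁻ a, ‖∑' i, F i a‖ₑ ∂τ ≤ ∫⁻ a, ∑' i, ‖F i a‖ₑ ∂τ := lintegral_mono fun a => enorm_tsum_le_tsum_enorm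
    _ = ∑' i, ∫⁻ a, ‖F i a‖ₑ ∂τ := lintegral_tsum fun i => (hF i).aestronglyMeasurable.enorm
    _ = ∑' i, ENNReal.ofReal (∫ a, ‖F i a‖ ∂τ) := by
        congr 1; ext i; rw [ofReal_integral_norm_eq_lintegral_enorm (hF i)]
    _ < ∞ := by
        rw [← ENNReal.ofReal_tsum_of_nonneg (fun i => integral_nonneg fun _ => norm_nonneg _) hs]
        exact ENNReal.ofReal_lt_top

/-! ### Stationary second moments of rewards and features -/

namespace TDModel

variable {S A : Type*} [Countable S] [MeasurableSpace S] [DiscreteMeasurableSpace S]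
  [Fintype A] [MeasurableSpace A] [DiscreteMeasurableSpace A] {d : ℕ} {M : TDModel S A d}
  {μ : Measure S} [IsProbabilityMeasure μ] {rhat psihat lam : ℝ}

/-- Every state is an atom of μ, so a null set of states is empty. -/
theorem ErgodicChain.eq_of_ae_eq {β : Type*} (h : M.ErgodicChain μ rhat) {f g : S → β}
    (hfg : f =ᵐ[μ] g) (s : S) : f s = g s := by
  by_contra hne
  exact h.measure_singleton_pos s (measure_mono_null (by
    intro x hx; rw [Set.mem_singleton_iff] at hx; subst hx; exact hne) (ae_iff.1 hfg))

theorem ErgodicChain.integralLE_reward_fourth (h : M.ErgodicChain μ rhat) :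
    IntegralLE (μ ⊗ₘ M.policyKernel) (fun p => M.R p.1 p.2 ^ 4) (rhat ^ 2) :=
  IntegralLE.of_lintegral .of_discrete (fun _ => by positivity) (sq_nonneg _) h.fourth_moment.le

theorem ErgodicChain.integralLE_reward_sq (h : M.ErgodicChain μ rhat) :
    IntegralLE (μ ⊗ₘ M.policyKernel) (fun p => M.R p.1 p.2 ^ 2) rhat := by
  have := h.integralLE_reward_fourth.sq .of_discrete
  rwa [Real.sqrt_sq h.rhat_nonneg] at this

theorem ErgodicChain.memLp_reward (h : M.ErgodicChain μ rhat) :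
    MemLp (fun p : S × A => M.R p.1 p.2) 2 (μ ⊗ₘ M.policyKernel) :=
  (memLp_two_iff_integrable_sq StronglyMeasurable.of_discrete.aestronglyMeasurable).2
    h.integralLE_reward_sq.1

theorem ErgodicChain.memLp_Rpi (h : M.ErgodicChain μ rhat) : MemLp M.Rpi 2 μ := by
  have := (memLp_two_integral_kernel h.memLp_reward).1
  simpa only [integral_reward_policyKernel] using this

theorem ErgodicChain.integral_Rpi_sq_le (h : M.ErgodicChain μ rhat) :
    ∫ s, M.Rpi s ^ 2 ∂μ ≤ rhat := by
  have := (memLp_two_integral_kernel h.memLp_reward).2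
  simp only [integral_reward_policyKernel] at this
  exact this.trans h.integralLE_reward_sq.2

theorem sq_integral_le {α : Type*} [MeasurableSpace α] {τ : Measure α} [IsProbabilityMeasure τ]
    {f : α → ℝ} (hf : MemLp f 2 τ) : (∫ x, f x ∂τ) ^ 2 ≤ ∫ x, f x ^ 2 ∂τ := by
  have h := variance_nonneg f τ
  rw [variance_eq_sub hf] at h
  have h2 : τ[f ^ 2] = ∫ x, f x ^ 2 ∂τ := rfl
  linarith

theorem ErgodicChain.abs_rbar_le (h : M.ErgodicChain μ rhat) : |M.rbar μ| ≤ √rhat := by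
  apply Real.abs_le_sqrt
  exact (sq_integral_le h.memLp_Rpi).trans h.integral_Rpi_sq_le

section Features

theorem FeatureMatrix.integralLE_sq (hf : M.FeatureMatrix μ psihat) (j : Fin d) :
    IntegralLE μ (fun s => M.ψ s j ^ 2) (psihat ^ 2) :=
  IntegralLE.of_lintegral .of_discrete (fun _ => sq_nonneg _) (sq_nonneg _) (hf.bounded j)

theorem FeatureMatrix.integrable_norm_sq (hf : M.FeatureMatrix μ psihat) :
    Integrable (fun s => ‖M.ψ s‖ ^ 2) μ := by
  simp_rw [EuclideanSpace.real_norm_sq_eq]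
  exact integrable_finsetSum _ fun j _ => (hf.integralLE_sq j).1

theorem FeatureMatrix.integral_norm_sq_le (hf : M.FeatureMatrix μ psihat) :
    ∫ s, ‖M.ψ s‖ ^ 2 ∂μ ≤ d * psihat ^ 2 := by
  simp_rw [EuclideanSpace.real_norm_sq_eq]
  rw [integral_finsetSum _ fun j _ => (hf.integralLE_sq j).1]
  refine (Finset.sum_le_sum fun j _ => (hf.integralLE_sq j).2).trans ?_
  simp

theorem FeatureMatrix.memLp (hf : M.FeatureMatrix μ psihat) : MemLp M.ψ 2 μ :=
  (memLp_two_iff_integrable_sq_norm StronglyMeasurable.of_discrete.aestronglyMeasurable).2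
    hf.integrable_norm_sq

theorem FeatureMatrix.memLp_Psi (hf : M.FeatureMatrix μ psihat)
    (θ : EuclideanSpace ℝ (Fin d)) : MemLp (M.Psi θ) 2 μ := by
  refine (hf.memLp.norm.const_mul ‖θ‖).mono' StronglyMeasurable.of_discrete.aestronglyMeasurable
    (Filter.Eventually.of_forall fun s => ?_)
  rw [mul_comm]
  exact norm_inner_le_norm _ _

theorem FeatureMatrix.integrable_smul (hf : M.FeatureMatrix μ psihat) {V : S → ℝ}
    (hV : MemLp V 2 μ) : Integrable (fun s => V s • M.ψ s) μ :=
  memLp_one_iff_integrable.1 (hf.memLp.smul (p := 2) (q := 2) (r := 1) hV)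

theorem inner_PsiTLam {V : S → ℝ}
    (hV : Integrable (fun s => V s • M.ψ s) μ) (u : EuclideanSpace ℝ (Fin d)) :
    ⟪u, M.PsiTLam μ V⟫_ℝ = ∫ s, V s * M.Psi u s ∂μ := by
  unfold PsiTLam
  rw [← integral_inner hV]
  refine integral_congr_ae (Filter.Eventually.of_forall fun s => ?_)
  simp only [inner_smul_right, Psi, real_inner_comm]

/-- `L` is not assumed linear, so the combination of columns stays outside of it. For the drift,
linearity is supplied by `resolvent_sum`. -/
theorem form_apply {L : (S → ℝ) → S → ℝ}
    (hL : ∀ j, Integrable (fun s => L (fun t => M.ψ t j) s • M.ψ s) μ)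
    (θ : EuclideanSpace ℝ (Fin d)) :
    Matrix.toEuclideanCLM (𝕜 := ℝ) (M.form μ L) θ =
      M.PsiTLam μ (fun s => ∑ j, θ j * L (fun t => M.ψ t j) s) := by
  have hL2 : ∀ j i, Integrable (fun s => M.ψ s i * L (fun t => M.ψ t j) s) μ := by
    intro j i
    have := (EuclideanSpace.proj (𝕜 := ℝ) i : EuclideanSpace ℝ (Fin d) →L[ℝ] ℝ).integrable_comp
      (hL j)
    refine this.congr (Filter.Eventually.of_forall fun s => ?_)
    simp [mul_comm]
  have hsum : Integrable (fun s => (∑ j, θ j * L (fun t => M.ψ t j) s) • M.ψ s) μ := by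
    simp_rw [Finset.sum_smul, mul_smul]
    exact integrable_finsetSum _ fun j _ => (hL j).smul (θ j)
  ext i
  have h1 : (M.PsiTLam μ (fun s => ∑ j, θ j * L (fun t => M.ψ t j) s)) i =
      ∫ s, (∑ j, θ j * L (fun t => M.ψ t j) s) * M.ψ s i ∂μ := by
    unfold PsiTLam
    exact ((EuclideanSpace.proj (𝕜 := ℝ) i :
      EuclideanSpace ℝ (Fin d) →L[ℝ] ℝ).integral_comp_comm hsum).symm
  rw [h1]
  have h2 : (Matrix.toEuclideanCLM (𝕜 := ℝ) (M.form μ L) θ) i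
      = ∑ j, (∫ s, M.ψ s i * L (fun t => M.ψ t j) s ∂μ) * θ j := by
    rw [Matrix.ofLp_toEuclideanCLM]; rfl
  rw [h2]
  simp_rw [Finset.sum_mul]
  rw [integral_finsetSum]
  · refine Finset.sum_congr rfl fun j _ => ?_
    rw [← integral_mul_const]
    congr 1; ext s; ring
  · intro j _
    refine ((hL2 j i).const_mul (θ j)).congr (Filter.Eventually.of_forall fun s => ?_)
    simp only; ring

theorem Psi_eq_sum (θ : EuclideanSpace ℝ (Fin d)) (s : S) :
    M.Psi θ s = ∑ j, θ j * M.ψ s j := by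
  simp [Psi, PiLp.inner_apply]

theorem FeatureMatrix.memLp_coord (hf : M.FeatureMatrix μ psihat) (j : Fin d) :
    MemLp (fun s => M.ψ s j) 2 μ :=
  (memLp_two_iff_integrable_sq StronglyMeasurable.of_discrete.aestronglyMeasurable).2
    (hf.integralLE_sq j).1

theorem FeatureMatrix.gram_apply (hf : M.FeatureMatrix μ psihat)
    (θ : EuclideanSpace ℝ (Fin d)) :
    Matrix.toEuclideanCLM (𝕜 := ℝ) (M.form μ id) θ = M.PsiTLam μ (M.Psi θ) := by
  rw [form_apply fun j => hf.integrable_smul (hf.memLp_coord j)]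
  refine congrArg _ (funext fun s => ?_)
  rw [Psi_eq_sum]; rfl

theorem FeatureMatrix.integral_Psi_sq (hf : M.FeatureMatrix μ psihat)
    (θ : EuclideanSpace ℝ (Fin d)) : ∫ s, M.Psi θ s ^ 2 ∂μ ≤ M.psiPrime μ * ‖θ‖ ^ 2 := by
  have h : ∫ s, M.Psi θ s ^ 2 ∂μ = ⟪θ, Matrix.toEuclideanCLM (𝕜 := ℝ) (M.form μ id) θ⟫_ℝ := by
    rw [hf.gram_apply, inner_PsiTLam (hf.integrable_smul (hf.memLp_Psi θ))]
    congr 1; ext s; ring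
  rw [h]
  refine (real_inner_le_norm _ _).trans ?_
  have := (Matrix.toEuclideanCLM (𝕜 := ℝ) (M.form μ id)).le_opNorm θ
  calc _ ≤ ‖θ‖ * (M.psiPrime μ * ‖θ‖) := by unfold psiPrime; gcongr
    _ = _ := by ring

theorem psiPrime_nonneg : 0 ≤ M.psiPrime μ := norm_nonneg _

/-- Pair u = Ψᵀ Λ V with itself: ‖u‖² = ∫ V · Ψu ≤ ‖V‖ ‖Ψu‖ in L²(μ), where ‖Ψu‖ ≤ √ψ' ‖u‖ by the
Gram matrix; then cancel ‖u‖. -/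
theorem FeatureMatrix.norm_PsiTLam_le (hf : M.FeatureMatrix μ psihat) {V : S → ℝ}
    (hV : MemLp V 2 μ) : ‖M.PsiTLam μ V‖ ≤ √(M.psiPrime μ) * √(∫ s, V s ^ 2 ∂μ) := by
  set u := M.PsiTLam μ V with hu
  have h1 : ‖u‖ ^ 2 ≤ √(∫ s, V s ^ 2 ∂μ) * (√(M.psiPrime μ) * ‖u‖) := by
    rw [← real_inner_self_eq_norm_sq]
    conv_lhs => rw [hu]
    rw [inner_PsiTLam (hf.integrable_smul hV)]
    refine (le_abs_self _).trans ((abs_integral_le_integral_abs).trans ?_)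
    simp_rw [abs_mul]
    refine (abs_integral_mul_le_sqrt_mul_sqrt hV (hf.memLp_Psi u)).trans ?_
    refine mul_le_mul_of_nonneg_left ?_ (Real.sqrt_nonneg _)
    refine (Real.sqrt_le_sqrt (hf.integral_Psi_sq u)).trans_eq ?_
    rw [Real.sqrt_mul psiPrime_nonneg, Real.sqrt_sq (norm_nonneg _)]
  rcases (norm_nonneg u).eq_or_lt with h0 | h0
  · rw [← h0]; positivity
  · nlinarith

/-- The feature weighted by its correlation with `P^m g`. -/
theorem ErgodicChain.norm_PsiTLam_powP_le (hc : M.ErgodicChain μ rhat)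
    (hf : M.FeatureMatrix μ psihat) {V : S → ℝ} (hV : MemLp V 2 μ) (m : ℕ) :
    ‖M.PsiTLam μ (M.powP m V)‖ ≤ √(M.psiPrime μ) * √(∫ s, V s ^ 2 ∂μ) :=
  (hf.norm_PsiTLam_le (hc.memLp_powP hV m)).trans
    (mul_le_mul_of_nonneg_left (Real.sqrt_le_sqrt (hc.integral_powP_sq_le hV m))
      (Real.sqrt_nonneg _))

theorem PsiTLam_add {V W : S → ℝ}
    (hV : Integrable (fun s => V s • M.ψ s) μ) (hW : Integrable (fun s => W s • M.ψ s) μ) :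
    M.PsiTLam μ (fun s => V s + W s) = M.PsiTLam μ V + M.PsiTLam μ W := by
  unfold PsiTLam; simp_rw [add_smul]; exact integral_add hV hW

theorem PsiTLam_sub {V W : S → ℝ}
    (hV : Integrable (fun s => V s • M.ψ s) μ) (hW : Integrable (fun s => W s • M.ψ s) μ) :
    M.PsiTLam μ (fun s => V s - W s) = M.PsiTLam μ V - M.PsiTLam μ W := by
  unfold PsiTLam; simp_rw [sub_smul]; exact integral_sub hV hW

theorem PsiTLam_const_mul (c : ℝ) (V : S → ℝ) :
    M.PsiTLam μ (fun s => c * V s) = c • M.PsiTLam μ V := by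
  unfold PsiTLam; simp_rw [mul_smul]; exact integral_smul c _

end Features

end TDModel

/-! ### The resolvent of the chain and the energy form -/

namespace TDModel

variable {S A : Type*} [Countable S] [MeasurableSpace S] [DiscreteMeasurableSpace S]
  [Fintype A] [MeasurableSpace A] [DiscreteMeasurableSpace A] {d : ℕ} {M : TDModel S A d}
  {μ : Measure S} [IsProbabilityMeasure μ] {rhat psihat lam : ℝ}

variable (M) in
/-- The resolvent `∑ₘ λ^m P^m V` of the chain. -/
noncomputable def resolvent (lam : ℝ) (V : S → ℝ) (s : S) : ℝ := ∑' m : ℕ, lam ^ m * M.powP m V s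

theorem ErgodicChain.summable_resolvent (hc : M.ErgodicChain μ rhat) (h0 : 0 ≤ lam)
    (h1 : lam < 1) {V : S → ℝ} (hV : Integrable V μ) (s : S) :
    Summable fun m : ℕ => lam ^ m * M.powP m V s := by
  obtain ⟨C, hC⟩ := hc.abs_powP_le hV s
  refine Summable.of_norm_bounded ((summable_geometric_of_lt_one h0 h1).mul_right C) fun m => ?_
  rw [norm_mul, Real.norm_of_nonneg (pow_nonneg h0 m)]
  exact mul_le_mul_of_nonneg_left (hC m) (pow_nonneg h0 m)

theorem ErgodicChain.integral_norm_powP_le (hc : M.ErgodicChain μ rhat) {V : S → ℝ}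
    (hV : Integrable V μ) (n : ℕ) : ∫ s, ‖M.powP n V s‖ ∂μ ≤ ∫ s, ‖V s‖ ∂μ := by
  rw [← hc.integral_powP hV.norm n]
  exact integral_mono (hc.integrable_powP hV n).norm (hc.integrable_powP hV.norm n)
    fun s => norm_integral_le_integral_norm _

theorem ErgodicChain.summable_integral_resolvent (hc : M.ErgodicChain μ rhat) (h0 : 0 ≤ lam)
    (h1 : lam < 1) {V : S → ℝ} (hV : Integrable V μ) :
    Summable fun m : ℕ => ∫ s, ‖lam ^ m * M.powP m V s‖ ∂μ := by
  refine Summable.of_nonneg_of_le (fun m => integral_nonneg fun _ => norm_nonneg _) (fun m => ?_)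
    ((summable_geometric_of_lt_one h0 h1).mul_right (∫ s, ‖V s‖ ∂μ))
  simp_rw [norm_mul, Real.norm_of_nonneg (pow_nonneg h0 m), integral_const_mul]
  exact mul_le_mul_of_nonneg_left (hc.integral_norm_powP_le hV m) (pow_nonneg h0 m)

theorem ErgodicChain.integrable_resolvent (hc : M.ErgodicChain μ rhat) (h0 : 0 ≤ lam)
    (h1 : lam < 1) {V : S → ℝ} (hV : Integrable V μ) : Integrable (M.resolvent lam V) μ :=
  integrable_tsum (fun m => (hc.integrable_powP hV m).const_mul _)
    (hc.summable_integral_resolvent h0 h1 hV) (hc.summable_resolvent h0 h1 hV)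

theorem ErgodicChain.integral_resolvent (hc : M.ErgodicChain μ rhat) (h0 : 0 ≤ lam)
    (h1 : lam < 1) {V : S → ℝ} (hV : Integrable V μ) :
    ∫ s, M.resolvent lam V s ∂μ = (1 - lam)⁻¹ * ∫ s, V s ∂μ := by
  have h := hasSum_integral_of_summable_integral_norm
    (fun m => (hc.integrable_powP hV m).const_mul (lam ^ m))
    (hc.summable_integral_resolvent h0 h1 hV)
  refine h.unique ?_
  simp_rw [integral_const_mul, hc.integral_powP hV]
  exact (hasSum_geometric_of_lt_one h0 h1).mul_right _

theorem ErgodicChain.integral_norm_powP_smul_le (hc : M.ErgodicChain μ rhat)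
    (hf : M.FeatureMatrix μ psihat) {V : S → ℝ} (hV : MemLp V 2 μ) (m : ℕ) :
    ∫ s, ‖M.powP m V s • M.ψ s‖ ∂μ ≤ √(∫ s, V s ^ 2 ∂μ) * √(∫ s, ‖M.ψ s‖ ^ 2 ∂μ) := by
  have h := abs_integral_mul_le_sqrt_mul_sqrt (hc.memLp_powP hV m) hf.memLp.norm
  simp_rw [norm_smul]
  simp only [abs_norm] at h
  exact h.trans (mul_le_mul_of_nonneg_right (Real.sqrt_le_sqrt (hc.integral_powP_sq_le hV m))
    (Real.sqrt_nonneg _))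

theorem ErgodicChain.summable_integral_resolvent_smul (hc : M.ErgodicChain μ rhat)
    (hf : M.FeatureMatrix μ psihat) (h0 : 0 ≤ lam) (h1 : lam < 1) {V : S → ℝ}
    (hV : MemLp V 2 μ) :
    Summable fun m : ℕ => ∫ s, ‖(lam ^ m * M.powP m V s) • M.ψ s‖ ∂μ := by
  refine Summable.of_nonneg_of_le (fun m => integral_nonneg fun _ => norm_nonneg _) (fun m => ?_)
    ((summable_geometric_of_lt_one h0 h1).mul_right (√(∫ s, V s ^ 2 ∂μ) * √(∫ s, ‖M.ψ s‖ ^ 2 ∂μ)))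
  simp_rw [mul_smul, norm_smul (lam ^ m), Real.norm_of_nonneg (pow_nonneg h0 m),
    integral_const_mul]
  exact mul_le_mul_of_nonneg_left (hc.integral_norm_powP_smul_le hf hV m) (pow_nonneg h0 m)

theorem ErgodicChain.integrable_term_smul (hc : M.ErgodicChain μ rhat)
    (hf : M.FeatureMatrix μ psihat) {V : S → ℝ} (hV : MemLp V 2 μ) (m : ℕ) :
    Integrable (fun s => (lam ^ m * M.powP m V s) • M.ψ s) μ :=
  hf.integrable_smul ((hc.memLp_powP hV m).const_mul _)

theorem ErgodicChain.resolvent_smul (hc : M.ErgodicChain μ rhat) (h0 : 0 ≤ lam) (h1 : lam < 1)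
    {V : S → ℝ} (hV : Integrable V μ) (s : S) :
    HasSum (fun m : ℕ => (lam ^ m * M.powP m V s) • M.ψ s) (M.resolvent lam V s • M.ψ s) :=
  (hc.summable_resolvent h0 h1 hV s).hasSum.smul_const _

theorem ErgodicChain.integrable_resolvent_smul (hc : M.ErgodicChain μ rhat)
    (hf : M.FeatureMatrix μ psihat) (h0 : 0 ≤ lam) (h1 : lam < 1) {V : S → ℝ}
    (hV : MemLp V 2 μ) : Integrable (fun s => M.resolvent lam V s • M.ψ s) μ := by
  refine (integrable_tsum (fun m => hc.integrable_term_smul hf hV m)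
    (hc.summable_integral_resolvent_smul hf h0 h1 hV)
    fun s => (hc.resolvent_smul h0 h1 (hV.integrable one_le_two) s).summable).congr
    (Filter.Eventually.of_forall fun s => ?_)
  exact (hc.resolvent_smul h0 h1 (hV.integrable one_le_two) s).tsum_eq

theorem ErgodicChain.hasSum_PsiTLam (hc : M.ErgodicChain μ rhat)
    (hf : M.FeatureMatrix μ psihat) (h0 : 0 ≤ lam) (h1 : lam < 1) {V : S → ℝ}
    (hV : MemLp V 2 μ) :
    HasSum (fun m : ℕ => lam ^ m • M.PsiTLam μ (M.powP m V))
      (M.PsiTLam μ (M.resolvent lam V)) := by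
  have h := hasSum_integral_of_summable_integral_norm
    (fun m => hc.integrable_term_smul (lam := lam) hf hV m)
    (hc.summable_integral_resolvent_smul hf h0 h1 hV)
  convert! h using 1
  · ext1 m
    exact (PsiTLam_const_mul _ _).symm
  · refine integral_congr_ae (Filter.Eventually.of_forall fun s => ?_)
    exact (hc.resolvent_smul h0 h1 (hV.integrable one_le_two) s).tsum_eq.symm

theorem ErgodicChain.PLam_eq (hc : M.ErgodicChain μ rhat) {V : S → ℝ} (hV : Integrable V μ)
    (s : S) : M.PLam lam V s = (1 - lam) * M.resolvent lam (M.powP 1 V) s := by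
  unfold PLam resolvent
  simp_rw [hc.powP_add hV]

/-- Since R = I + λ R P for the resolvent R, one gets (1 - λ) R P - I = R (P - I). The drift becomes
the resolvent of the one-step increment, the form in which the stationary trace produces it. -/
theorem ErgodicChain.PLam_sub_eq (hc : M.ErgodicChain μ rhat) (h0 : 0 ≤ lam) (h1 : lam < 1)
    {V : S → ℝ} (hV : Integrable V μ) (s : S) :
    M.PLam lam V s - V s = M.resolvent lam (fun t => M.powP 1 V t - V t) s := by
  have hP := hc.integrable_powP hV 1
  have s1 := (hc.summable_resolvent h0 h1 hP s).hasSum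
  have s2 := (hc.summable_resolvent h0 h1 hV s)
  rw [hc.PLam_eq hV]
  have h3 : M.resolvent lam (fun t => M.powP 1 V t - V t) s =
      M.resolvent lam (M.powP 1 V) s - M.resolvent lam V s := by
    unfold resolvent
    rw [← s1.summable.tsum_sub s2]
    congr 1; ext m
    rw [hc.powP_sub hP hV]; ring
  have h4 : M.resolvent lam V s = V s + lam * M.resolvent lam (M.powP 1 V) s := by
    unfold resolvent
    rw [s2.tsum_eq_zero_add, ← tsum_mul_left, pow_zero, powP_zero, one_mul]
    congr 2; ext m
    rw [hc.powP_add hV]; ring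
  rw [h3, h4]; ring

/-- The Cauchy product of the resolvent series with the geometric series. The resulting factor 1 /
(1 - λ) cancels the one in the definition of `RLam`. -/
theorem ErgodicChain.hasSum_sum_powP (hc : M.ErgodicChain μ rhat) (h0 : 0 ≤ lam)
    (h1 : lam < 1) {V : S → ℝ} (hV : Integrable V μ) (s : S) :
    HasSum (fun m : ℕ => lam ^ m * ∑ l ∈ Finset.range (m + 1), M.powP l V s)
      (M.resolvent lam V s * (1 - lam)⁻¹) := by
  have hs := hc.summable_resolvent h0 h1 hV s
  have h := hasSum_sum_range_mul_of_summable_norm (f := fun m : ℕ => lam ^ m * M.powP m V s)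
    (g := fun m : ℕ => lam ^ m) hs.norm
    (by simpa [abs_of_nonneg h0] using summable_geometric_of_lt_one h0 h1)
  rw [tsum_geometric_of_lt_one h0 h1] at h
  convert! h using 2 with m
  rw [Finset.mul_sum]
  refine Finset.sum_congr rfl fun k hk => ?_
  have : lam ^ m = lam ^ k * lam ^ (m - k) := by
    rw [← pow_add, Nat.add_sub_cancel' (Nat.lt_succ_iff.1 (Finset.mem_range.1 hk))]
  rw [this]; ring

theorem ErgodicChain.RLam_eq (hc : M.ErgodicChain μ rhat) (h0 : 0 ≤ lam) (h1 : lam < 1)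
    (s : S) : M.RLam lam s = M.resolvent lam M.Rpi s := by
  unfold RLam
  rw [(hc.hasSum_sum_powP h0 h1 (hc.memLp_Rpi.integrable one_le_two) s).tsum_eq]
  have : (1 - lam) ≠ 0 := by linarith
  field_simp

theorem ErgodicChain.resolvent_sum (hc : M.ErgodicChain μ rhat) (h0 : 0 ≤ lam) (h1 : lam < 1)
    {ι : Type*} (I : Finset ι) (c : ι → ℝ) {V : ι → S → ℝ} (hV : ∀ i, Integrable (V i) μ)
    (s : S) :
    M.resolvent lam (fun t => ∑ i ∈ I, c i * V i t) s = ∑ i ∈ I, c i * M.resolvent lam (V i) s := by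
  have h : HasSum (fun m : ℕ => ∑ i ∈ I, c i * (lam ^ m * M.powP m (V i) s))
      (∑ i ∈ I, c i * M.resolvent lam (V i) s) :=
    hasSum_sum fun i _ => (hc.summable_resolvent h0 h1 (hV i) s).hasSum.mul_left (c i)
  unfold resolvent at h ⊢
  rw [← h.tsum_eq]
  congr 1; ext m
  have : M.powP m (fun t => ∑ i ∈ I, c i * V i t) s = ∑ i ∈ I, c i * M.powP m (V i) s := by
    unfold powP
    rw [integral_finsetSum]
    · simp_rw [integral_const_mul]
    · exact fun i _ => (hc.integrable_pow (hV i) m s).const_mul _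
  rw [this, Finset.mul_sum]
  exact Finset.sum_congr rfl fun i _ => by ring

theorem ErgodicChain.powP_Psi (hc : M.ErgodicChain μ rhat) (hf : M.FeatureMatrix μ psihat)
    (m : ℕ) (θ : EuclideanSpace ℝ (Fin d)) (s : S) :
    M.powP m (M.Psi θ) s = ∑ j, θ j * M.powP m (fun t => M.ψ t j) s := by
  have : M.Psi θ = fun t => ∑ j, θ j * M.ψ t j := funext (Psi_eq_sum θ)
  rw [this]
  unfold powP
  rw [integral_finsetSum]
  · simp_rw [integral_const_mul]
  · exact fun i _ => (hc.integrable_pow ((hf.memLp_coord i).integrable one_le_two) m s).const_mul _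

theorem ErgodicChain.driftOp_apply (hc : M.ErgodicChain μ rhat) (hf : M.FeatureMatrix μ psihat)
    (h0 : 0 ≤ lam) (h1 : lam < 1) (θ : EuclideanSpace ℝ (Fin d)) :
    M.driftOp μ lam θ =
      M.PsiTLam μ (M.resolvent lam fun t => M.powP 1 (M.Psi θ) t - M.Psi θ t) := by
  have hj : ∀ j, MemLp (fun t => M.powP 1 (fun t => M.ψ t j) t - M.ψ t j) 2 μ := fun j =>
    (hc.memLp_powP (hf.memLp_coord j) 1).sub (hf.memLp_coord j)
  unfold driftOp
  rw [form_apply]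
  · refine congrArg _ (funext fun s => ?_)
    simp_rw [hc.PLam_sub_eq h0 h1 ((hf.memLp_coord _).integrable one_le_two)]
    rw [← hc.resolvent_sum h0 h1 _ _ fun j => (hj j).integrable one_le_two]
    congr 1; ext t
    rw [hc.powP_Psi hf, Psi_eq_sum, ← Finset.sum_sub_distrib]
    exact Finset.sum_congr rfl fun j _ => by ring
  · intro j
    simp_rw [hc.PLam_sub_eq h0 h1 ((hf.memLp_coord _).integrable one_le_two)]
    exact hc.integrable_resolvent_smul hf h0 h1 (hj j)

theorem energyOp_eq (θ : EuclideanSpace ℝ (Fin d)) :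
    M.energyOp μ lam θ = -M.driftOp μ lam θ := by
  have : M.form μ (fun V s => V s - M.PLam lam V s) = -M.form μ (fun V s => M.PLam lam V s - V s) := by
    ext i j
    simp only [form, Matrix.of_apply, Matrix.neg_apply]
    rw [← integral_neg]
    congr 1; ext s; ring
  unfold energyOp driftOp
  rw [this, map_neg, neg_apply]

/-- The energy `⟨θ, Ψᵀ Λ (I - P^(λ)) Ψ θ⟩` as a mixture of `n`-step energies. -/
theorem ErgodicChain.hasSum_energy (hc : M.ErgodicChain μ rhat) (hf : M.FeatureMatrix μ psihat)
    (h0 : 0 ≤ lam) (h1 : lam < 1) (θ : EuclideanSpace ℝ (Fin d)) :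
    HasSum (fun m : ℕ => (1 - lam) * lam ^ m *
        (∫ s, M.Psi θ s ^ 2 ∂μ - ∫ s, M.powP (m + 1) (M.Psi θ) s * M.Psi θ s ∂μ))
      ⟪θ, M.energyOp μ lam θ⟫_ℝ := by
  have hV := hf.memLp_Psi θ
  have hP := hc.memLp_powP hV 1
  have hVi := hV.integrable one_le_two
  have e : M.driftOp μ lam θ = (1 - lam) • M.PsiTLam μ (M.resolvent lam (M.powP 1 (M.Psi θ)))
      - M.PsiTLam μ (M.Psi θ) := by
    rw [hc.driftOp_apply hf h0 h1, ← PsiTLam_const_mul, ← PsiTLam_sub]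
    · refine congrArg _ (funext fun s => ?_)
      rw [← hc.PLam_sub_eq h0 h1 hVi, hc.PLam_eq hVi]
    · simp_rw [mul_smul]
      exact (hc.integrable_resolvent_smul hf h0 h1 hP).smul (1 - lam)
    · exact hf.integrable_smul hV
  have h := (((hc.hasSum_PsiTLam hf h0 h1 hP).mapL (innerSL ℝ θ)).mul_left (1 - lam))
  -- The weights (1 - λ) λ^m sum to one, so the single term ∫ V² can be distributed over the series.
  have g := ((hasSum_geometric_of_lt_one h0 h1).mul_left (1 - lam)).mul_right
    (∫ s, M.Psi θ s ^ 2 ∂μ)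
  rw [mul_inv_cancel₀ (by linarith), one_mul] at g
  convert! g.sub h using 1
  · ext m
    have : M.powP m (M.powP 1 (M.Psi θ)) = M.powP (m + 1) (M.Psi θ) :=
      funext fun s => (hc.powP_add hVi m 1 s).symm
    simp only [innerSL_apply_apply, inner_smul_right, this]
    rw [inner_PsiTLam (hf.integrable_smul (hc.memLp_powP hV _))]
    ring
  · rw [energyOp_eq, e, innerSL_apply_apply, inner_neg_right, inner_sub_right, inner_smul_right,
      inner_PsiTLam (hf.integrable_smul hV)]
    simp_rw [← sq]; ring

theorem ErgodicChain.integral_powP_mul_le (hc : M.ErgodicChain μ rhat) {V : S → ℝ}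
    (hV : MemLp V 2 μ) (n : ℕ) : ∫ s, M.powP n V s * V s ∂μ ≤ ∫ s, V s ^ 2 ∂μ := by
  have hP := hc.memLp_powP hV n
  refine (le_abs_self _).trans (abs_integral_le_integral_abs.trans ?_)
  simp_rw [abs_mul]
  refine (abs_integral_mul_le_sqrt_mul_sqrt hP hV).trans ?_
  have h1 := Real.sqrt_le_sqrt (hc.integral_powP_sq_le hV n)
  calc _ ≤ √(∫ s, V s ^ 2 ∂μ) * √(∫ s, V s ^ 2 ∂μ) := by gcongr
    _ = _ := Real.mul_self_sqrt (integral_nonneg fun _ => sq_nonneg _)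

/-- A function without one-step energy is constant. -/
theorem ErgodicChain.const_of_energy_eq_zero (hc : M.ErgodicChain μ rhat) {V : S → ℝ}
    (hV : MemLp V 2 μ) (h : ∫ s, V s ^ 2 ∂μ ≤ ∫ s, M.powP 1 V s * V s ∂μ) (s t : S) :
    V s = V t := by
  have hP := hc.memLp_powP hV 1
  have hVi := hV.integrable one_le_two
  have hmul : Integrable (fun s => M.powP 1 V s * V s) μ := hP.integrable_mul hV
  -- Expand the square: by contraction ‖PV‖² ≤ ‖V‖², and by assumption ⟨PV, V⟩ ≥ ‖V‖², so V is
  -- harmonic.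
  have h1 : ∫ s, (M.powP 1 V s - V s) ^ 2 ∂μ ≤ 0 := by
    have e : ∀ s, (M.powP 1 V s - V s) ^ 2 =
        M.powP 1 V s ^ 2 + V s ^ 2 - 2 * (M.powP 1 V s * V s) := fun s => by ring
    simp_rw [e]
    have ha : Integrable (fun s => M.powP 1 V s ^ 2 + V s ^ 2) μ :=
      hP.integrable_sq.add hV.integrable_sq
    rw [integral_sub ha (hmul.const_mul 2),
      integral_add hP.integrable_sq hV.integrable_sq, integral_const_mul]
    have := hc.integral_powP_sq_le hV 1
    linarith
  have hharm : ∀ s, M.powP 1 V s = V s := by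
    have h2 := (integral_eq_zero_iff_of_nonneg (fun _ => sq_nonneg _)
      (hP.sub hV).integrable_sq).1 (le_antisymm h1 (integral_nonneg fun _ => sq_nonneg _))
    intro s
    have := hc.eq_of_ae_eq h2 s
    have h3 : (M.powP 1 V s - V s) ^ 2 = 0 := this
    nlinarith
  have hharmn : ∀ n s, M.powP n V s = V s := by
    intro n
    induction n with
    | zero => exact powP_zero V
    | succ n ih => intro s; rw [hc.powP_add hVi, funext hharm, ih]
  -- By Jensen P^n V² - V² ≥ 0 for harmonic V, and it has stationary mean zero; hence V² is harmonic
  -- as well.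
  have hsq : ∀ n s, M.powP n (fun t => V t ^ 2) s = V s ^ 2 := by
    intro n
    have hi := hc.integrable_powP hV.integrable_sq n
    have hnn : ∀ s, 0 ≤ M.powP n (fun t => V t ^ 2) s - V s ^ 2 := fun s => by
      have := powP_sq_le (hc.memLp_pow hV n s)
      rw [hharmn] at this; linarith
    have h2 := (integral_eq_zero_iff_of_nonneg hnn (hi.sub hV.integrable_sq)).1 (by
      rw [integral_sub hi hV.integrable_sq, hc.integral_powP hV.integrable_sq, sub_self])
    intro s
    have h3 : M.powP n (fun t => V t ^ 2) s - V s ^ 2 = 0 := hc.eq_of_ae_eq h2 s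
    linarith
  obtain ⟨n, hn⟩ := hc.irreducible s t
  have hm := hc.memLp_pow hV n s
  -- Both V and V² are harmonic, so V has variance zero under P^n(s, ·), a law that charges t.
  have hint : ∫ x, (V x - V s) ^ 2 ∂((M.stateKernel ^ n) s) = 0 := by
    have hvi := hc.integrable_pow hVi n s
    have e : ∀ x, (V x - V s) ^ 2 = V x ^ 2 + V s ^ 2 - 2 * V s * V x := fun x => by ring
    simp_rw [e]
    have ha : Integrable (fun x => V x ^ 2 + V s ^ 2) ((M.stateKernel ^ n) s) :=
      hm.integrable_sq.add (integrable_const _)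
    rw [integral_sub ha (hvi.const_mul _),
      integral_add hm.integrable_sq (integrable_const _), integral_const_mul, integral_const]
    have a1 := hsq n s
    have a2 := hharmn n s
    unfold powP at a1 a2
    rw [a1, a2]; simp; ring
  have hz := (integral_eq_zero_iff_of_nonneg (fun _ => sq_nonneg _)
    (hm.sub (memLp_const (V s))).integrable_sq).1 hint
  by_contra hne
  refine hn.ne' (measure_mono_null ?_ (ae_iff.1 hz))
  intro x hx
  rw [Set.mem_singleton_iff] at hx
  subst hx
  have : V x - V s ≠ 0 := fun h => hne (by linarith)
  simpa using this

/-- All terms of the energy series are nonnegative, so it suffices that the term m = 0, of weight 1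
- λ, is positive. Otherwise Ψθ is constant: the constant 0 contradicts linear independence, and any
other constant puts θ into E_Ψ, hence makes it orthogonal to itself. -/
theorem ErgodicChain.energy_pos (hc : M.ErgodicChain μ rhat) (hf : M.FeatureMatrix μ psihat)
    (h0 : 0 ≤ lam) (h1 : lam < 1) {θ : EuclideanSpace ℝ (Fin d)} (hθ : θ ∈ M.EPsiᗮ)
    (hne : θ ≠ 0) : 0 < ⟪θ, M.energyOp μ lam θ⟫_ℝ := by
  have hV := hf.memLp_Psi θ
  have hs := hc.hasSum_energy hf h0 h1 θ
  have hle := le_hasSum hs 0 fun m _ => mul_nonneg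
    (mul_nonneg (by linarith) (pow_nonneg h0 m))
    (sub_nonneg.2 (hc.integral_powP_mul_le hV (m + 1)))
  refine lt_of_lt_of_le ?_ hle
  simp only [pow_zero, mul_one, zero_add]
  refine mul_pos (by linarith) (sub_pos.2 ?_)
  by_contra! hcon
  have hconst := hc.const_of_energy_eq_zero hV hcon
  obtain ⟨s₀⟩ : Nonempty S := nonempty_of_isProbabilityMeasure μ
  apply hne
  by_cases hz : M.Psi θ s₀ = 0
  · exact hf.independent θ fun s => (hconst s s₀).trans hz
  · have hmem : (M.Psi θ s₀)⁻¹ • θ ∈ M.EPsi := by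
      refine Submodule.subset_span fun s => ?_
      rw [inner_smul_right]
      change _ * M.Psi θ s = 1
      rw [hconst s s₀, inv_mul_cancel₀ hz]
    have hmem2 : θ ∈ M.EPsi := by
      have := M.EPsi.smul_mem (M.Psi θ s₀) hmem
      rwa [smul_smul, mul_inv_cancel₀ hz, one_smul] at this
    exact inner_self_eq_zero.1 (M.EPsi.mem_orthogonal θ |>.1 hθ θ hmem2)

end TDModel

/-! ### The negative drift -/

/-- Completing the square in √q |r| - Δ |t| requires only c - Δ/2 ≥ q/(2Δ). The threshold implies
this because the root is √((q/Δ)(q/Δ - Δ)), which is at least (q/Δ - Δ)/2 when q/Δ > Δ. When q/Δ ≤ Δ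
the summand Δ alone suffices, whatever value the root takes. -/
theorem quadratic_drift {q Δ c r t : ℝ} (hq : 0 ≤ q) (hΔ : 0 < Δ)
    (hc : Δ + √(q ^ 2 / Δ ^ 2 - q) ≤ c) :
    Δ / 2 * (r ^ 2 + t ^ 2) ≤ c * r ^ 2 - √q * |r| * |t| + Δ * t ^ 2 := by
  have h1 : q / Δ - Δ ≤ 2 * √(q ^ 2 / Δ ^ 2 - q) := by
    by_cases h : q / Δ ≤ Δ
    · have := Real.sqrt_nonneg (q ^ 2 / Δ ^ 2 - q); linarith
    · push Not at h
      have : (q / Δ - Δ) / 2 ≤ √(q ^ 2 / Δ ^ 2 - q) := by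
        apply Real.le_sqrt_of_sq_le
        have e : q ^ 2 / Δ ^ 2 - q = (q / Δ) * (q / Δ - Δ) := by field_simp
        rw [e]; nlinarith
      linarith
  have h2 : q / (2 * Δ) ≤ c - Δ / 2 := by
    have : q / (2 * Δ) = q / Δ / 2 := by field_simp
    rw [this]; linarith
  have hs := Real.sq_sqrt hq
  have h3 : 0 ≤ q / (2 * Δ) * r ^ 2 - √q * |r| * |t| + Δ / 2 * t ^ 2 := by
    have e : q / (2 * Δ) * r ^ 2 - √q * |r| * |t| + Δ / 2 * t ^ 2 =
        (√q * |r| - Δ * |t|) ^ 2 / (2 * Δ) := by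
      field_simp
      rw [sub_sq, mul_pow, mul_pow, hs, sq_abs, sq_abs]; ring
    rw [e]; positivity
  nlinarith [mul_le_mul_of_nonneg_right h2 (sq_nonneg r)]

namespace TDModel

variable {S A : Type*} [Countable S] [MeasurableSpace S] [DiscreteMeasurableSpace S]
  [Fintype A] [MeasurableSpace A] [DiscreteMeasurableSpace A] {d : ℕ} {M : TDModel S A d}
  {μ : Measure S} [IsProbabilityMeasure μ] {rhat psihat lam cα : ℝ}

theorem inner_proj {θ : EuclideanSpace ℝ (Fin d)} (hθ : θ ∈ M.EPsiᗮ)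
    (v : EuclideanSpace ℝ (Fin d)) : ⟪θ, M.proj v⟫_ℝ = ⟪θ, v⟫_ℝ := by
  unfold proj
  rw [← Submodule.inner_starProjection_left_eq_right, Submodule.starProjection_eq_self_iff.2 hθ]

theorem norm_proj_le (v : EuclideanSpace ℝ (Fin d)) : ‖M.proj v‖ ≤ ‖v‖ :=
  Submodule.norm_starProjection_apply_le _ v

theorem proj_mem (v : EuclideanSpace ℝ (Fin d)) : M.proj v ∈ M.EPsiᗮ :=
  Submodule.starProjection_apply_mem _ v

theorem Tbar_apply (x : TDParam d) : M.Tbar μ lam cα x = WithLp.toLp 2 (-(cα * x.fst),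
    -(x.fst • (1 / (1 - lam)) • M.proj (M.PsiTLam μ fun _ => 1))
      + M.proj (M.driftOp μ lam x.snd)) := rfl

theorem FeatureMatrix.norm_mean_sq_le (hf : M.FeatureMatrix μ psihat) :
    ‖M.PsiTLam μ fun _ => 1‖ ^ 2 ≤ d * psihat ^ 2 := by
  have h1 : ‖M.PsiTLam μ fun _ => 1‖ ≤ ∫ s, ‖M.ψ s‖ ∂μ := by
    unfold PsiTLam; simp_rw [one_smul]; exact norm_integral_le_integral_norm _
  calc _ ≤ (∫ s, ‖M.ψ s‖ ∂μ) ^ 2 := by gcongr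
    _ ≤ ∫ s, ‖M.ψ s‖ ^ 2 ∂μ := sq_integral_le hf.memLp.norm
    _ ≤ _ := hf.integral_norm_sq_le

theorem ErgodicChain.exists_isLeast_energy (hc : M.ErgodicChain μ rhat)
    (hf : M.FeatureMatrix μ psihat) (h0 : 0 ≤ lam) (h1 : lam < 1) (hE : M.EPsiᗮ ≠ ⊥) :
    ∃ Δ : ℝ, IsLeast {v : ℝ | ∃ θ ∈ M.EPsiᗮ, ‖θ‖ = 1 ∧
      v = ⟪θ, M.proj (M.energyOp μ lam θ)⟫_ℝ} Δ ∧ 0 < Δ := by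
  set K : Set (EuclideanSpace ℝ (Fin d)) := (M.EPsiᗮ : Set _) ∩ Metric.sphere 0 1 with hK
  have hKc : IsCompact K :=
    (isCompact_sphere (0 : EuclideanSpace ℝ (Fin d)) 1).inter_left
      (Submodule.isClosed_orthogonal _)
  have hne : K.Nonempty := by
    obtain ⟨v, hv, hv0⟩ := Submodule.exists_mem_ne_zero_of_ne_bot hE
    refine ⟨‖v‖⁻¹ • v, Submodule.smul_mem _ _ hv, ?_⟩
    simp [norm_smul, hv0]
  have hcont : ContinuousOn (fun θ => ⟪θ, M.proj (M.energyOp μ lam θ)⟫_ℝ) K := by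
    fun_prop
  obtain ⟨θ, hθ, hmin⟩ := hKc.exists_isMinOn hne hcont
  have hθ1 : ‖θ‖ = 1 := by simpa using hθ.2
  refine ⟨_, ⟨⟨θ, hθ.1, hθ1, rfl⟩, ?_⟩, ?_⟩
  · rintro v ⟨η, hη, hη1, rfl⟩
    exact hmin ⟨hη, by simpa using hη1⟩
  · rw [inner_proj hθ.1]
    exact hc.energy_pos hf h0 h1 hθ.1 (by rintro rfl; simp at hθ1)

/-- The only mixed term of the quadratic form is r ⟨θ, m⟩ / (1 - λ) with m the mean feature, and
‖m‖² ≤ d ψ̂². So `quadratic_drift` applies with q = d ψ̂² / (1 - λ)², and homogeneity extends the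
minimum Δ from the sphere to all θ. -/
theorem FeatureMatrix.negative_drift (hf : M.FeatureMatrix μ psihat) (h1 : lam < 1) {Δ : ℝ}
    (hΔ : IsLeast {v : ℝ | ∃ θ ∈ M.EPsiᗮ, ‖θ‖ = 1 ∧
      v = ⟪θ, M.proj (M.energyOp μ lam θ)⟫_ℝ} Δ) (hpos : 0 < Δ)
    (hcα : Δ + √((d : ℝ) ^ 2 * psihat ^ 4 / (Δ ^ 2 * (1 - lam) ^ 4)
          - d * psihat ^ 2 / (1 - lam) ^ 2) ≤ cα) (x : TDParam d) (hx : x.snd ∈ M.EPsiᗮ) :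
    Δ / 2 * ‖x‖ ^ 2 ≤ -⟪x, M.Tbar μ lam cα x⟫_ℝ := by
  set r := x.fst with hr
  set θ := x.snd with hθ
  set m := M.PsiTLam μ fun _ => 1 with hm
  have hl : 0 < 1 - lam := by linarith
  set q : ℝ := d * psihat ^ 2 / (1 - lam) ^ 2 with hq
  have hq0 : 0 ≤ q := by positivity
  have hquad := quadratic_drift (r := r) (t := ‖θ‖) hq0 hpos (c := cα) (by
    refine le_trans (le_of_eq ?_) hcα
    congr 3
    rw [hq]; field_simp)
  have henergy : Δ * ‖θ‖ ^ 2 ≤ ⟪θ, M.energyOp μ lam θ⟫_ℝ := by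
    by_cases hz : θ = 0
    · simp [hz]
    · have hn : ‖θ‖ ≠ 0 := norm_ne_zero_iff.2 hz
      have := hΔ.2 ⟨‖θ‖⁻¹ • θ, Submodule.smul_mem _ _ hx, by simp [norm_smul, hn], rfl⟩
      rw [inner_proj (Submodule.smul_mem _ _ hx), map_smul, inner_smul_left, inner_smul_right]
        at this
      simp only [conj_trivial] at this
      calc Δ * ‖θ‖ ^ 2 ≤ (‖θ‖⁻¹ * (‖θ‖⁻¹ * ⟪θ, M.energyOp μ lam θ⟫_ℝ)) * ‖θ‖ ^ 2 := by gcongr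
        _ = _ := by field_simp
  have hinner : -⟪x, M.Tbar μ lam cα x⟫_ℝ =
      cα * r ^ 2 + r * ((1 / (1 - lam)) * ⟪θ, m⟫_ℝ) + ⟪θ, M.energyOp μ lam θ⟫_ℝ := by
    rw [WithLp.prod_inner_apply, Tbar_apply, energyOp_eq]
    change -(⟪r, -(cα * r)⟫_ℝ + ⟪θ, -(r • (1 / (1 - lam)) • M.proj m)
      + M.proj (M.driftOp μ lam θ)⟫_ℝ) = _
    rw [inner_add_right, inner_neg_right, inner_neg_right, inner_smul_right, inner_smul_right,
      inner_proj hx, inner_proj hx, inner_neg_right]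
    simp only [RCLike.inner_apply, conj_trivial]; ring
  have hcross : |r * ((1 / (1 - lam)) * ⟪θ, m⟫_ℝ)| ≤ √q * |r| * |‖θ‖| := by
    rw [abs_mul, abs_mul, abs_of_pos (by positivity : 0 < 1 / (1 - lam)), abs_norm]
    have h2 : ‖m‖ / (1 - lam) ≤ √q := by
      apply Real.le_sqrt_of_sq_le
      rw [div_pow, hq]
      gcongr
      exact hf.norm_mean_sq_le
    calc |r| * (1 / (1 - lam) * |⟪θ, m⟫_ℝ|) ≤ |r| * (1 / (1 - lam) * (‖θ‖ * ‖m‖)) := by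
          gcongr; exact abs_real_inner_le_norm _ _
      _ = ‖m‖ / (1 - lam) * |r| * ‖θ‖ := by ring
      _ ≤ _ := by gcongr
  have hnorm : ‖x‖ ^ 2 = r ^ 2 + ‖θ‖ ^ 2 := by
    rw [WithLp.prod_norm_sq_eq_of_L2, Real.norm_eq_abs, sq_abs]
  rw [hinner, hnorm]
  have := neg_abs_le (r * ((1 / (1 - lam)) * ⟪θ, m⟫_ℝ))
  linarith

/-! ### The fixed point and the projected Bellman equation -/

/-- A map that is definite on a subspace can be inverted there, after projection. -/
theorem existsUnique_proj_eq {E : Type*} [NormedAddCommGroup E] [InnerProductSpace ℝ E]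
    [FiniteDimensional ℝ E] (K : Submodule ℝ E) (D : E →L[ℝ] E)
    (hD : ∀ θ ∈ K, θ ≠ 0 → ⟪θ, D θ⟫_ℝ ≠ 0) {v : E} (hv : v ∈ K) :
    ∃ θ ∈ K, K.starProjection (D θ) = v ∧
      ∀ η ∈ K, K.starProjection (D η) = v → η = θ := by
  let L : K →ₗ[ℝ] K := K.orthogonalProjectionOnto.toLinearMap ∘ₗ D.toLinearMap ∘ₗ K.subtype
  have hL : ∀ θ : K, (L θ : E) = K.starProjection (D θ) := fun θ => rfl
  have hinj : Function.Injective L := by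
    rw [← LinearMap.ker_eq_bot, LinearMap.ker_eq_bot']
    intro θ hθ
    by_contra hne
    refine hD θ θ.2 (by simpa using hne) ?_
    have h0 : K.starProjection (D θ) = 0 := by rw [← hL, hθ]; rfl
    have h2 := K.starProjection_eq_self_iff.2 θ.2
    rw [← h2, Submodule.inner_starProjection_left_eq_right, h2, h0, inner_zero_right]
  obtain ⟨θ, hθ⟩ := LinearMap.injective_iff_surjective.1 hinj ⟨v, hv⟩
  refine ⟨θ, θ.2, by rw [← hL, hθ], fun η hη h => ?_⟩
  have : L ⟨η, hη⟩ = L θ := by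
    rw [hθ]; exact Subtype.ext h
  exact congrArg Subtype.val (hinj this)

/-- With r = r̄ the first row vanishes identically, which leaves a projected linear equation for θ
alone. -/
theorem Tbar_add_bbar_eq_zero_iff (hc : M.ErgodicChain μ rhat) (h0 : 0 ≤ lam) (h1 : lam < 1)
    (θ : EuclideanSpace ℝ (Fin d)) :
    M.Tbar μ lam cα (WithLp.toLp 2 (M.rbar μ, θ)) + M.bbar μ lam cα = 0 ↔
      M.proj (M.driftOp μ lam θ) = M.rbar μ • (1 / (1 - lam)) • M.proj (M.PsiTLam μ fun _ => 1)
        - M.proj (M.PsiTLam μ (M.resolvent lam M.Rpi)) := by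
  rw [Tbar_apply, bbar, ← WithLp.toLp_add, Prod.mk_add_mk, funext (hc.RLam_eq h0 h1)]
  change WithLp.toLp 2 (-(cα * M.rbar μ) + cα * M.rbar μ,
    -(M.rbar μ • (1 / (1 - lam)) • M.proj (M.PsiTLam μ fun _ => 1)) + M.proj (M.driftOp μ lam θ)
      + M.proj (M.PsiTLam μ (M.resolvent lam M.Rpi))) = 0 ↔ _
  rw [neg_add_cancel, ← WithLp.toLp_zero 2]
  constructor
  · intro h
    have := congrArg Prod.snd ((WithLp.toLp_injective 2) h)
    simp only [Prod.snd_zero] at this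
    rw [← sub_eq_zero, ← this]; abel
  · intro h
    rw [h]
    congr 1
    refine Prod.ext rfl ?_
    simp only [Prod.snd_zero]; abel

theorem ErgodicChain.exists_fixedPoint (hc : M.ErgodicChain μ rhat)
    (hf : M.FeatureMatrix μ psihat) (h0 : 0 ≤ lam) (h1 : lam < 1) :
    ∃ θs ∈ M.EPsiᗮ, M.Tbar μ lam cα (WithLp.toLp 2 (M.rbar μ, θs)) + M.bbar μ lam cα = 0 ∧
      ∀ θ ∈ M.EPsiᗮ,
        M.Tbar μ lam cα (WithLp.toLp 2 (M.rbar μ, θ)) + M.bbar μ lam cα = 0 → θ = θs := by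
  simp_rw [Tbar_add_bbar_eq_zero_iff hc h0 h1]
  refine existsUnique_proj_eq M.EPsiᗮ (M.driftOp μ lam) (fun θ hθ hne => ?_) ?_
  · have := hc.energy_pos hf h0 h1 hθ hne
    rw [energyOp_eq, inner_neg_right] at this
    linarith
  · exact Submodule.sub_mem _ (Submodule.smul_mem _ _ (Submodule.smul_mem _ _ (proj_mem _)))
      (proj_mem _)

theorem ErgodicChain.bellman_iterate (hc : M.ErgodicChain μ rhat) {V : S → ℝ}
    (hV : Integrable V μ) (m : ℕ) (s : S) :
    (M.bellman μ)^[m + 1] V s = ∑ l ∈ Finset.range (m + 1), M.powP l M.Rpi s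
      + M.powP (m + 1) V s - (m + 1) * M.rbar μ := by
  have hR := hc.memLp_Rpi.integrable one_le_two
  induction m generalizing s with
  | zero => simp [bellman, powP_zero]
  | succ m ih =>
    rw [Function.iterate_succ_apply', funext ih]
    unfold bellman
    have hi : Integrable (fun s => ∑ l ∈ Finset.range (m + 1), M.powP l M.Rpi s) μ :=
      integrable_finsetSum _ fun l _ => hc.integrable_powP hR l
    have hPV := hc.integrable_powP hV (m + 1)
    have e : M.powP 1 (fun s => ∑ l ∈ Finset.range (m + 1), M.powP l M.Rpi s
        + M.powP (m + 1) V s - (m + 1) * M.rbar μ) s =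
        ∑ l ∈ Finset.range (m + 1), M.powP (l + 1) M.Rpi s + M.powP (m + 1 + 1) V s
          - (m + 1) * M.rbar μ := by
      have hip : Integrable (fun s => ∑ l ∈ Finset.range (m + 1), M.powP l M.Rpi s
        + M.powP (m + 1) V s) μ := hi.add hPV
      rw [hc.powP_sub hip (integrable_const _), powP_const, hc.powP_add_fun hi hPV,
        add_comm (m + 1) 1, hc.powP_add hV 1 (m + 1)]
      congr 2
      change ∫ t, ∑ l ∈ Finset.range (m + 1), M.powP l M.Rpi t ∂((M.stateKernel ^ 1) s) = _
      rw [integral_finsetSum _ fun l _ => hc.integrable_pow (hc.integrable_powP hR l) 1 s]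
      refine Finset.sum_congr rfl fun l _ => ?_
      rw [add_comm l 1]
      exact (hc.powP_add hR 1 l s).symm
    rw [e, Finset.sum_range_succ' _ (m + 1), powP_zero]
    push_cast; ring

/-- Expand the iterates into three series. The accumulated r̄ has total weight (1 - λ) ∑ (m + 1) λ^m
= 1 / (1 - λ). -/
theorem ErgodicChain.bellmanLam_eq (hc : M.ErgodicChain μ rhat) (h0 : 0 ≤ lam) (h1 : lam < 1)
    {V : S → ℝ} (hV : Integrable V μ) (s : S) :
    M.bellmanLam μ lam V s = M.resolvent lam M.Rpi s + M.PLam lam V s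
      - (1 - lam)⁻¹ * M.rbar μ := by
  have hl : (1 - lam) ≠ 0 := by linarith
  have a := hc.hasSum_sum_powP h0 h1 (hc.memLp_Rpi.integrable one_le_two) s
  have b := (hc.summable_resolvent h0 h1 (hc.integrable_powP hV 1) s).hasSum
  have c : HasSum (fun m : ℕ => ((m : ℝ) + 1) * lam ^ m) ((1 - lam)⁻¹ ^ 2) := by
    have e := (hasSum_coe_mul_geometric_of_norm_lt_one (r := lam)
      (by rwa [Real.norm_of_nonneg h0])).add (hasSum_geometric_of_lt_one h0 h1)
    convert! e using 1
    · ext m; ring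
    · field_simp; ring
  have hsum := ((a.add b).sub (c.mul_right (M.rbar μ))).mul_left (1 - lam)
  unfold bellmanLam
  rw [hc.PLam_eq hV]
  have e : ∀ m : ℕ, (1 - lam) * (lam ^ m * (M.bellman μ)^[m + 1] V s) =
      (1 - lam) * (lam ^ m * ∑ l ∈ Finset.range (m + 1), M.powP l M.Rpi s
        + lam ^ m * M.powP m (M.powP 1 V) s - (m + 1) * lam ^ m * M.rbar μ) := by
    intro m
    rw [hc.bellman_iterate hV, hc.powP_add hV m 1]; ring
  rw [← tsum_mul_left]
  simp_rw [e]
  rw [hsum.tsum_eq]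
  unfold resolvent
  field_simp

theorem ErgodicChain.gram_isUnit (hc : M.ErgodicChain μ rhat) (hf : M.FeatureMatrix μ psihat) :
    IsUnit (M.form μ id).det := by
  rw [← Matrix.isUnit_iff_isUnit_det, ← Matrix.mulVec_injective_iff_isUnit]
  have key : ∀ θ : EuclideanSpace ℝ (Fin d),
      Matrix.toEuclideanCLM (𝕜 := ℝ) (M.form μ id) θ = 0 → θ = 0 := by
    intro θ h
    rw [hf.gram_apply] at h
    have h2 : ∫ s, M.Psi θ s * M.Psi θ s ∂μ = 0 := by
      rw [← inner_PsiTLam (hf.integrable_smul (hf.memLp_Psi θ)), h, inner_zero_right]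
    have h3 := (integral_eq_zero_iff_of_nonneg (fun s => mul_self_nonneg _)
      ((hf.memLp_Psi θ).integrable_mul (hf.memLp_Psi θ))).1 h2
    refine hf.independent θ fun s => ?_
    exact mul_self_eq_zero.1 (hc.eq_of_ae_eq h3 s)
  intro u v huv
  have h := key (WithLp.toLp 2 (u - v)) (by
    apply WithLp.ofLp_injective
    rw [Matrix.ofLp_toEuclideanCLM]
    change (M.form μ id).mulVec (u - v) = 0
    rw [Matrix.mulVec_sub, sub_eq_zero]; exact huv)
  have h2 : u - v = 0 := by simpa using congrArg WithLp.ofLp h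
  exact sub_eq_zero.1 h2

/-- Let W be the Bellman residual at Ψθ and w = Ψᵀ Λ W. The fixed point equation gives only Πw = 0,
that is w ∈ E_Ψ. But w is also orthogonal to E_Ψ, so w = 0, and then Ψᵀ Λ does not distinguish the
Bellman image from Ψθ. -/
theorem ErgodicChain.projected_bellman (hc : M.ErgodicChain μ rhat)
    (hf : M.FeatureMatrix μ psihat) (h0 : 0 ≤ lam) (h1 : lam < 1)
    {θ : EuclideanSpace ℝ (Fin d)}
    (hθ : M.Tbar μ lam cα (WithLp.toLp 2 (M.rbar μ, θ)) + M.bbar μ lam cα = 0) :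
    M.projLam μ (M.bellmanLam μ lam (M.Psi θ)) = M.Psi θ := by
  rw [Tbar_add_bbar_eq_zero_iff hc h0 h1] at hθ
  have hV := hf.memLp_Psi θ
  have hVi := hV.integrable one_le_two
  have hR := hc.memLp_Rpi
  have hPV : MemLp (fun t => M.powP 1 (M.Psi θ) t - M.Psi θ t) 2 μ := (hc.memLp_powP hV 1).sub hV
  have hPVi := hPV.integrable one_le_two
  -- The trailing factor 1 exhibits the constant as a multiple of the constant function 1, the shape
  -- in which `PsiTLam_const_mul` extracts it.
  set W : S → ℝ := fun s => M.resolvent lam M.Rpi s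
    + M.resolvent lam (fun t => M.powP 1 (M.Psi θ) t - M.Psi θ t) s
    - (1 - lam)⁻¹ * M.rbar μ * 1 with hW
  have i1 := hc.integrable_resolvent_smul hf h0 h1 hR
  have i2 := hc.integrable_resolvent_smul hf h0 h1 hPV
  have i3 : Integrable (fun s => ((1 - lam)⁻¹ * M.rbar μ * 1) • M.ψ s) μ :=
    (hf.memLp.integrable one_le_two).smul ((1 - lam)⁻¹ * M.rbar μ * 1)
  have i12 : Integrable (fun s => (M.resolvent lam M.Rpi s
    + M.resolvent lam (fun t => M.powP 1 (M.Psi θ) t - M.Psi θ t) s) • M.ψ s) μ := by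
    simp_rw [add_smul]; exact i1.add i2
  have iW : Integrable (fun s => W s • M.ψ s) μ := by
    simp_rw [hW, sub_smul]; exact i12.sub i3
  have hb : ∀ s, M.bellmanLam μ lam (M.Psi θ) s = W s + M.Psi θ s := by
    intro s
    have := hc.PLam_sub_eq h0 h1 hVi s
    rw [hc.bellmanLam_eq h0 h1 hVi]
    simp only [hW]
    linarith
  have hwv : M.PsiTLam μ W = M.PsiTLam μ (M.resolvent lam M.Rpi) + M.driftOp μ lam θ
      - ((1 - lam)⁻¹ * M.rbar μ) • M.PsiTLam μ fun _ => 1 := by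
    rw [hW, PsiTLam_sub i12 i3, PsiTLam_add i1 i2, hc.driftOp_apply hf h0 h1, PsiTLam_const_mul]
  have hw1 : M.PsiTLam μ W ∈ M.EPsi := by
    rw [← Submodule.orthogonal_orthogonal M.EPsi, ← Submodule.starProjection_apply_eq_zero_iff]
    change M.proj _ = 0
    rw [hwv, map_sub, map_add, map_smul, hθ, smul_smul, one_div]
    rw [mul_comm (M.rbar μ)]; abel
  -- Pairing w with a vector e such that Ψe = 1 gives the stationary mean of W. It is zero: the
  -- resolvent multiplies means by 1 / (1 - λ), so the reward part cancels the r̄ term, and the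
  -- increment PV - V has mean zero.
  have hw2 : M.PsiTLam μ W ∈ M.EPsiᗮ := by
    have hle : M.EPsi ≤ (Submodule.span ℝ {M.PsiTLam μ W})ᗮ := by
      refine Submodule.span_le.2 fun e he => ?_
      rw [SetLike.mem_coe, Submodule.mem_orthogonal_singleton_iff_inner_left, inner_PsiTLam iW]
      have he' : ∀ s, M.Psi e s = 1 := he
      simp_rw [he', mul_one, hW]
      have j1 := hc.integrable_resolvent h0 h1 (hR.integrable one_le_two)
      have j2 := hc.integrable_resolvent h0 h1 hPVi
      have j12 : Integrable (fun s => M.resolvent lam M.Rpi s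
        + M.resolvent lam (fun t => M.powP 1 (M.Psi θ) t - M.Psi θ t) s) μ := j1.add j2
      rw [integral_sub j12 (integrable_const _), integral_add j1 j2, hc.integral_resolvent h0 h1 (hR.integrable one_le_two),
        hc.integral_resolvent h0 h1 hPVi, integral_sub (hc.integrable_powP hVi 1) hVi,
        hc.integral_powP hVi]
      simp [rbar]
    rw [Submodule.mem_orthogonal]
    intro u hu
    exact (Submodule.mem_orthogonal_singleton_iff_inner_left).1 (hle hu)
  have hw0 : M.PsiTLam μ W = 0 := inner_self_eq_zero.1 (M.EPsi.mem_orthogonal _ |>.1 hw2 _ hw1)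
  unfold projLam
  rw [funext hb, PsiTLam_add iW (hf.integrable_smul hV), hw0, zero_add, ← hf.gram_apply]
  congr 1
  have hmul : Matrix.toEuclideanCLM (𝕜 := ℝ) (M.form μ id)⁻¹
      * Matrix.toEuclideanCLM (𝕜 := ℝ) (M.form μ id) = 1 := by
    rw [← map_mul, Matrix.nonsing_inv_mul _ (hc.gram_isUnit hf), map_one]
  exact DFunLike.congr_fun hmul θ

end TDModel

/-! ### Moments and weighted expectations of the eligibility trace -/

namespace TDModel

variable {S A : Type*} [Countable S] [MeasurableSpace S] [DiscreteMeasurableSpace S]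
  [Fintype A] [MeasurableSpace A] [DiscreteMeasurableSpace A] {d : ℕ} {M : TDModel S A d}
  {μ : Measure S} [IsProbabilityMeasure μ] {rhat psihat lam cα : ℝ}

section Trace

omit [Countable S] [DiscreteMeasurableSpace S] [Fintype A] [DiscreteMeasurableSpace A] in
theorem measurable_trace : Measurable fun y : TDState S A d => y.2.2.2 := by fun_prop

/-- The new trace λz + v is the convex combination of z and v / (1 - λ) with weights λ and 1 - λ,
and t ↦ t^p is convex. A moment bound C / (1 - λ)^p is therefore preserved exactly by the recursion.
-/
theorem norm_update_pow_le (h0 : 0 ≤ lam) (h1 : lam < 1) {E : Type*} [NormedAddCommGroup E]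
    [NormedSpace ℝ E] (z v : E) (p : ℕ) :
    ‖lam • z + v‖ ^ p ≤ lam * ‖z‖ ^ p + (1 - lam) * (‖v‖ ^ p / (1 - lam) ^ p) := by
  have hl : 0 < 1 - lam := by linarith
  have h2 : ‖lam • z + v‖ ≤ lam * ‖z‖ + (1 - lam) * (‖v‖ / (1 - lam)) := by
    refine (norm_add_le _ _).trans_eq ?_
    rw [norm_smul, Real.norm_of_nonneg h0]; field_simp
  have h3 := (convexOn_pow (𝕜 := ℝ) p).2 (x := ‖z‖) (norm_nonneg z)
    (y := ‖v‖ / (1 - lam)) (div_nonneg (norm_nonneg v) hl.le) h0 hl.le (by ring)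
  simp only [smul_eq_mul, div_pow] at h3
  exact (pow_le_pow_left₀ (norm_nonneg _) h2 p).trans h3

theorem lintegral_bind_tdKernel (τ : Measure (TDState S A d)) {f : TDState S A d → ℝ≥0∞}
    (hf : Measurable f) : ∫⁻ y, f y ∂(τ.bind (M.tdKernel lam)) =
      ∫⁻ y, ∫⁻ q, f (y.2.2.1, q.1, q.2, lam • y.2.2.2 + M.ψ y.2.2.1) ∂(M.stepKernel y.2.2.1) ∂τ := by
  rw [Measure.lintegral_bind (Kernel.aemeasurable _) hf.aemeasurable]
  exact lintegral_congr fun y => M.lintegral_tdKernel lam y hf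

/-- Moment bounds for the eligibility trace. -/
theorem integralLE_trace_pow (h0 : 0 ≤ lam) (h1 : lam < 1) {C : ℝ} (p : ℕ)
    (τ : ℕ → Measure (TDState S A d)) (hτ : ∀ n, τ (n + 1) = (τ n).bind (M.tdKernel lam))
    (hψ : ∀ n, IntegralLE (τ n) (fun y => ‖M.ψ y.2.2.1‖ ^ p) C)
    (hz : IntegralLE (τ 0) (fun y => ‖y.2.2.2‖ ^ p) (C / (1 - lam) ^ p)) (n : ℕ) :
    IntegralLE (τ n) (fun y => ‖y.2.2.2‖ ^ p) (C / (1 - lam) ^ p) := by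
  have hl : 0 < 1 - lam := by linarith
  have hC : 0 ≤ C := (hψ 0).nonneg fun _ => by positivity
  have hψm : Measurable M.ψ := .of_discrete
  induction n with
  | zero => exact hz
  | succ n ih =>
    refine IntegralLE.of_lintegral (by fun_prop) (fun _ => by positivity) (by positivity) ?_
    rw [hτ, lintegral_bind_tdKernel _ (by fun_prop)]
    simp only [lintegral_const, measure_univ, mul_one]
    have h2 := (ih.const_mul h0).add (((hψ n).const_mul (c := ((1 - lam) ^ p)⁻¹)
      (by positivity)).const_mul hl.le)
    have h3 : IntegralLE (τ n) (fun y => ‖lam • y.2.2.2 + M.ψ y.2.2.1‖ ^ p)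
        (lam * (C / (1 - lam) ^ p) + (1 - lam) * (((1 - lam) ^ p)⁻¹ * C)) :=
      h2.mono (by fun_prop) (fun _ => by positivity) fun y =>
        (norm_update_pow_le h0 h1 _ _ p).trans_eq (by ring)
    refine (h3.lintegral_le fun _ => by positivity).trans_eq ?_
    congr 1; field_simp; ring

theorem pow_bind_succ (τ : Measure (TDState S A d)) (n : ℕ) :
    τ.bind (M.tdKernel lam ^ (n + 1)) = (τ.bind (M.tdKernel lam ^ n)).bind (M.tdKernel lam) := by
  rw [pow_succ', Measure.comp_assoc]; rfl

end Trace

variable (M) in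
/-- The conditional expectation of a function of a transition given the present state. -/
noncomputable def condStep (φ : S × A × S → ℝ) (s : S) : ℝ := ∫ q, φ (s, q) ∂(M.stepKernel s)

theorem memLp_condStep {φ : S × A × S → ℝ} (hφ : MemLp φ 2 (μ ⊗ₘ M.stepKernel)) :
    MemLp (M.condStep φ) 2 μ :=
  (memLp_two_integral_kernel hφ).1

theorem condStep_next (h : S → ℝ) : M.condStep (fun t => h t.2.2) = M.powP 1 h := by
  ext s
  unfold condStep powP
  rw [pow_one, ← stepKernel_map_snd, integral_map measurable_snd.aemeasurable
    StronglyMeasurable.of_discrete.aestronglyMeasurable]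

theorem condStep_fst (h : S → ℝ) : M.condStep (fun t => h t.1) = h := by
  ext s; simp [condStep]

theorem condStep_reward : M.condStep (fun t => M.R t.1 t.2.1) = M.Rpi := by
  ext s
  unfold condStep
  rw [← integral_reward_policyKernel, ← stepKernel_map_fst,
    integral_map measurable_fst.aemeasurable StronglyMeasurable.of_discrete.aestronglyMeasurable]

theorem ErgodicChain.memLp_next (hc : M.ErgodicChain μ rhat) {h : S → ℝ} (hh : MemLp h 2 μ) :
    MemLp (fun t : S × A × S => h t.2.2) 2 (μ ⊗ₘ M.stepKernel) := by
  have e : (μ ⊗ₘ M.stepKernel).map (fun t : S × A × S => t.2.2) = μ := by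
    rw [compProd_stepKernel_map_next]; exact hc.invariant
  rw [← e] at hh
  exact hh.comp_of_map (by fun_prop)

theorem memLp_current {h : S → ℝ} (hh : MemLp h 2 μ) :
    MemLp (fun t : S × A × S => h t.1) 2 (μ ⊗ₘ M.stepKernel) := by
  rw [← Measure.fst_compProd μ M.stepKernel] at hh
  exact hh.comp_of_map (by fun_prop)

theorem ErgodicChain.memLp_reward_transition (hc : M.ErgodicChain μ rhat) :
    MemLp (fun t : S × A × S => M.R t.1 t.2.1) 2 (μ ⊗ₘ M.stepKernel) := by
  have h := hc.memLp_reward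
  rw [← compProd_stepKernel_map_stateAction] at h
  exact h.comp_of_map (by fun_prop)

/-- One step of the expectation of the eligibility trace, weighted by a function of the
transition. -/
theorem integral_bind_transition_smul_trace (τ : Measure (TDState S A d)) {φ : S × A × S → ℝ}
    (hi : Integrable (fun y : TDState S A d => φ (transition y) • y.2.2.2)
      (τ.bind (M.tdKernel lam))) :
    ∫ y, φ (transition y) • y.2.2.2 ∂(τ.bind (M.tdKernel lam)) =
      ∫ y, M.condStep φ y.2.2.1 • (lam • y.2.2.2 + M.ψ y.2.2.1) ∂τ := by
  rw [integral_bind_kernel hi]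
  refine integral_congr_ae (Filter.Eventually.of_forall fun y => ?_)
  have hφ : Measurable φ := .of_discrete
  have hsm : StronglyMeasurable (fun y : TDState S A d => φ (transition y) • y.2.2.2) :=
    ((hφ.comp measurable_transition).smul (by fun_prop)).stronglyMeasurable
  simp only
  rw [integral_tdKernel _ _ _ hsm]
  exact integral_smul_const _ _

section FromState

theorem ErgodicChain.memLp_next_pow (hc : M.ErgodicChain μ rhat) {E : Type*}
    [NormedAddCommGroup E] {p : ℝ≥0∞} {h : S → E} (hh : MemLp h p μ) (k : ℕ)
    (y : TDState S A d) :
    MemLp (fun y : TDState S A d => h y.2.2.1) p ((M.tdKernel lam ^ k) y) := by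
  have := hc.memLp_pow hh k y.2.2.1
  rw [← tdKernel_pow_map_next (lam := lam)] at this
  exact this.comp_of_map measurable_next.aemeasurable

theorem ErgodicChain.memLp_transition_pow (hc : M.ErgodicChain μ rhat) {φ : S × A × S → ℝ}
    (hφ : MemLp φ 2 (μ ⊗ₘ M.stepKernel)) (k : ℕ) (y : TDState S A d) :
    MemLp (fun y : TDState S A d => φ (transition y)) 2 ((M.tdKernel lam ^ (k + 1)) y) := by
  have := hφ.of_measure_le_smul (hc.inv_ne_top y.2.2.1) (hc.compProd_le _ k y.2.2.1)
  rw [← tdKernel_pow_succ_map_transition (lam := lam)] at this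
  exact this.comp_of_map measurable_transition.aemeasurable

theorem ErgodicChain.memLp_trace_pow (hc : M.ErgodicChain μ rhat)
    (hf : M.FeatureMatrix μ psihat) (k : ℕ) (y : TDState S A d) :
    MemLp (fun y : TDState S A d => y.2.2.2) 2 ((M.tdKernel lam ^ k) y) := by
  have hψm : Measurable M.ψ := .of_discrete
  induction k with
  | zero =>
    rw [kernel_pow_zero_apply]
    refine (memLp_two_iff_integrable_sq_norm measurable_trace.aestronglyMeasurable).2 ?_
    exact integrable_dirac' (measurable_trace.norm.pow_const 2).stronglyMeasurable (by simp)
  | succ k ih =>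
    have hmem : MemLp (fun y : TDState S A d => lam • y.2.2.2 + M.ψ y.2.2.1) 2
        ((M.tdKernel lam ^ k) y) := (ih.const_smul lam).add (hc.memLp_next_pow hf.memLp k y)
    have hi := hmem.integrable_norm_pow (p := 2) (by norm_num)
    refine (memLp_two_iff_integrable_sq_norm measurable_trace.aestronglyMeasurable).2
      ⟨(measurable_trace.norm.pow_const 2).aestronglyMeasurable, ?_⟩
    rw [hasFiniteIntegral_iff_ofReal (Filter.Eventually.of_forall fun _ => by positivity),
      kernel_pow_succ_apply, lintegral_bind_tdKernel _ (by fun_prop)]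
    simp only [lintegral_const, measure_univ, mul_one]
    have := hi.hasFiniteIntegral
    rwa [hasFiniteIntegral_iff_ofReal (Filter.Eventually.of_forall fun _ => by positivity)] at this

theorem ErgodicChain.integrable_transition_smul_trace (hc : M.ErgodicChain μ rhat)
    (hf : M.FeatureMatrix μ psihat) {φ : S × A × S → ℝ}
    (hφ : MemLp φ 2 (μ ⊗ₘ M.stepKernel)) (k : ℕ) (y : TDState S A d) :
    Integrable (fun y : TDState S A d => φ (transition y) • y.2.2.2)
      ((M.tdKernel lam ^ k) y) := by
  cases k with
  | zero =>
    have hφm : Measurable φ := .of_discrete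
    have := hφm.comp (measurable_transition (S := S) (A := A) (d := d))
    rw [kernel_pow_zero_apply]
    have hm : Measurable (fun y : TDState S A d => φ (transition y) • y.2.2.2) :=
      this.smul (by fun_prop)
    exact integrable_dirac' hm.stronglyMeasurable (by simp)
  | succ k =>
    have h1 := hc.memLp_trace_pow (lam := lam) hf (k + 1) y
    have h2 := hc.memLp_transition_pow (lam := lam) hφ k y
    generalize (M.tdKernel lam ^ (k + 1)) y = τ at h1 h2 ⊢
    exact memLp_one_iff_integrable.1 (h1.smul (p := 2) (q := 2) (r := 1) h2)

variable (M) in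
/-- The expectation of `(P^i g)(S_j) ψ(S_j)` given `S_0`. -/
noncomputable def corr (g : S → ℝ) (j i : ℕ) (s : S) : EuclideanSpace ℝ (Fin d) :=
  ∫ t, M.powP i g t • M.ψ t ∂((M.stateKernel ^ j) s)

theorem ErgodicChain.integrable_smul_pow (hc : M.ErgodicChain μ rhat)
    (hf : M.FeatureMatrix μ psihat) {g : S → ℝ} (hg : MemLp g 2 μ) (k : ℕ) (s : S) :
    Integrable (fun t => g t • M.ψ t) ((M.stateKernel ^ k) s) :=
  hc.integrable_pow (hf.integrable_smul hg) k s

theorem ErgodicChain.integral_condStep_update (hc : M.ErgodicChain μ rhat)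
    (hf : M.FeatureMatrix μ psihat) {g : S → ℝ} (hg : MemLp g 2 μ) (k : ℕ) (y : TDState S A d) :
    ∫ y', g y'.2.2.1 • (lam • y'.2.2.2 + M.ψ y'.2.2.1) ∂((M.tdKernel lam ^ k) y) =
      lam • ∫ y', g y'.2.2.1 • y'.2.2.2 ∂((M.tdKernel lam ^ k) y) + M.corr g k 0 y.2.2.1 := by
  have i1 : Integrable (fun y' : TDState S A d => g y'.2.2.1 • y'.2.2.2)
      ((M.tdKernel lam ^ k) y) :=
    hc.integrable_transition_smul_trace hf (hc.memLp_next hg) k y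
  have i2 := hc.integrable_smul_pow hf hg k y.2.2.1
  rw [← tdKernel_pow_map_next (lam := lam)] at i2
  have i3 : Integrable (fun y' : TDState S A d => g y'.2.2.1 • M.ψ y'.2.2.1)
      ((M.tdKernel lam ^ k) y) := i2.comp_aemeasurable measurable_next.aemeasurable
  have i4 : Integrable (fun y' : TDState S A d => lam • g y'.2.2.1 • y'.2.2.2)
      ((M.tdKernel lam ^ k) y) := i1.smul lam
  simp_rw [smul_add, smul_comm _ lam]
  rw [integral_add i4 i3, integral_smul]
  congr 1
  unfold corr
  simp_rw [powP_zero]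
  rw [← tdKernel_pow_map_next (lam := lam), integral_map measurable_next.aemeasurable
    i2.aestronglyMeasurable]

/-- The expected trace, weighted by a function of the next state. -/
theorem ErgodicChain.integral_next_smul_trace (hc : M.ErgodicChain μ rhat)
    (hf : M.FeatureMatrix μ psihat) {h : S → ℝ} (hh : MemLp h 2 μ) (k : ℕ) (y : TDState S A d) :
    ∫ y', h y'.2.2.1 • y'.2.2.2 ∂((M.tdKernel lam ^ k) y) =
      (lam ^ k * M.powP k h y.2.2.1) • y.2.2.2 +
        ∑ i ∈ Finset.range k, lam ^ i • M.corr h (k - 1 - i) (i + 1) y.2.2.1 := by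
  induction k generalizing h with
  | zero =>
    have hm : Measurable h := .of_discrete
    have hm2 : Measurable (fun y : TDState S A d => h y.2.2.1 • y.2.2.2) := by fun_prop
    rw [kernel_pow_zero_apply, integral_dirac' _ _ hm2.stronglyMeasurable]
    simp [powP_zero]
  | succ k ih =>
    have hi := hc.integrable_transition_smul_trace (lam := lam) hf (hc.memLp_next hh) (k + 1) y
    rw [kernel_pow_succ_apply] at hi ⊢
    -- Going back one step replaces the weight h by P h, multiplies the old trace by λ and adds one
    -- feature term; hence the induction is over all h. In the sum i < k, so the subtractions are
    -- not truncated.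
    have e := integral_bind_transition_smul_trace ((M.tdKernel lam ^ k) y)
      (φ := fun t => h t.2.2) hi
    rw [condStep_next] at e
    change ∫ y' : TDState S A d, h y'.2.2.1 • y'.2.2.2 ∂_ = _ at e
    have hP := hc.memLp_powP hh 1
    have hhi := hh.integrable one_le_two
    rw [e, hc.integral_condStep_update hf hP, ih hP, smul_add, Finset.smul_sum,
      Finset.sum_range_succ']
    have e1 : M.powP k (M.powP 1 h) y.2.2.1 = M.powP (k + 1) h y.2.2.1 := by
      rw [hc.powP_add hhi]
    have e2 : ∀ j i, M.corr (M.powP 1 h) j i y.2.2.1 = M.corr h j (i + 1) y.2.2.1 := by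
      intro j i
      unfold corr
      simp_rw [hc.powP_add hhi i 1]
    rw [e1]
    simp_rw [e2, smul_smul]
    have e3 : ∀ i ∈ Finset.range k, (lam ^ (i + 1)) • M.corr h (k + 1 - 1 - (i + 1)) (i + 1 + 1) y.2.2.1
        = (lam * lam ^ i) • M.corr h (k - 1 - i) (i + 1 + 1) y.2.2.1 := by
      intro i _
      rw [show k + 1 - 1 - (i + 1) = k - 1 - i by omega, pow_succ']
    rw [Finset.sum_congr rfl e3]
    simp only [pow_zero, one_smul, Nat.sub_zero, zero_add, Nat.add_sub_cancel]
    rw [add_assoc]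
    congr 2
    ring

/-- The expected trace, weighted by a function of the transition. -/
theorem ErgodicChain.integral_transition_smul_trace (hc : M.ErgodicChain μ rhat)
    (hf : M.FeatureMatrix μ psihat) {φ : S × A × S → ℝ}
    (hφ : MemLp φ 2 (μ ⊗ₘ M.stepKernel)) (k : ℕ) (y : TDState S A d) :
    ∫ y', φ (transition y') • y'.2.2.2 ∂((M.tdKernel lam ^ (k + 1)) y) =
      (lam ^ (k + 1) * M.powP k (M.condStep φ) y.2.2.1) • y.2.2.2 +
        ∑ i ∈ Finset.range (k + 1), lam ^ i • M.corr (M.condStep φ) (k - i) i y.2.2.1 := by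
  have hi := hc.integrable_transition_smul_trace (lam := lam) hf hφ (k + 1) y
  have hg := memLp_condStep hφ
  rw [kernel_pow_succ_apply] at hi ⊢
  rw [integral_bind_transition_smul_trace _ hi, hc.integral_condStep_update hf hg,
    hc.integral_next_smul_trace hf hg, Finset.sum_range_succ', smul_add, Finset.smul_sum,
    smul_smul]
  have e3 : ∀ i ∈ Finset.range k, (lam ^ (i + 1)) • M.corr (M.condStep φ) (k - (i + 1)) (i + 1) y.2.2.1
      = lam • lam ^ i • M.corr (M.condStep φ) (k - 1 - i) (i + 1) y.2.2.1 := by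
    intro i _
    rw [show k - (i + 1) = k - 1 - i by omega, pow_succ', smul_smul]
  rw [Finset.sum_congr rfl e3]
  simp only [pow_zero, one_smul, Nat.sub_zero]
  rw [add_assoc, pow_succ']
  congr 2
  ring

end FromState

end TDModel

/-! ### Uniqueness of the stationary distribution -/

namespace TDModel

/-- Bounded measurable functions that are Lipschitz in the eligibility trace. -/
structure TraceLipschitz {S A : Type*} [MeasurableSpace S] [MeasurableSpace A] {d : ℕ}
    (f : TDState S A d → ℝ) (C L : ℝ) : Prop where
  measurable : Measurable f
  bounded : ∀ y, |f y| ≤ C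
  lipschitz : ∀ a b c z z', |f (a, b, c, z) - f (a, b, c, z')| ≤ L * ‖z - z'‖

variable {S A : Type*} [Countable S] [MeasurableSpace S] [DiscreteMeasurableSpace S]
  [Fintype A] [MeasurableSpace A] [DiscreteMeasurableSpace A] {d : ℕ} {M : TDModel S A d}
  {μ : Measure S} [IsProbabilityMeasure μ] {rhat psihat lam cα : ℝ}
  {f : TDState S A d → ℝ} {C L : ℝ}

theorem TraceLipschitz.integrable (hf : TraceLipschitz f C L) (τ : Measure (TDState S A d))
    [IsFiniteMeasure τ] : Integrable f τ :=
  Integrable.of_bound hf.measurable.aestronglyMeasurable C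
    (Filter.Eventually.of_forall fun y => hf.bounded y)

/-- From the same transition, two processes can share their draws; their next transitions then
coincide and their traces differ by λ times the previous difference. -/
theorem TraceLipschitz.tdKernel (hf : TraceLipschitz f C L) (h0 : 0 ≤ lam) :
    TraceLipschitz (fun y => ∫ y', f y' ∂(M.tdKernel lam y)) C (lam * L) where
  measurable := hf.measurable.stronglyMeasurable.integral_kernel.measurable
  bounded y := by
    refine (norm_integral_le_of_norm_le_const (f := f) (μ := M.tdKernel lam y) (C := C)
      (Filter.Eventually.of_forall fun y' => hf.bounded y')).trans ?_
    simp
  lipschitz a b c z z' := by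
    rw [integral_tdKernel _ _ _ hf.measurable.stronglyMeasurable,
      integral_tdKernel _ _ _ hf.measurable.stronglyMeasurable]
    have hi : ∀ z : EuclideanSpace ℝ (Fin d),
        Integrable (fun q : A × S => f (c, q.1, q.2, lam • z + M.ψ c)) (M.stepKernel c) :=
      fun z => Integrable.of_bound StronglyMeasurable.of_discrete.aestronglyMeasurable C
        (Filter.Eventually.of_forall fun q => hf.bounded _)
    rw [← integral_sub (hi z) (hi z')]
    have h1 : ∀ q : A × S, ‖f (c, q.1, q.2, lam • z + M.ψ c) - f (c, q.1, q.2, lam • z' + M.ψ c)‖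
        ≤ lam * L * ‖z - z'‖ := by
      intro q
      refine (hf.lipschitz _ _ _ _ _).trans_eq ?_
      rw [add_sub_add_right_eq_sub, ← smul_sub, norm_smul, Real.norm_of_nonneg h0]; ring
    refine (norm_integral_le_of_norm_le_const (Filter.Eventually.of_forall h1)).trans ?_
    simp

theorem TraceLipschitz.tdKernel_pow (hf : TraceLipschitz f C L) (h0 : 0 ≤ lam) (n : ℕ) :
    TraceLipschitz (fun y => ∫ y', f y' ∂((M.tdKernel lam ^ n) y)) C (lam ^ n * L) := by
  induction n with
  | zero =>
    have : (fun y => ∫ y', f y' ∂((M.tdKernel lam ^ 0) y)) = f := by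
      ext y; rw [kernel_pow_zero_apply, integral_dirac' _ _ hf.measurable.stronglyMeasurable]
    rw [this, pow_zero, one_mul]; exact hf
  | succ n ih =>
    have h := ih.tdKernel (M := M) h0
    rw [← mul_assoc, ← pow_succ'] at h
    convert! h using 1
    ext y
    have e : (M.tdKernel lam ^ (n + 1)) y = (M.tdKernel lam y).bind (M.tdKernel lam ^ n : Kernel (TDState S A d) (TDState S A d)) := by
      rw [pow_succ]; exact Kernel.comp_apply _ _ _
    rw [e]
    exact integral_bind_kernel (hf.integrable _)

/-- A transition with zero eligibility trace. -/
def zeroTrace (t : S × A × S) : TDState S A d := (t.1, t.2.1, t.2.2, 0)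

omit [Countable S] [DiscreteMeasurableSpace S] [Fintype A] [DiscreteMeasurableSpace A] in
theorem measurable_zeroTrace : Measurable (zeroTrace : S × A × S → TDState S A d) := by
  unfold zeroTrace; fun_prop

/-- The initial eligibility trace is forgotten. -/
theorem TraceLipschitz.tendsto_integral_sub (hf : TraceLipschitz f C L) (h0 : 0 ≤ lam)
    (h1 : lam < 1) (τ : Measure (TDState S A d)) [IsProbabilityMeasure τ]
    {σ : Measure (S × A × S)} (hσ : τ.map transition = σ) :
    Filter.Tendsto (fun n => ∫ y, f y ∂(τ.bind (M.tdKernel lam ^ n : Kernel (TDState S A d) (TDState S A d))) -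
      ∫ t, (∫ y', f y' ∂((M.tdKernel lam ^ n) (zeroTrace t))) ∂σ) Filter.atTop (nhds 0) := by
  have hn := fun n => hf.tdKernel_pow (M := M) h0 n
  have hmz : Measurable fun y : TDState S A d => zeroTrace (d := d) (transition y) :=
    measurable_zeroTrace.comp measurable_transition
  -- Each start is compared with the same transition and zero trace. The integrand is at most λ^n L
  -- ‖z‖, which tends to zero pointwise though ‖z‖ need not be integrable; the bound 2C allows
  -- dominated convergence.
  have e : ∀ n, ∫ y, f y ∂(τ.bind (M.tdKernel lam ^ n : Kernel (TDState S A d) (TDState S A d))) -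
      ∫ t, (∫ y', f y' ∂((M.tdKernel lam ^ n) (zeroTrace t))) ∂σ =
      ∫ y, (∫ y', f y' ∂((M.tdKernel lam ^ n) y)
        - ∫ y', f y' ∂((M.tdKernel lam ^ n) (zeroTrace (transition y)))) ∂τ := by
    intro n
    have hi : Integrable (fun y => ∫ y', f y' ∂((M.tdKernel lam ^ n) (zeroTrace (transition y)))) τ :=
      Integrable.of_bound ((hn n).measurable.comp hmz).aestronglyMeasurable C
        (Filter.Eventually.of_forall fun y => (hn n).bounded _)
    rw [integral_sub ((hn n).integrable τ) hi, integral_bind_kernel (hf.integrable _), ← hσ,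
      integral_map measurable_transition.aemeasurable
        StronglyMeasurable.of_discrete.aestronglyMeasurable]
  simp_rw [e]
  have h3 : (0 : ℝ) = ∫ _y : TDState S A d, (0 : ℝ) ∂τ := by simp
  rw [h3]
  refine tendsto_integral_of_dominated_convergence (fun _ => C + C) (fun n => ?_)
    (integrable_const _) (fun n => ?_) (Filter.Eventually.of_forall fun y => ?_)
  · exact ((hn n).measurable.sub ((hn n).measurable.comp hmz)).aestronglyMeasurable
  · exact Filter.Eventually.of_forall fun y =>
      (norm_sub_le _ _).trans (add_le_add ((hn n).bounded _) ((hn n).bounded _))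
  · have h4 : Filter.Tendsto (fun n => lam ^ n * L * ‖y.2.2.2 - 0‖) Filter.atTop (nhds 0) := by
      have := ((tendsto_pow_atTop_nhds_zero_of_lt_one h0 h1).mul_const L).mul_const ‖y.2.2.2 - 0‖
      simpa using this
    exact squeeze_zero_norm (fun n => (hn n).lipschitz _ _ _ _ _) h4

-- There are countably many fibres over the transitions, and on each of them a measure is determined
-- by its characteristic function in the trace. Its real and imaginary parts are integrals of the
-- cosine and the sine of ⟨z, ξ⟩ over the fibre: functions bounded by 1 and ‖ξ‖-Lipschitz in z.
omit [Fintype A] in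
theorem ext_of_traceLipschitz [Countable A] {ν ν' : Measure (TDState S A d)}
    [IsProbabilityMeasure ν] [IsProbabilityMeasure ν']
    (h : ∀ (f : TDState S A d → ℝ) (C L : ℝ), TraceLipschitz f C L →
      ∫ y, f y ∂ν = ∫ y, f y ∂ν') : ν = ν' := by
  classical
  have hset : ∀ t : S × A × S, MeasurableSet (transition (d := d) ⁻¹' {t}) := fun t =>
    measurable_transition (measurableSet_singleton t)
  have hz : Measurable fun y : TDState S A d => y.2.2.2 := by fun_prop
  have hmap : ∀ t : S × A × S, (ν.restrict (transition ⁻¹' {t})).map (fun y => y.2.2.2) =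
      (ν'.restrict (transition ⁻¹' {t})).map (fun y => y.2.2.2) := by
    intro t
    apply Measure.ext_of_charFun
    ext ξ
    have key : ∀ g : ℝ → ℝ, (∀ x, |g x| ≤ 1) → (∀ x y, |g x - g y| ≤ |x - y|) → Measurable g →
        ∫ y in transition ⁻¹' {t}, g ⟪y.2.2.2, ξ⟫_ℝ ∂ν =
        ∫ y in transition ⁻¹' {t}, g ⟪y.2.2.2, ξ⟫_ℝ ∂ν' := by
      intro g hg1 hg2 hg3
      rw [← integral_indicator (hset t), ← integral_indicator (hset t)]
      refine h _ 1 ‖ξ‖ ⟨?_, fun y => ?_, fun a b c z z' => ?_⟩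
      · exact Measurable.indicator (by fun_prop) (hset t)
      · by_cases hy : y ∈ transition ⁻¹' {t}
        · rw [Set.indicator_of_mem hy]; exact hg1 _
        · rw [Set.indicator_of_notMem hy]; simp
      · by_cases hy : (a, b, c) = t
        · rw [Set.indicator_of_mem (by simpa [transition] using hy),
            Set.indicator_of_mem (by simpa [transition] using hy)]
          refine (hg2 _ _).trans ?_
          rw [← inner_sub_left, mul_comm]
          exact abs_real_inner_le_norm _ _
        · rw [Set.indicator_of_notMem (by simpa [transition] using hy),
            Set.indicator_of_notMem (by simpa [transition] using hy)]
          simp only [sub_self, abs_zero]; positivity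
    have hexp : ∀ τ : Measure (TDState S A d), IsFiniteMeasure τ →
        charFun (τ.map (fun y => y.2.2.2)) ξ =
          ((∫ y, Real.cos ⟪y.2.2.2, ξ⟫_ℝ ∂τ : ℝ) : ℂ) +
          ((∫ y, Real.sin ⟪y.2.2.2, ξ⟫_ℝ ∂τ : ℝ) : ℂ) * Complex.I := by
      intro τ _
      have ic0 : Integrable (fun y : TDState S A d => Real.cos ⟪y.2.2.2, ξ⟫_ℝ) τ :=
        Integrable.of_bound (Measurable.aestronglyMeasurable (by fun_prop)) 1
          (Filter.Eventually.of_forall fun y => Real.abs_cos_le_one _)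
      have ic : Integrable (fun y : TDState S A d => ((Real.cos ⟪y.2.2.2, ξ⟫_ℝ : ℝ) : ℂ)) τ :=
        ic0.ofReal
      have is0 : Integrable (fun y : TDState S A d => Real.sin ⟪y.2.2.2, ξ⟫_ℝ) τ :=
        Integrable.of_bound (Measurable.aestronglyMeasurable (by fun_prop)) 1
          (Filter.Eventually.of_forall fun y => Real.abs_sin_le_one _)
      have is : Integrable (fun y : TDState S A d => ((Real.sin ⟪y.2.2.2, ξ⟫_ℝ : ℝ) : ℂ)) τ :=
        is0.ofReal
      rw [charFun_apply, integral_map hz.aemeasurable (by fun_prop)]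
      simp_rw [Complex.exp_mul_I, ← Complex.ofReal_cos, ← Complex.ofReal_sin]
      rw [integral_add ic (is.mul_const _), integral_mul_const,
        integral_complex_ofReal, integral_complex_ofReal]
    rw [hexp _ inferInstance, hexp _ inferInstance,
      key Real.cos Real.abs_cos_le_one Real.abs_cos_sub_cos_le (by fun_prop),
      key Real.sin Real.abs_sin_le_one Real.abs_sin_sub_sin_le (by fun_prop)]
  ext B hB
  have hsplit : ∀ τ : Measure (TDState S A d), τ B = ∑' t : S × A × S,
      (τ.restrict (transition ⁻¹' {t})).map (fun y => y.2.2.2)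
        ((fun z => ((t.1, t.2.1, t.2.2, z) : TDState S A d)) ⁻¹' B) := by
    intro τ
    have hU : B = ⋃ t : S × A × S, B ∩ transition ⁻¹' {t} := by
      ext y; simp
    conv_lhs => rw [hU]
    rw [measure_iUnion]
    · congr 1; ext t
      have hm : Measurable fun z : EuclideanSpace ℝ (Fin d) =>
        ((t.1, t.2.1, t.2.2, z) : TDState S A d) := by fun_prop
      rw [Measure.map_apply hz (hm hB), Measure.restrict_apply (hz (hm hB))]
      congr 1; ext y
      simp only [Set.mem_inter_iff, Set.mem_preimage, Set.mem_singleton_iff]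
      constructor
      · rintro ⟨h1, rfl⟩; exact ⟨h1, rfl⟩
      · rintro ⟨h1, rfl⟩; exact ⟨h1, rfl⟩
    · intro t t' htt
      refine Set.disjoint_left.2 fun y hy hy' => htt ?_
      exact hy.2.symm.trans hy'.2
    · exact fun t => hB.inter (hset t)
  rw [hsplit ν, hsplit ν']
  simp_rw [hmap]

section Stationary

theorem map_next_of_invariant (hc : M.ErgodicChain μ rhat) {ν : Measure (TDState S A d)}
    [IsProbabilityMeasure ν] (hν : Kernel.Invariant (M.tdKernel lam) ν) :
    ν.map (fun y => y.2.2.1) = μ := by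
  refine hc.unique _ (Measure.isProbabilityMeasure_map measurable_next.aemeasurable) ?_
  have := M.bind_tdKernel_map_next lam ν
  rw [hν.def] at this
  exact this.symm

theorem map_transition_of_invariant (hc : M.ErgodicChain μ rhat) {ν : Measure (TDState S A d)}
    [IsProbabilityMeasure ν] (hν : Kernel.Invariant (M.tdKernel lam) ν) :
    ν.map transition = μ ⊗ₘ M.stepKernel := by
  have := M.bind_tdKernel_map_transition lam ν
  rwa [hν.def, map_next_of_invariant hc hν] at this

/-- Uniqueness of μ for the chain forces both invariant laws to have the same transition marginal.
Both are then asymptotically compared with one and the same process started at zero trace. -/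
theorem tdKernel_invariant_unique (hc : M.ErgodicChain μ rhat) (h0 : 0 ≤ lam) (h1 : lam < 1)
    {ν ν' : Measure (TDState S A d)} [IsProbabilityMeasure ν] [IsProbabilityMeasure ν']
    (hν : Kernel.Invariant (M.tdKernel lam) ν) (hν' : Kernel.Invariant (M.tdKernel lam) ν') :
    ν = ν' := by
  refine ext_of_traceLipschitz fun f C L hf => ?_
  have t1 := hf.tendsto_integral_sub (M := M) h0 h1 ν (map_transition_of_invariant hc hν)
  have t2 := hf.tendsto_integral_sub (M := M) h0 h1 ν' (map_transition_of_invariant hc hν')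
  have t3 := t1.sub t2
  simp_rw [(kernel_invariant_pow hν _).def, (kernel_invariant_pow hν' _).def,
    sub_sub_sub_cancel_right] at t3
  have := tendsto_nhds_unique t3 tendsto_const_nhds
  linarith

variable (M μ) in
/-- The process started from a stationary transition and the zero trace, at time `n`. -/
noncomputable def startZero (lam : ℝ) (n : ℕ) : Measure (TDState S A d) :=
  ((μ ⊗ₘ M.stepKernel).map zeroTrace).bind (M.tdKernel lam ^ n)

instance (n : ℕ) : IsProbabilityMeasure (M.startZero μ lam n) := by
  unfold startZero
  have : IsProbabilityMeasure ((μ ⊗ₘ M.stepKernel).map (zeroTrace (d := d))) :=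
    Measure.isProbabilityMeasure_map measurable_zeroTrace.aemeasurable
  infer_instance

theorem startZero_succ (n : ℕ) :
    M.startZero μ lam (n + 1) = (M.startZero μ lam n).bind (M.tdKernel lam) :=
  pow_bind_succ _ n

theorem startZero_map_transition (hc : M.ErgodicChain μ rhat) (n : ℕ) :
    (M.startZero μ lam n).map transition = μ ⊗ₘ M.stepKernel := by
  induction n with
  | zero =>
    have : M.startZero μ lam 0 = (μ ⊗ₘ M.stepKernel).map zeroTrace := by
      unfold startZero; rw [pow_zero]; exact Measure.id_comp
    rw [this, Measure.map_map measurable_transition measurable_zeroTrace]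
    exact Measure.map_id
  | succ n ih =>
    have h : (M.startZero μ lam n).map (fun y => y.2.2.1) = μ := by
      have h2 : (fun y : TDState S A d => y.2.2.1) = (fun t : S × A × S => t.2.2) ∘ transition := rfl
      rw [h2, ← Measure.map_map (by fun_prop) measurable_transition, ih,
        compProd_stepKernel_map_next, hc.invariant.def]
    rw [startZero_succ, bind_tdKernel_map_transition, h]

theorem integralLE_startZero (hc : M.ErgodicChain μ rhat) (hf : M.FeatureMatrix μ psihat)
    (h0 : 0 ≤ lam) (h1 : lam < 1) (n : ℕ) :
    IntegralLE (M.startZero μ lam n) (fun y => ‖y.2.2.2‖ ^ 2)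
      (d * psihat ^ 2 / (1 - lam) ^ 2) := by
  have hψm : Measurable M.ψ := .of_discrete
  refine integralLE_trace_pow h0 h1 2 (M.startZero μ lam) startZero_succ (fun n => ?_) ?_ n
  · have h := startZero_map_transition (lam := lam) hc n
    have h2 : IntegralLE μ (fun s => ‖M.ψ s‖ ^ 2) (d * psihat ^ 2) :=
      ⟨hf.integrable_norm_sq, hf.integral_norm_sq_le⟩
    have h3 : (M.startZero μ lam n).map (fun y => y.2.2.1) = μ := by
      have h2 : (fun y : TDState S A d => y.2.2.1) = (fun t : S × A × S => t.2.2) ∘ transition := rfl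
      rw [h2, ← Measure.map_map (by fun_prop) measurable_transition, h,
        compProd_stepKernel_map_next, hc.invariant.def]
    rw [← h3] at h2
    exact h2.comp_map measurable_next .of_discrete
  · have e : M.startZero μ lam 0 = (μ ⊗ₘ M.stepKernel).map zeroTrace := by
      unfold startZero; rw [pow_zero]; exact Measure.id_comp
    have hm : Measurable fun y : TDState S A d => ‖y.2.2.2‖ ^ 2 := by fun_prop
    refine IntegralLE.of_lintegral hm (fun _ => by positivity) (by positivity) ?_
    rw [e, lintegral_map (by fun_prop) measurable_zeroTrace]
    simp [zeroTrace]

end Stationary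

end TDModel

/-! ### Existence of the stationary distribution -/

namespace TDModel

variable {S A : Type*} [Countable S] [MeasurableSpace S] [DiscreteMeasurableSpace S]
  [Fintype A] [MeasurableSpace A] [DiscreteMeasurableSpace A] {d : ℕ} {M : TDModel S A d}
  {μ : Measure S} [IsProbabilityMeasure μ] {rhat psihat lam cα : ℝ}

section Prokhorov

variable [TopologicalSpace S] [DiscreteTopology S] [TopologicalSpace A] [DiscreteTopology A]

/-- The laws of the process with stationary transitions and initial trace zero are tight. -/
theorem isTightMeasureSet_startZero (hc : M.ErgodicChain μ rhat) (hf : M.FeatureMatrix μ psihat)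
    (h0 : 0 ≤ lam) (h1 : lam < 1) :
    IsTightMeasureSet (Set.range (M.startZero μ lam)) := by
  -- Splitting the state into transition and trace reduces tightness to the marginals: the
  -- transitions have one fixed law, and the traces have bounded second moments, so that Markov's
  -- inequality applies.
  let split : TDState S A d → (S × A × S) × EuclideanSpace ℝ (Fin d) :=
    fun y => (transition y, y.2.2.2)
  let join : (S × A × S) × EuclideanSpace ℝ (Fin d) → TDState S A d :=
    fun p => (p.1.1, p.1.2.1, p.1.2.2, p.2)
  have hs : Measurable split := measurable_transition.prodMk measurable_trace
  have hj : Continuous join := by fun_prop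
  have hB := integralLE_startZero (lam := lam) hc hf h0 h1
  have hB0 : 0 ≤ d * psihat ^ 2 / (1 - lam) ^ 2 := (hB 0).nonneg fun _ => by positivity
  have key : IsTightMeasureSet (Measure.map split '' Set.range (M.startZero μ lam)) := by
    refine IsTightMeasureSet.prodMk ?_ ?_
    · refine IsTightMeasureSet.subset (isTightMeasureSet_singleton (μ := μ ⊗ₘ M.stepKernel)) ?_
      rintro _ ⟨_, ⟨_, ⟨n, rfl⟩, rfl⟩, rfl⟩
      rw [Set.mem_singleton_iff, Measure.fst, Measure.map_map measurable_fst hs]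
      exact startZero_map_transition hc n
    · refine isTightMeasureSet_of_tendsto_measure_norm_gt ?_
      have hlim : Filter.Tendsto (fun r : ℝ => ENNReal.ofReal
          (d * psihat ^ 2 / (1 - lam) ^ 2 / r ^ 2)) Filter.atTop (nhds 0) := by
        rw [← ENNReal.ofReal_zero]
        refine ENNReal.tendsto_ofReal ?_
        exact tendsto_const_nhds.div_atTop (Filter.tendsto_pow_atTop (by norm_num))
      refine tendsto_of_tendsto_of_tendsto_of_le_of_le' tendsto_const_nhds hlim
        (Filter.Eventually.of_forall fun _ => bot_le) ?_
      filter_upwards [Filter.eventually_gt_atTop 0] with r hr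
      refine iSup₂_le ?_
      rintro _ ⟨_, ⟨_, ⟨n, rfl⟩, rfl⟩, rfl⟩
      have hm : MeasurableSet {x : EuclideanSpace ℝ (Fin d) | r < ‖x‖} :=
        measurableSet_lt measurable_const measurable_norm
      rw [Measure.snd, Measure.map_map measurable_snd hs,
        Measure.map_apply (measurable_snd.comp hs) hm]
      have h2 := mul_meas_ge_le_lintegral (μ := M.startZero μ lam n)
        (f := fun y => ENNReal.ofReal (‖y.2.2.2‖ ^ 2)) (by fun_prop) (ENNReal.ofReal (r ^ 2))
      have h3 := h2.trans ((hB n).lintegral_le fun _ => by positivity)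
      rw [ENNReal.ofReal_div_of_pos (by positivity), ENNReal.le_div_iff_mul_le
        (.inl (by simpa using hr.ne')) (.inl ENNReal.ofReal_ne_top), mul_comm]
      refine le_trans (mul_le_mul_right (measure_mono fun y hy => ?_) _) h3
      have hy' : r < ‖y.2.2.2‖ := hy
      exact ENNReal.ofReal_le_ofReal (by gcongr)
  have h2 := key.map hj
  refine h2.subset ?_
  rintro _ ⟨n, rfl⟩
  refine ⟨_, ⟨_, ⟨n, rfl⟩, rfl⟩, ?_⟩
  rw [Measure.map_map hj.measurable hs]
  exact Measure.map_id

-- The trace is the only coordinate that is not discrete.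
omit [Countable S] [DiscreteMeasurableSpace S] [Fintype A] [DiscreteMeasurableSpace A] in
theorem TraceLipschitz.continuous {f : TDState S A d → ℝ} {C L : ℝ} (hf : TraceLipschitz f C L) :
    Continuous f := by
  refine continuous_prod_of_discrete_left.2 fun a => continuous_prod_of_discrete_left.2 fun b =>
    continuous_prod_of_discrete_left.2 fun c => ?_
  have hL : LipschitzWith L.toNNReal fun z => f (a, b, c, z) :=
    LipschitzWith.of_dist_le_mul fun z z' => by
      rw [Real.dist_eq, dist_eq_norm]
      exact (hf.lipschitz a b c z z').trans
        (mul_le_mul_of_nonneg_right (Real.le_coe_toNNReal L) (norm_nonneg _))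
  exact hL.continuous

/-- Take a limit of the laws of the zero trace process along a nonprincipal ultrafilter. The laws at
times n and n + 1 are the n-th iterates of the laws at times 0 and 1, which have the same transition
marginal. By forgetting of the trace, test functions have asymptotically equal integrals, so the
limit is invariant without any averaging over time. -/
theorem exists_invariant_tdKernel (hc : M.ErgodicChain μ rhat) (hf : M.FeatureMatrix μ psihat)
    (h0 : 0 ≤ lam) (h1 : lam < 1) : ∃ ν : Measure (TDState S A d), IsProbabilityMeasure ν ∧
      Kernel.Invariant (M.tdKernel lam) ν := by
  let u : ℕ → ProbabilityMeasure (TDState S A d) := fun n => ⟨M.startZero μ lam n, inferInstance⟩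
  have ht : IsTightMeasureSet {((σ : ProbabilityMeasure (TDState S A d)) : Measure (TDState S A d)) |
      σ ∈ Set.range u} := by
    refine (isTightMeasureSet_startZero hc hf h0 h1).subset ?_
    rintro _ ⟨_, ⟨n, rfl⟩, rfl⟩
    exact ⟨n, rfl⟩
  have hcomp := isCompact_closure_of_isTightMeasureSet ht
  obtain ⟨ν, -, hν⟩ := hcomp.ultrafilter_le_nhds' (Ultrafilter.map u (Filter.hyperfilter ℕ))
    (Filter.mem_of_superset (Filter.Eventually.of_forall (f := (Filter.hyperfilter ℕ : Filter ℕ))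
      fun n => subset_closure (Set.mem_range_self n)) fun _ h => h)
  have hlim : ∀ (f : TDState S A d → ℝ) (C L : ℝ), TraceLipschitz f C L →
      Filter.Tendsto (fun n => ∫ y, f y ∂(M.startZero μ lam n)) (Filter.hyperfilter ℕ)
        (nhds (∫ y, f y ∂(ν : Measure (TDState S A d)))) := by
    intro f C L hfl
    have hν' : Filter.Tendsto u (Filter.hyperfilter ℕ) (nhds ν) := hν
    exact ProbabilityMeasure.tendsto_iff_forall_integral_tendsto.1 hν'
      (BoundedContinuousFunction.ofNormedAddCommGroup f hfl.continuous C hfl.bounded)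
  refine ⟨(ν : Measure (TDState S A d)), inferInstance, ?_⟩
  refine ext_of_traceLipschitz fun f C L hfl => ?_
  rw [integral_bind_kernel (hfl.integrable _)]
  have l1 := hlim _ _ _ (hfl.tdKernel (M := M) h0)
  have l2 := hlim _ _ _ hfl
  have e : ∀ n, ∫ y, (∫ y', f y' ∂(M.tdKernel lam y)) ∂(M.startZero μ lam n) =
      ∫ y, f y ∂(M.startZero μ lam (n + 1)) := fun n => by
    rw [startZero_succ, integral_bind_kernel (hfl.integrable _)]
  simp_rw [e] at l1
  have d1 := hfl.tendsto_integral_sub (M := M) h0 h1 (M.startZero μ lam 1)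
    (startZero_map_transition hc 1)
  have d0 := hfl.tendsto_integral_sub (M := M) h0 h1 (M.startZero μ lam 0)
    (startZero_map_transition hc 0)
  have e2 : ∀ m n, (M.startZero μ lam m).bind
      (M.tdKernel lam ^ n : Kernel (TDState S A d) (TDState S A d)) =
      M.startZero μ lam (n + m) := by
    intro m n
    unfold startZero
    rw [pow_add, Measure.comp_assoc]; rfl
  simp_rw [e2] at d1 d0
  have d2 := (d1.sub d0).mono_left Nat.hyperfilter_le_atTop
  simp_rw [sub_sub_sub_cancel_right, add_zero, sub_zero] at d2
  have := tendsto_nhds_unique d2 (l1.sub l2)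
  linarith

end Prokhorov

/-- The process `Y_k` has a stationary distribution. -/
theorem ErgodicChain.exists_invariant_tdKernel (hc : M.ErgodicChain μ rhat)
    (hf : M.FeatureMatrix μ psihat) (h0 : 0 ≤ lam) (h1 : lam < 1) :
    ∃ ν : Measure (TDState S A d), IsProbabilityMeasure ν ∧
      Kernel.Invariant (M.tdKernel lam) ν := by
  -- The statement has no topology on states and actions; the discrete one is supplied for
  -- Prokhorov's theorem.
  let _ : TopologicalSpace S := ⊥
  have : DiscreteTopology S := ⟨rfl⟩
  let _ : TopologicalSpace A := ⊥
  have : DiscreteTopology A := ⟨rfl⟩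
  exact TDModel.exists_invariant_tdKernel hc hf h0 h1

variable {ν : Measure (TDState S A d)} [IsProbabilityMeasure ν]

theorem tendsto_integral_startZero (hc : M.ErgodicChain μ rhat) (h0 : 0 ≤ lam) (h1 : lam < 1)
    (hν : Kernel.Invariant (M.tdKernel lam) ν) {f : TDState S A d → ℝ} {C L : ℝ}
    (hfl : TraceLipschitz f C L) :
    Filter.Tendsto (fun n => ∫ y, f y ∂(M.startZero μ lam n)) Filter.atTop
      (nhds (∫ y, f y ∂ν)) := by
  have d1 := hfl.tendsto_integral_sub (M := M) h0 h1 (M.startZero μ lam 0)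
    (startZero_map_transition hc 0)
  have d0 := hfl.tendsto_integral_sub (M := M) h0 h1 ν (map_transition_of_invariant hc hν)
  have e2 : ∀ n, (M.startZero μ lam 0).bind
      (M.tdKernel lam ^ n : Kernel (TDState S A d) (TDState S A d)) =
      M.startZero μ lam n := by
    intro n
    unfold startZero
    rw [pow_zero]; exact congrArg (Measure.bind · _) Measure.id_comp
  simp_rw [e2] at d1
  simp_rw [(kernel_invariant_pow hν _).def] at d0
  have d2 := (d1.sub d0).add_const (∫ y, f y ∂ν)
  simpa using d2

/-- The stationary eligibility trace is square integrable. -/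
theorem ErgodicChain.memLp_trace_invariant (hc : M.ErgodicChain μ rhat)
    (hf : M.FeatureMatrix μ psihat) (h0 : 0 ≤ lam) (h1 : lam < 1)
    (hν : Kernel.Invariant (M.tdKernel lam) ν) :
    MemLp (fun y : TDState S A d => y.2.2.2) 2 ν := by
  set B := d * psihat ^ 2 / (1 - lam) ^ 2 with hB
  -- The function ‖z‖² is not an admissible test function, but its truncation at N is bounded and
  -- 2N-Lipschitz in the trace. The uniform bound B passes to the stationary law for each N, and
  -- Fatou's lemma removes the truncation.
  have hfN : ∀ N : ℕ, TraceLipschitz (S := S) (A := A) (d := d)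
      (fun y => min ‖y.2.2.2‖ N ^ 2) ((N : ℝ) ^ 2) (2 * N) := by
    intro N
    refine ⟨by fun_prop, fun y => ?_, fun a b c z z' => ?_⟩
    · rw [abs_of_nonneg (by positivity)]
      have : 0 ≤ min ‖y.2.2.2‖ (N : ℝ) := by positivity
      gcongr
      exact min_le_right _ _
    · have h2 : |min ‖z‖ (N : ℝ) - min ‖z'‖ N| ≤ ‖z - z'‖ :=
        (abs_min_sub_min_le_max _ _ _ _).trans (by simpa using abs_norm_sub_norm_le z z')
      have ha : 0 ≤ min ‖z‖ (N : ℝ) := by positivity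
      have hb : 0 ≤ min ‖z'‖ (N : ℝ) := by positivity
      have ha' := min_le_right ‖z‖ (N : ℝ)
      have hb' := min_le_right ‖z'‖ (N : ℝ)
      change |min ‖z‖ (N : ℝ) ^ 2 - min ‖z'‖ N ^ 2| ≤ _
      rw [sq_sub_sq, abs_mul, abs_of_nonneg (add_nonneg ha hb)]
      exact mul_le_mul (by linarith) h2 (abs_nonneg _) (by positivity)
  have hle : ∀ N : ℕ, ∫ y, min ‖y.2.2.2‖ (N : ℝ) ^ 2 ∂ν ≤ B := by
    intro N
    refine le_of_tendsto (tendsto_integral_startZero hc h0 h1 hν (hfN N))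
      (Filter.Eventually.of_forall fun n => ?_)
    have h2 := integralLE_startZero (lam := lam) hc hf h0 h1 n
    refine (integral_mono ((hfN N).integrable _) h2.1 fun y => ?_).trans h2.2
    have : 0 ≤ min ‖y.2.2.2‖ (N : ℝ) := by positivity
    change min ‖y.2.2.2‖ (N : ℝ) ^ 2 ≤ ‖y.2.2.2‖ ^ 2
    gcongr
    exact min_le_left _ _
  refine (memLp_two_iff_integrable_sq_norm measurable_trace.aestronglyMeasurable).2 ?_
  have hm : Measurable fun y : TDState S A d => ‖y.2.2.2‖ ^ 2 := by fun_prop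
  refine ⟨hm.aestronglyMeasurable, ?_⟩
  rw [hasFiniteIntegral_iff_ofReal (Filter.Eventually.of_forall fun _ => by positivity)]
  refine lt_of_le_of_lt ?_ (ENNReal.ofReal_lt_top (r := B))
  have h2 := lintegral_liminf_le (μ := ν) (u := Filter.atTop)
    (f := fun (N : ℕ) y => ENNReal.ofReal (min ‖y.2.2.2‖ (N : ℝ) ^ 2))
    (fun N => (hfN N).measurable.ennreal_ofReal)
  have h3 : ∀ y : TDState S A d, Filter.liminf
      (fun N : ℕ => ENNReal.ofReal (min ‖y.2.2.2‖ (N : ℝ) ^ 2)) Filter.atTop =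
      ENNReal.ofReal (‖y.2.2.2‖ ^ 2) := by
    intro y
    refine Filter.Tendsto.liminf_eq (tendsto_const_nhds.congr' ?_)
    obtain ⟨N, hN⟩ := exists_nat_ge ‖y.2.2.2‖
    filter_upwards [Filter.eventually_ge_atTop N] with n hn
    rw [min_eq_left (hN.trans (by exact_mod_cast hn))]
  simp_rw [h3] at h2
  refine h2.trans (Filter.liminf_le_of_le (by isBoundedDefault) fun b hb => ?_)
  obtain ⟨N, hN⟩ := hb.exists
  refine hN.trans ?_
  rw [← ofReal_integral_eq_lintegral_ofReal ((hfN N).integrable ν)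
    (Filter.Eventually.of_forall fun _ => by positivity)]
  exact ENNReal.ofReal_le_ofReal (hle N)

end TDModel

/-! ### Stationary means of `T`, `b` and `F` -/

/-- A function with values in a space of linear maps between finite dimensional spaces is
integrable if it is so pointwise. -/
theorem ContinuousLinearMap.integrable_of_forall_apply {α E F : Type*} [MeasurableSpace α]
    {τ : Measure α} [NormedAddCommGroup E] [NormedSpace ℝ E] [FiniteDimensional ℝ E]
    [NormedAddCommGroup F] [NormedSpace ℝ F] [FiniteDimensional ℝ F] {f : α → E →L[ℝ] F}
    (h : ∀ x, Integrable (fun a => f a x) τ) : Integrable f τ := by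
  let b := Module.finBasis ℝ E
  let Λ : (Fin (Module.finrank ℝ E) → F) →ₗ[ℝ] (E →L[ℝ] F) :=
    LinearMap.toContinuousLinearMap.toLinearMap ∘ₗ (b.constr ℝ).toLinearMap
  have e : f = fun a => Λ.toContinuousLinearMap fun i => f a (b i) := by
    ext a x
    have : (f a : E →ₗ[ℝ] F) = b.constr ℝ fun i => f a (b i) :=
      b.ext fun i => by simp
    exact congrArg (fun g : E →ₗ[ℝ] F => g x) this
  rw [e]
  exact Λ.toContinuousLinearMap.integrable_comp (Integrable.of_eval fun i => h (b i))

namespace TDModel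

variable {S A : Type*} [Countable S] [MeasurableSpace S] [DiscreteMeasurableSpace S]
  [Fintype A] [MeasurableSpace A] [DiscreteMeasurableSpace A] {d : ℕ} {M : TDModel S A d}
  {μ : Measure S} [IsProbabilityMeasure μ] {rhat psihat lam cα : ℝ}

theorem ErgodicChain.condStep_next_sub (hc : M.ErgodicChain μ rhat) {h : S → ℝ}
    (hh : MemLp h 2 μ) :
    M.condStep (fun t => h t.2.2 - h t.1) = fun s => M.powP 1 h s - h s := by
  ext s
  have hi : Integrable (fun q : A × S => h q.2) (M.stepKernel s) := by
    have := hc.integrable_pow (hh.integrable one_le_two) 1 s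
    rw [pow_one, ← stepKernel_map_snd] at this
    exact this.comp_measurable measurable_snd
  have e : M.condStep (fun t => h t.2.2 - h t.1) s = ∫ q : A × S, (h q.2 - h s) ∂M.stepKernel s :=
    rfl
  rw [← condStep_next, e, integral_sub hi (integrable_const _)]
  simp [condStep]

theorem resolvent_condStep_one (h0 : 0 ≤ lam) (h1 : lam < 1) :
    M.resolvent lam (M.condStep fun _ => 1) = fun _ => 1 / (1 - lam) * 1 := by
  ext s
  rw [condStep_fst fun _ => (1 : ℝ)]
  unfold resolvent
  simp_rw [powP_const, mul_one]
  rw [tsum_geometric_of_lt_one h0 h1, one_div]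

section Stationary

variable {ν : Measure (TDState S A d)} [IsProbabilityMeasure ν]

theorem memLp_transition_invariant (hc : M.ErgodicChain μ rhat)
    (hν : Kernel.Invariant (M.tdKernel lam) ν) {φ : S × A × S → ℝ}
    (hφ : MemLp φ 2 (μ ⊗ₘ M.stepKernel)) :
    MemLp (fun y : TDState S A d => φ (transition y)) 2 ν := by
  rw [← map_transition_of_invariant hc hν] at hφ
  exact hφ.comp_of_map measurable_transition.aemeasurable

theorem ErgodicChain.integrable_transition_smul_trace_invariant (hc : M.ErgodicChain μ rhat)
    (hf : M.FeatureMatrix μ psihat) (h0 : 0 ≤ lam) (h1 : lam < 1)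
    (hν : Kernel.Invariant (M.tdKernel lam) ν) {φ : S × A × S → ℝ}
    (hφ : MemLp φ 2 (μ ⊗ₘ M.stepKernel)) :
    Integrable (fun y : TDState S A d => φ (transition y) • y.2.2.2) ν :=
  memLp_one_iff_integrable.1 ((hc.memLp_trace_invariant hf h0 h1 hν).smul (p := 2) (q := 2)
    (r := 1) (memLp_transition_invariant hc hν hφ))

/-- One step of the stationary expectation of the weighted trace. -/
theorem ErgodicChain.integral_invariant_step (hc : M.ErgodicChain μ rhat)
    (hf : M.FeatureMatrix μ psihat) (h0 : 0 ≤ lam) (h1 : lam < 1)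
    (hν : Kernel.Invariant (M.tdKernel lam) ν) {φ : S × A × S → ℝ}
    (hφ : MemLp φ 2 (μ ⊗ₘ M.stepKernel)) :
    ∫ y, φ (transition y) • y.2.2.2 ∂ν =
      lam • ∫ y, M.condStep φ y.2.2.1 • y.2.2.2 ∂ν + M.PsiTLam μ (M.condStep φ) := by
  have hi := hc.integrable_transition_smul_trace_invariant hf h0 h1 hν hφ
  have hg := memLp_condStep hφ
  have i1 : Integrable (fun y : TDState S A d => M.condStep φ y.2.2.1 • y.2.2.2) ν :=
    hc.integrable_transition_smul_trace_invariant hf h0 h1 hν (hc.memLp_next hg)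
  have i2 := hf.integrable_smul hg
  rw [← map_next_of_invariant hc hν] at i2
  have i3 : Integrable (fun y : TDState S A d => M.condStep φ y.2.2.1 • M.ψ y.2.2.1) ν :=
    i2.comp_aemeasurable measurable_next.aemeasurable
  have i4 : Integrable (fun y : TDState S A d => lam • M.condStep φ y.2.2.1 • y.2.2.2) ν :=
    i1.smul lam
  conv at hi => rw [← hν.def]
  conv_lhs => rw [← hν.def]
  rw [integral_bind_transition_smul_trace _ hi]
  simp_rw [smul_add, smul_comm _ lam]
  rw [integral_add i4 i3, integral_smul]
  congr 1
  unfold PsiTLam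
  conv_rhs => rw [← map_next_of_invariant hc hν]
  rw [integral_map measurable_next.aemeasurable i2.aestronglyMeasurable]

/-- The stationary expectation of the trace, weighted by a function of the transition. -/
theorem ErgodicChain.integral_invariant_transition_smul_trace (hc : M.ErgodicChain μ rhat)
    (hf : M.FeatureMatrix μ psihat) (h0 : 0 ≤ lam) (h1 : lam < 1)
    (hν : Kernel.Invariant (M.tdKernel lam) ν) {φ : S × A × S → ℝ}
    (hφ : MemLp φ 2 (μ ⊗ₘ M.stepKernel)) :
    ∫ y, φ (transition y) • y.2.2.2 ∂ν = M.PsiTLam μ (M.resolvent lam (M.condStep φ)) := by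
  set g := M.condStep φ with hgdef
  have hg : MemLp g 2 μ := memLp_condStep hφ
  -- G h is the stationary expectation of the trace weighted by a function of the transition with
  -- conditional mean h. Stationarity gives G h = Ψᵀ Λ h + λ G(P h). Iterating produces the
  -- resolvent series, with a remainder λ^n G(P^n g) that vanishes because P contracts L²(μ) and so
  -- keeps G(P^n g) bounded.
  set G : (S → ℝ) → EuclideanSpace ℝ (Fin d) := fun h =>
    lam • ∫ y, h y.2.2.1 • y.2.2.2 ∂ν + M.PsiTLam μ h with hG
  have hstep : ∀ n, G (M.powP n g) = lam • G (M.powP (n + 1) g) + M.PsiTLam μ (M.powP n g) := by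
    intro n
    have e := hc.integral_invariant_step hf h0 h1 hν (hc.memLp_next (hc.memLp_powP hg n))
    have e1 : M.powP 1 (M.powP n g) = M.powP (n + 1) g := by
      ext s; rw [add_comm n 1, hc.powP_add (hg.integrable one_le_two)]
    rw [condStep_next, e1] at e
    simp only [hG]
    rw [← e]; rfl
  have hsum : ∀ n, G g = ∑ m ∈ Finset.range n, lam ^ m • M.PsiTLam μ (M.powP m g)
      + lam ^ n • G (M.powP n g) := by
    intro n
    induction n with
    | zero =>
      have : M.powP 0 g = g := funext (powP_zero g)
      simp [this]
    | succ n ih =>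
      rw [ih, hstep n, Finset.sum_range_succ, smul_add, smul_smul, ← pow_succ]
      abel
  have hz := hc.memLp_trace_invariant hf h0 h1 hν
  set B := ∫ y, ‖y.2.2.2‖ ^ 2 ∂ν with hB
  have hbound : ∀ n, ‖G (M.powP n g)‖ ≤ (∫ s, g s ^ 2 ∂μ + B) +
      √(M.psiPrime μ) * √(∫ s, g s ^ 2 ∂μ) := by
    intro n
    refine (norm_add_le _ _).trans (add_le_add ?_ (hc.norm_PsiTLam_powP_le hf hg n))
    have hl : ‖∫ y : TDState S A d, M.powP n g y.2.2.1 • y.2.2.2 ∂ν‖ ≤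
        ∫ s, g s ^ 2 ∂μ + B := by
      have i1 := (hc.memLp_powP hg n).integrable_sq
      rw [← map_next_of_invariant hc hν] at i1
      have i2 : Integrable (fun y : TDState S A d => M.powP n g y.2.2.1 ^ 2) ν :=
        i1.comp_aemeasurable measurable_next.aemeasurable
      have i3 : Integrable (fun y : TDState S A d => ‖y.2.2.2‖ ^ 2) ν :=
        (memLp_two_iff_integrable_sq_norm hz.1).1 hz
      have e1 : ∫ y : TDState S A d, M.powP n g y.2.2.1 ^ 2 ∂ν ≤ ∫ s, g s ^ 2 ∂μ := by
        rw [← integral_map measurable_next.aemeasurable i1.aestronglyMeasurable,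
          map_next_of_invariant hc hν]
        exact hc.integral_powP_sq_le hg n
      calc _ ≤ ∫ y : TDState S A d, (M.powP n g y.2.2.1 ^ 2 + ‖y.2.2.2‖ ^ 2) ∂ν := by
            refine norm_integral_le_of_norm_le (i2.add i3) (Filter.Eventually.of_forall fun y => ?_)
            rw [norm_smul, ← sq_abs (M.powP n g y.2.2.1), Real.norm_eq_abs]
            nlinarith [sq_nonneg (|M.powP n g y.2.2.1| - ‖y.2.2.2‖),
              sq_nonneg (|M.powP n g y.2.2.1| + ‖y.2.2.2‖)]
        _ ≤ _ := by rw [integral_add i2 i3]; linarith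
    rw [norm_smul, Real.norm_of_nonneg h0]
    exact (mul_le_of_le_one_left (norm_nonneg _) h1.le).trans hl
  have t1 := (hc.hasSum_PsiTLam hf h0 h1 hg).tendsto_sum_nat
  have t2 : Filter.Tendsto (fun n => lam ^ n • G (M.powP n g)) Filter.atTop (nhds 0) := by
    have t := (tendsto_pow_atTop_nhds_zero_of_lt_one h0 h1).mul_const
      ((∫ s, g s ^ 2 ∂μ + B) + √(M.psiPrime μ) * √(∫ s, g s ^ 2 ∂μ))
    rw [zero_mul] at t
    refine squeeze_zero_norm (fun n => ?_) t
    rw [norm_smul, Real.norm_of_nonneg (pow_nonneg h0 n)]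
    exact mul_le_mul_of_nonneg_left (hbound n) (pow_nonneg h0 n)
  have t3 := t1.add t2
  simp_rw [← hsum, add_zero] at t3
  rw [hc.integral_invariant_step hf h0 h1 hν hφ]
  exact tendsto_nhds_unique tendsto_const_nhds t3

theorem T_apply (x : TDParam d) (y : TDState S A d) : M.T cα y x = WithLp.toLp 2 (-(cα * x.fst),
    -(x.fst • M.proj y.2.2.2) + ⟪M.ψ y.2.2.1 - M.ψ y.1, x.snd⟫_ℝ • M.proj y.2.2.2) := rfl

/-- The column of r weights the trace by 1, and the block of θ weights it by (Ψθ)(s') - (Ψθ)(s),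
whose conditional mean (P - I)Ψθ has the resolvent (P^(λ) - I)Ψθ. The projection commutes with the
integral. -/
theorem ErgodicChain.integral_T_apply (hc : M.ErgodicChain μ rhat)
    (hf : M.FeatureMatrix μ psihat) (h0 : 0 ≤ lam) (h1 : lam < 1)
    (hν : Kernel.Invariant (M.tdKernel lam) ν) (x : TDParam d) :
    Integrable (fun y => M.T cα y x) ν ∧ ∫ y, M.T cα y x ∂ν = M.Tbar μ lam cα x := by
  have hψ := hf.memLp_Psi x.snd
  have p1 : MemLp (fun _ : S × A × S => (1 : ℝ)) 2 (μ ⊗ₘ M.stepKernel) := memLp_const 1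
  have p2 : MemLp (fun t : S × A × S => M.Psi x.snd t.2.2 - M.Psi x.snd t.1) 2
      (μ ⊗ₘ M.stepKernel) := (hc.memLp_next hψ).sub (memLp_current hψ)
  have i1 := hc.integrable_transition_smul_trace_invariant hf h0 h1 hν p1
  have i2 := hc.integrable_transition_smul_trace_invariant hf h0 h1 hν p2
  have m1 := hc.integral_invariant_transition_smul_trace hf h0 h1 hν p1
  have m2 := hc.integral_invariant_transition_smul_trace hf h0 h1 hν p2
  rw [hc.condStep_next_sub hψ, ← hc.driftOp_apply hf h0 h1] at m2
  rw [resolvent_condStep_one h0 h1, PsiTLam_const_mul] at m1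
  have j1 : Integrable (fun y : TDState S A d => -(x.fst • M.proj y.2.2.2)) ν := by
    have : Integrable (fun y : TDState S A d => M.proj y.2.2.2) ν := by
      simpa only [one_smul] using M.proj.integrable_comp i1
    exact (this.smul x.fst).neg
  have j2 : Integrable (fun y : TDState S A d =>
      ⟪M.ψ y.2.2.1 - M.ψ y.1, x.snd⟫_ℝ • M.proj y.2.2.2) ν := by
    have := M.proj.integrable_comp i2
    simp_rw [map_smul] at this
    simp_rw [inner_sub_left]
    exact this
  have e2 : ∫ y : TDState S A d, -(x.fst • M.proj y.2.2.2) ∂ν =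
      -(x.fst • (1 / (1 - lam)) • M.proj (M.PsiTLam μ fun _ => 1)) := by
    have := M.proj.integral_comp_comm i1
    rw [m1, map_smul] at this
    rw [integral_neg, integral_smul, ← this]
    simp
  have e3 : ∫ y : TDState S A d, ⟪M.ψ y.2.2.1 - M.ψ y.1, x.snd⟫_ℝ • M.proj y.2.2.2 ∂ν =
      M.proj (M.driftOp μ lam x.snd) := by
    rw [← m2, ← M.proj.integral_comp_comm i2]
    simp_rw [map_smul, inner_sub_left]
    rfl
  have j3 : Integrable (fun _ : TDState S A d => -(cα * x.fst)) ν := integrable_const _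
  have j4 : Integrable (fun y : TDState S A d => -(x.fst • M.proj y.2.2.2) +
      ⟪M.ψ y.2.2.1 - M.ψ y.1, x.snd⟫_ℝ • M.proj y.2.2.2) ν := j1.add j2
  simp_rw [T_apply]
  refine ⟨integrable_toLp_prod j3 j4, ?_⟩
  rw [integral_toLp_prod j3 j4, Tbar_apply, integral_const, integral_add j1 j2, e2, e3]
  simp

theorem ErgodicChain.integral_T (hc : M.ErgodicChain μ rhat)
    (hf : M.FeatureMatrix μ psihat) (h0 : 0 ≤ lam) (h1 : lam < 1)
    (hν : Kernel.Invariant (M.tdKernel lam) ν) :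
    Integrable (M.T cα) ν ∧ ∫ y, M.T cα y ∂ν = M.Tbar μ lam cα := by
  have hi : Integrable (M.T cα) ν := ContinuousLinearMap.integrable_of_forall_apply fun x =>
    (hc.integral_T_apply hf h0 h1 hν x).1
  refine ⟨hi, ?_⟩
  ext1 x
  rw [ContinuousLinearMap.integral_apply hi]
  exact (hc.integral_T_apply hf h0 h1 hν x).2

theorem ErgodicChain.integral_b (hc : M.ErgodicChain μ rhat)
    (hf : M.FeatureMatrix μ psihat) (h0 : 0 ≤ lam) (h1 : lam < 1)
    (hν : Kernel.Invariant (M.tdKernel lam) ν) :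
    Integrable (M.b cα) ν ∧ ∫ y, M.b cα y ∂ν = M.bbar μ lam cα := by
  have p := hc.memLp_reward_transition
  have i1 := hc.integrable_transition_smul_trace_invariant hf h0 h1 hν p
  have m1 := hc.integral_invariant_transition_smul_trace hf h0 h1 hν p
  have e1 : M.resolvent lam (M.condStep fun t => M.R t.1 t.2.1) = M.RLam lam := by
    ext s; rw [condStep_reward, hc.RLam_eq h0 h1]
  rw [e1] at m1
  have j1 : Integrable (fun y : TDState S A d => M.R y.1 y.2.1 • M.proj y.2.2.2) ν := by
    have := M.proj.integrable_comp i1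
    simp_rw [map_smul] at this
    exact this
  have j2 : Integrable (fun y : TDState S A d => cα * M.R y.1 y.2.1) ν :=
    ((memLp_transition_invariant hc hν p).integrable one_le_two).const_mul cα
  have e2 : ∫ y : TDState S A d, M.R y.1 y.2.1 • M.proj y.2.2.2 ∂ν =
      M.proj (M.PsiTLam μ (M.RLam lam)) := by
    rw [← m1, ← M.proj.integral_comp_comm i1]
    simp_rw [map_smul]
    rfl
  have e3 : ∫ y : TDState S A d, cα * M.R y.1 y.2.1 ∂ν = cα * M.rbar μ := by
    have hR : ∫ t, M.R t.1 t.2.1 ∂(μ ⊗ₘ M.stepKernel) = M.rbar μ := by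
      rw [Measure.integral_compProd (p.integrable one_le_two)]
      unfold rbar
      rw [← condStep_reward]
      rfl
    rw [integral_const_mul, ← hR, ← map_transition_of_invariant hc hν,
      integral_map measurable_transition.aemeasurable
        StronglyMeasurable.of_discrete.aestronglyMeasurable]
    rfl
  unfold b bbar
  refine ⟨integrable_toLp_prod j2 j1, ?_⟩
  rw [integral_toLp_prod j2 j1, e2, e3]

/-- The stationary means of the operators of the iteration. -/
theorem ErgodicChain.integral_F (hc : M.ErgodicChain μ rhat)
    (hf : M.FeatureMatrix μ psihat) (h0 : 0 ≤ lam) (h1 : lam < 1)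
    (hν : Kernel.Invariant (M.tdKernel lam) ν) (x : TDParam d) :
    Integrable (M.F cα x) ν ∧ ∫ y, M.F cα x y ∂ν = M.Tbar μ lam cα x + M.bbar μ lam cα := by
  obtain ⟨i1, m1⟩ := hc.integral_T_apply (cα := cα) hf h0 h1 hν x
  obtain ⟨i2, m2⟩ := hc.integral_b (cα := cα) hf h0 h1 hν
  exact ⟨i1.add i2, by unfold F; rw [integral_add i1 i2, m1, m2]⟩

end Stationary

end TDModel

/-! ### Moment bounds for `T(Y_k)` and `b(Y_k)` -/

namespace TDModel

variable {S A : Type*} [Countable S] [MeasurableSpace S] [DiscreteMeasurableSpace S]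
  [Fintype A] [MeasurableSpace A] [DiscreteMeasurableSpace A] {d : ℕ} {M : TDModel S A d}
  {μ : Measure S} [IsProbabilityMeasure μ] {rhat psihat lam cα : ℝ}
  {f₁ f₂ f₃ : S → ℝ} {ρ : ℝ}

theorem integralLE_next_pow {h c : S → ℝ} (hh : ∀ s k, IntegralLE ((M.stateKernel ^ k) s) h (c s))
    (k : ℕ) (y : TDState S A d) :
    IntegralLE ((M.tdKernel lam ^ k) y) (fun y => h y.2.2.1) (c y.2.2.1) := by
  have := hh y.2.2.1 k
  rw [← tdKernel_pow_map_next (lam := lam)] at this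
  exact this.comp_map measurable_next .of_discrete

theorem tdKernel_pow_succ_map_current (k : ℕ) (y : TDState S A d) :
    ((M.tdKernel lam ^ (k + 1)) y).map (fun y => y.1) = (M.stateKernel ^ k) y.2.2.1 := by
  have e : (fun y : TDState S A d => y.1) = Prod.fst ∘ transition := rfl
  rw [e, ← Measure.map_map measurable_fst measurable_transition,
    tdKernel_pow_succ_map_transition]
  exact Measure.fst_compProd _ _

/-- The current state is prescribed at time 0, and at time k + 1 it is k steps from the next state
of y. The sum of the two constants covers both cases. -/
theorem integralLE_current_pow {h c : S → ℝ} (h0 : ∀ s, 0 ≤ h s) (hc0 : ∀ s, 0 ≤ c s)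
    (hh : ∀ s k, IntegralLE ((M.stateKernel ^ k) s) h (c s)) (k : ℕ) (y : TDState S A d) :
    IntegralLE ((M.tdKernel lam ^ k) y) (fun y => h y.1) (c y.1 + c y.2.2.1) := by
  have hm : Measurable h := .of_discrete
  have hmc : Measurable fun y : TDState S A d => h y.1 := by fun_prop
  cases k with
  | zero =>
    have h1 := (hh y.1 0).lintegral_le h0
    refine IntegralLE.of_lintegral hmc (fun y => h0 _) (add_nonneg (hc0 _) (hc0 _)) ?_
    rw [kernel_pow_zero_apply, lintegral_dirac' _ hm.ennreal_ofReal] at h1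
    rw [kernel_pow_zero_apply, lintegral_dirac' _ hmc.ennreal_ofReal]
    exact h1.trans (ENNReal.ofReal_le_ofReal (by linarith [hc0 y.2.2.1]))
  | succ k =>
    have := hh y.2.2.1 k
    rw [← tdKernel_pow_succ_map_current (lam := lam)] at this
    exact (this.comp_map measurable_fst .of_discrete).mono_const (by linarith [hc0 y.1])

theorem sqrt_div_pow_four (φ : ℝ) : √(φ / (1 - lam) ^ 4) = √φ / (1 - lam) ^ 2 := by
  rw [Real.sqrt_div' _ (by positivity), show (1 - lam) ^ 4 = ((1 - lam) ^ 2) ^ 2 by ring,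
    Real.sqrt_sq (by positivity)]

namespace StableChain

theorem integralLE_feature (hs : M.StableChain μ f₁ f₂ f₃ ρ) (s : S) (k : ℕ) :
    IntegralLE ((M.stateKernel ^ k) s) (fun s => ‖M.ψ s‖ ^ 4) (f₃ s) :=
  .of_lintegral .of_discrete (fun _ => by positivity) (hs.f₃_nonneg s) (hs.moment_feature s k)

theorem integralLE_f₁ (hs : M.StableChain μ f₁ f₂ f₃ ρ) (s : S) (k : ℕ) :
    IntegralLE ((M.stateKernel ^ k) s) (fun s => f₁ s ^ 4) (f₂ s) :=
  .of_lintegral .of_discrete (fun _ => by positivity) (hs.f₂_nonneg s) (hs.moment_f₁ s k)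

theorem integralLE_reward_succ (hs : M.StableChain μ f₁ f₂ f₃ ρ) (k : ℕ) (y : TDState S A d) :
    IntegralLE ((M.tdKernel lam ^ (k + 1)) y) (fun y => M.R y.1 y.2.1 ^ 4) (f₃ y.2.2.1) := by
  have h := IntegralLE.of_lintegral (τ := M.stateAction k y.2.2.1)
    (f := fun p => M.R p.1 p.2 ^ 4) .of_discrete
    (fun _ => by positivity) (hs.f₃_nonneg _) (hs.moment_reward y.2.2.1 k)
  rw [stateAction_apply, ← compProd_stepKernel_map_stateAction,
    ← tdKernel_pow_succ_map_transition (lam := lam),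
    Measure.map_map (by fun_prop) measurable_transition] at h
  exact h.comp_map (Measurable.comp (by fun_prop) measurable_transition) .of_discrete

/-- At time 0 the action is arbitrary, so the moment assumption does not control the reward and its
fourth power is added. This is the source of φ_{a₀}. -/
theorem integralLE_reward (hs : M.StableChain μ f₁ f₂ f₃ ρ) (k : ℕ) (y : TDState S A d) :
    IntegralLE ((M.tdKernel lam ^ k) y) (fun y => M.R y.1 y.2.1 ^ 4)
      (f₃ y.2.2.1 + M.R y.1 y.2.1 ^ 4) := by
  have h3 := hs.f₃_nonneg y.2.2.1
  have h4 : 0 ≤ M.R y.1 y.2.1 ^ 4 := by positivity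
  cases k with
  | zero =>
    have hm' : Measurable fun p : S × A => M.R p.1 p.2 ^ 4 := .of_discrete
    have hm : Measurable fun y : TDState S A d => M.R y.1 y.2.1 ^ 4 :=
      hm'.comp (measurable_fst.prodMk (measurable_fst.comp measurable_snd))
    refine .of_lintegral hm (fun _ => by positivity) (by linarith) ?_
    rw [kernel_pow_zero_apply, lintegral_dirac' _ hm.ennreal_ofReal]
    exact ENNReal.ofReal_le_ofReal (by linarith)
  | succ k => exact (hs.integralLE_reward_succ k y).mono_const (by linarith)

theorem integralLE_trace (hs : M.StableChain μ f₁ f₂ f₃ ρ) (h0 : 0 ≤ lam) (h1 : lam < 1)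
    (k : ℕ) (y : TDState S A d) :
    IntegralLE ((M.tdKernel lam ^ k) y) (fun y => ‖y.2.2.2‖ ^ 4)
      ((‖y.2.2.2‖ ^ 4 + f₃ y.2.2.1) / (1 - lam) ^ 4) := by
  have hz : 0 ≤ ‖y.2.2.2‖ ^ 4 := by positivity
  have hf3 := hs.f₃_nonneg y.2.2.1
  have hl : 0 < (1 - lam) ^ 4 := pow_pos (by linarith) 4
  refine integralLE_trace_pow h0 h1 4 (fun n => (M.tdKernel lam ^ n) y)
    (fun n => kernel_pow_succ_apply _ _ _) (fun n => ?_) ?_ k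
  · exact (integralLE_next_pow hs.integralLE_feature n y).mono_const (by linarith)
  · have hm : Measurable fun y : TDState S A d => ‖y.2.2.2‖ ^ 4 := by fun_prop
    refine .of_lintegral hm (fun _ => by positivity) (by positivity) ?_
    rw [kernel_pow_zero_apply, lintegral_dirac' _ hm.ennreal_ofReal]
    refine ENNReal.ofReal_le_ofReal ?_
    rw [le_div_iff₀ hl]
    have : (1 - lam) ^ 4 ≤ 1 := pow_le_one₀ (by linarith) (by linarith)
    nlinarith

theorem integralLE_trace_sq (hs : M.StableChain μ f₁ f₂ f₃ ρ) (h0 : 0 ≤ lam) (h1 : lam < 1)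
    (k : ℕ) (y : TDState S A d) :
    IntegralLE ((M.tdKernel lam ^ k) y) (fun y => ‖y.2.2.2‖ ^ 2)
      (√(‖y.2.2.2‖ ^ 4 + f₃ y.2.2.1) / (1 - lam) ^ 2) := by
  rw [← sqrt_div_pow_four]
  exact IntegralLE.sq (hs.integralLE_trace h0 h1 k y) (by fun_prop)

end StableChain

/-- The lower component of T(y)x is the vector Πz times the scalar -r + ⟨ψ(s') - ψ(s), θ⟩. By
Cauchy-Schwarz the square of that scalar is at most (1 + D²)‖x‖² with D = ‖ψ(s') - ψ(s)‖. -/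
theorem norm_T_sq_le (y : TDState S A d) : ‖M.T cα y‖ ^ 2 ≤
    cα ^ 2 + (‖y.2.2.2‖ ^ 2 + ‖y.2.2.2‖ ^ 2 * ‖M.ψ y.2.2.1 - M.ψ y.1‖ ^ 2) := by
  set B := cα ^ 2 + (‖y.2.2.2‖ ^ 2 + ‖y.2.2.2‖ ^ 2 * ‖M.ψ y.2.2.1 - M.ψ y.1‖ ^ 2) with hB
  have hB0 : 0 ≤ B := by positivity
  have key : ‖M.T cα y‖ ≤ √B := by
    refine ContinuousLinearMap.opNorm_le_bound _ (Real.sqrt_nonneg _) fun x => ?_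
    rw [← Real.sqrt_sq (norm_nonneg x), ← Real.sqrt_mul hB0]
    refine Real.le_sqrt_of_sq_le ?_
    rw [T_apply, ← neg_smul, ← add_smul, WithLp.prod_norm_sq_eq_of_L2,
      WithLp.prod_norm_sq_eq_of_L2]
    simp only [Real.norm_eq_abs, sq_abs]
    set D := ‖M.ψ y.2.2.1 - M.ψ y.1‖
    set r := x.fst
    set t := ‖x.snd‖
    set i := ⟪M.ψ y.2.2.1 - M.ψ y.1, x.snd⟫_ℝ
    have hi : |i| ≤ D * t := abs_real_inner_le_norm _ _
    have hp : ‖M.proj y.2.2.2‖ ^ 2 ≤ ‖y.2.2.2‖ ^ 2 := by gcongr; exact norm_proj_le _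
    have h1 : (-r + i) ^ 2 ≤ (1 + D ^ 2) * (r ^ 2 + t ^ 2) := by
      have h2 : |-r + i| ≤ |r| + D * t := (abs_add_le _ _).trans (by rw [abs_neg]; gcongr)
      rw [← sq_abs]
      calc |-r + i| ^ 2 ≤ (|r| + D * t) ^ 2 := by gcongr
        _ ≤ (1 + D ^ 2) * (|r| ^ 2 + t ^ 2) := by nlinarith [sq_nonneg (D * |r| - t)]
        _ = _ := by rw [sq_abs]
    have h3 : (-r + i) ^ 2 * ‖M.proj y.2.2.2‖ ^ 2 ≤
        (1 + D ^ 2) * (r ^ 2 + t ^ 2) * ‖y.2.2.2‖ ^ 2 :=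
      mul_le_mul h1 hp (by positivity) (by positivity)
    change (-(cα * r)) ^ 2 + ‖(-r + i) • M.proj y.2.2.2‖ ^ 2 ≤ _
    rw [norm_smul, mul_pow, Real.norm_eq_abs, sq_abs, hB]
    nlinarith [mul_nonneg (sq_nonneg cα) (sq_nonneg t)]
  calc ‖M.T cα y‖ ^ 2 ≤ √B ^ 2 := by gcongr
    _ = B := Real.sq_sqrt hB0

theorem norm_b_sq_le (y : TDState S A d) : ‖M.b cα y‖ ^ 2 ≤
    cα ^ 2 * M.R y.1 y.2.1 ^ 2 + M.R y.1 y.2.1 ^ 2 * ‖y.2.2.2‖ ^ 2 := by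
  unfold b
  rw [WithLp.prod_norm_sq_eq_of_L2]
  change ‖cα * M.R y.1 y.2.1‖ ^ 2 + ‖M.R y.1 y.2.1 • M.proj y.2.2.2‖ ^ 2 ≤ _
  rw [norm_smul, mul_pow, Real.norm_eq_abs, Real.norm_eq_abs, sq_abs, sq_abs, mul_pow]
  gcongr
  exact norm_proj_le _

omit [Fintype A] [DiscreteMeasurableSpace S] [DiscreteMeasurableSpace A] [Countable S] in
theorem measurable_norm_trace : Measurable fun y : TDState S A d => ‖y.2.2.2‖ := by fun_prop

theorem measurable_reward [Countable A] : Measurable fun y : TDState S A d => M.R y.1 y.2.1 := by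
  have hm : Measurable fun p : S × A => M.R p.1 p.2 := .of_discrete
  exact hm.comp (measurable_fst.prodMk (measurable_fst.comp measurable_snd))

namespace StableChain

theorem integralLE_T (hs : M.StableChain μ f₁ f₂ f₃ ρ) (h0 : 0 ≤ lam) (h1 : lam < 1) (k : ℕ)
    (y : TDState S A d) {φ : ℝ} (hz : ‖y.2.2.2‖ ^ 4 + f₃ y.2.2.1 ≤ φ)
    (hψ : f₃ y.1 + f₃ y.2.2.1 ≤ φ) :
    IntegralLE ((M.tdKernel lam ^ k) y) (fun y => cα ^ 2 +
      (‖y.2.2.2‖ ^ 2 + ‖y.2.2.2‖ ^ 2 * ‖M.ψ y.2.2.1 - M.ψ y.1‖ ^ 2)) (tdTHat lam cα φ) := by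
  have hψm : Measurable M.ψ := .of_discrete
  have hδm : Measurable fun y : TDState S A d => ‖M.ψ y.2.2.1 - M.ψ y.1‖ := by fun_prop
  have a3 := hs.f₃_nonneg y.1
  have b3 := hs.f₃_nonneg y.2.2.1
  have hz4 : 0 ≤ ‖y.2.2.2‖ ^ 4 := by positivity
  have hz2 := (hs.integralLE_trace_sq h0 h1 k y).mono_const
    (b := √φ / (1 - lam) ^ 2) (by gcongr)
  -- Here 16 = 8 · 2: the fourth power of a sum costs 8, and the two fourth moments add up to at
  -- most 2φ. Its square root is the 4 in `tdTHat`.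
  have hδ : IntegralLE ((M.tdKernel lam ^ k) y) (fun y => ‖M.ψ y.2.2.1 - M.ψ y.1‖ ^ 4)
      (16 * φ) := by
    have e1 := integralLE_next_pow (lam := lam) hs.integralLE_feature k y
    have e2 := integralLE_current_pow (lam := lam) (fun _ => by positivity) hs.f₃_nonneg
      hs.integralLE_feature k y
    refine (((e1.add e2).const_mul (c := 8) (by norm_num)).mono (hδm.pow_const 4)
      (fun _ => by positivity) fun y => ?_).mono_const (by linarith)
    calc ‖M.ψ y.2.2.1 - M.ψ y.1‖ ^ 4 ≤ (‖M.ψ y.2.2.1‖ + ‖M.ψ y.1‖) ^ 4 := by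
          gcongr; exact norm_sub_le _ _
      _ ≤ 2 ^ (4 - 1) * (‖M.ψ y.2.2.1‖ ^ 4 + ‖M.ψ y.1‖ ^ 4) :=
          add_pow_le (norm_nonneg _) (norm_nonneg _) 4
      _ = _ := by norm_num
  have hz4' := (hs.integralLE_trace h0 h1 k y).mono_const (b := φ / (1 - lam) ^ 4) (by gcongr)
  have hm := hz4'.mul_sq hδ measurable_norm_trace hδm
  refine ((IntegralLE.const (cα ^ 2)).add (hz2.add hm)).mono_const (le_of_eq ?_)
  unfold tdTHat
  rw [sqrt_div_pow_four, Real.sqrt_mul (by norm_num), show (16 : ℝ) = 4 ^ 2 by norm_num,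
    Real.sqrt_sq (by norm_num)]
  have : √φ * √φ = φ := Real.mul_self_sqrt (by linarith)
  calc _ = cα ^ 2 + (√φ / (1 - lam) ^ 2 + 4 * (√φ * √φ) / (1 - lam) ^ 2) := by ring
    _ = _ := by rw [this]; ring

theorem integralLE_b (hs : M.StableChain μ f₁ f₂ f₃ ρ) (h0 : 0 ≤ lam) (h1 : lam < 1) (k : ℕ)
    (y : TDState S A d) {φ c : ℝ} (hz : ‖y.2.2.2‖ ^ 4 + f₃ y.2.2.1 ≤ φ)
    (hR : IntegralLE ((M.tdKernel lam ^ k) y) (fun y => M.R y.1 y.2.1 ^ 4) c) (hc : c ≤ φ) :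
    IntegralLE ((M.tdKernel lam ^ k) y) (fun y => cα ^ 2 * M.R y.1 y.2.1 ^ 2 +
      M.R y.1 y.2.1 ^ 2 * ‖y.2.2.2‖ ^ 2) (tdbHat lam cα φ) := by
  have hc0 : 0 ≤ c := hR.nonneg fun _ => by positivity
  have hR' := hR.mono_const hc
  have hz4 := (hs.integralLE_trace h0 h1 k y).mono_const (b := φ / (1 - lam) ^ 4) (by gcongr)
  have e1 := (hR'.sq measurable_reward).const_mul (sq_nonneg cα)
  have e2 := hR'.mul_sq hz4 measurable_reward measurable_norm_trace
  refine (e1.add e2).mono_const (le_of_eq ?_)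
  unfold tdbHat
  rw [sqrt_div_pow_four]
  have : √φ * √φ = φ := Real.mul_self_sqrt (by linarith)
  rw [← mul_div_assoc, this]

theorem lintegral_T_le (hs : M.StableChain μ f₁ f₂ f₃ ρ) (h0 : 0 ≤ lam) (h1 : lam < 1) (k : ℕ)
    (y : TDState S A d) {φ : ℝ} (hz : ‖y.2.2.2‖ ^ 4 + f₃ y.2.2.1 ≤ φ)
    (hψ : f₃ y.1 + f₃ y.2.2.1 ≤ φ) :
    ∫⁻ y, ENNReal.ofReal (‖M.T cα y‖ ^ 2) ∂((M.tdKernel lam ^ k) y) ≤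
      ENNReal.ofReal (tdTHat lam cα φ) :=
  (lintegral_mono fun y => ENNReal.ofReal_le_ofReal (norm_T_sq_le y)).trans
    ((hs.integralLE_T h0 h1 k y hz hψ).lintegral_le fun _ => by positivity)

theorem lintegral_b_le (hs : M.StableChain μ f₁ f₂ f₃ ρ) (h0 : 0 ≤ lam) (h1 : lam < 1) (k : ℕ)
    (y : TDState S A d) {φ c : ℝ} (hz : ‖y.2.2.2‖ ^ 4 + f₃ y.2.2.1 ≤ φ)
    (hR : IntegralLE ((M.tdKernel lam ^ k) y) (fun y => M.R y.1 y.2.1 ^ 4) c) (hc : c ≤ φ) :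
    ∫⁻ y, ENNReal.ofReal (‖M.b cα y‖ ^ 2) ∂((M.tdKernel lam ^ k) y) ≤
      ENNReal.ofReal (tdbHat lam cα φ) :=
  (lintegral_mono fun y => ENNReal.ofReal_le_ofReal (norm_b_sq_le y)).trans
    ((hs.integralLE_b h0 h1 k y hz hR hc).lintegral_le fun _ => by positivity)

/-- At time 0 the moment bound is a pointwise one. It absorbs the initial trace z₀ = ψ(s₀) into
f₃(s₀). -/
theorem norm_feature_le (hs : M.StableChain μ f₁ f₂ f₃ ρ) (s : S) : ‖M.ψ s‖ ^ 4 ≤ f₃ s := by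
  have h := hs.moment_feature s 0
  have hm : Measurable fun s => ENNReal.ofReal (‖M.ψ s‖ ^ 4) := .of_discrete
  rw [kernel_pow_zero_apply, lintegral_dirac' _ hm] at h
  exact (ENNReal.ofReal_le_ofReal_iff (hs.f₃_nonneg s)).1 h

theorem exists_bound_T_b (hs : M.StableChain μ f₁ f₂ f₃ ρ) (h0 : 0 ≤ lam) (h1 : lam < 1)
    (cα : ℝ) (xs : TDParam d) (y : TDState S A d) : ∃ C : ℝ≥0, ∀ k : ℕ,
      ∫⁻ y, ENNReal.ofReal (‖M.T cα y‖ ^ 2) ∂((M.tdKernel lam ^ k) y) ≤ C ∧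
      ∫⁻ y, ENNReal.ofReal ((‖M.b cα y‖ + ‖M.T cα y‖ * ‖xs‖) ^ 2) ∂((M.tdKernel lam ^ k) y)
        ≤ C := by
  set φ := ‖y.2.2.2‖ ^ 4 + f₃ y.1 + f₃ y.2.2.1 + M.R y.1 y.2.1 ^ 4 with hφ
  have a3 := hs.f₃_nonneg y.1
  have b3 := hs.f₃_nonneg y.2.2.1
  have hz4 : 0 ≤ ‖y.2.2.2‖ ^ 4 := by positivity
  have hR4 : 0 ≤ M.R y.1 y.2.1 ^ 4 := by positivity
  have eT := fun k => hs.integralLE_T (cα := cα) h0 h1 k y (φ := φ) (by linarith) (by linarith)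
  have eb := fun k => hs.integralLE_b (cα := cα) h0 h1 k y (φ := φ) (by linarith)
    (hs.integralLE_reward k y) (by linarith)
  have e := fun k => ((eb k).add ((eT k).const_mul (sq_nonneg ‖xs‖))).const_mul
    (c := 2) (by norm_num)
  refine ⟨(tdTHat lam cα φ).toNNReal + (2 * (tdbHat lam cα φ + ‖xs‖ ^ 2 * tdTHat lam cα φ)).toNNReal,
    fun k => ⟨?_, ?_⟩⟩
  · rw [ENNReal.coe_add]
    exact (hs.lintegral_T_le h0 h1 k y (by linarith) (by linarith)).trans le_self_add
  · rw [ENNReal.coe_add]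
    refine le_trans ?_ le_add_self
    refine (lintegral_mono fun y => ENNReal.ofReal_le_ofReal ?_).trans
      ((e k).lintegral_le fun _ => by positivity)
    have hT := norm_T_sq_le (M := M) (cα := cα) y
    have hb := norm_b_sq_le (M := M) (cα := cα) y
    have hx : ‖xs‖ ^ 2 * ‖M.T cα y‖ ^ 2 ≤ ‖xs‖ ^ 2 * _ := mul_le_mul_of_nonneg_left hT (by positivity)
    nlinarith [sq_nonneg (‖M.b cα y‖ - ‖M.T cα y‖ * ‖xs‖)]

end StableChain

end TDModel

/-! ### Relaxation of correlations to their stationary values -/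

namespace TDModel

variable {S A : Type*} [Countable S] [MeasurableSpace S] [DiscreteMeasurableSpace S]
  [Fintype A] [MeasurableSpace A] [DiscreteMeasurableSpace A] {d : ℕ} {M : TDModel S A d}
  {μ : Measure S} [IsProbabilityMeasure μ] {rhat psihat lam cα : ℝ}
  {f₁ f₂ f₃ : S → ℝ} {ρ : ℝ}

theorem memLp_fst_compProd {β E : Type*} [MeasurableSpace β] [NormedAddCommGroup E] {τ : Measure S}
    [SFinite τ] {κ : Kernel S β} [IsMarkovKernel κ] {v : S → E} (hv : MemLp v 2 τ) :
    MemLp (fun p : S × β => v p.1) 2 (τ ⊗ₘ κ) := by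
  rw [← Measure.fst_compProd τ κ] at hv
  exact hv.comp_of_map (by fun_prop)

/-- Integrating out the second variable. -/
theorem integral_smul_fst_compProd {β E : Type*} [MeasurableSpace β] [NormedAddCommGroup E]
    [NormedSpace ℝ E] [CompleteSpace E] {τ : Measure S} [SFinite τ] {κ : Kernel S β}
    [IsMarkovKernel κ] {r : β → ℝ} {v : S → E}
    (hr : MemLp (fun p : S × β => r p.2) 2 (τ ⊗ₘ κ)) (hv : MemLp v 2 τ) :
    ∫ p, r p.2 • v p.1 ∂(τ ⊗ₘ κ) = ∫ t, (∫ q, r q ∂(κ t)) • v t ∂τ := by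
  have hi : Integrable (fun p : S × β => r p.2 • v p.1) (τ ⊗ₘ κ) :=
    memLp_one_iff_integrable.1 ((memLp_fst_compProd hv).smul (p := 2) (q := 2) (r := 1) hr)
  rw [Measure.integral_compProd hi]
  simp_rw [integral_smul_const]

instance (m : ℕ) : IsMarkovKernel (M.stateAction m) := by
  unfold stateAction; infer_instance

namespace ErgodicChain

theorem memLp_snd_compProd_pow (hc : M.ErgodicChain μ rhat) {E : Type*} [NormedAddCommGroup E]
    {h : S → E} (hh : MemLp h 2 μ) (m : ℕ) :
    MemLp (fun p : S × S => h p.2) 2 (μ ⊗ₘ (M.stateKernel ^ m)) := by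
  have e : (μ ⊗ₘ (M.stateKernel ^ m)).map Prod.snd = μ :=
    (Measure.snd_compProd μ (M.stateKernel ^ m)).trans (kernel_invariant_pow hc.invariant m).def
  rw [← e] at hh
  exact hh.comp_of_map (by fun_prop)

theorem bind_stateAction (hc : M.ErgodicChain μ rhat) (m : ℕ) :
    μ.bind (M.stateAction m) = μ ⊗ₘ M.policyKernel := by
  ext B hB
  have hm : Measurable fun t => M.policyKernel t (Prod.mk t ⁻¹' B) := .of_discrete
  rw [Measure.bind_apply hB (Kernel.aemeasurable _), Measure.compProd_apply hB]
  simp_rw [stateAction_apply, Measure.compProd_apply hB]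
  conv_rhs => rw [← (kernel_invariant_pow hc.invariant m).def]
  rw [Measure.lintegral_bind (Kernel.aemeasurable _) hm.aemeasurable]

theorem memLp_reward_stateAction (hc : M.ErgodicChain μ rhat) (m : ℕ) :
    MemLp (fun p : S × S × A => M.R p.2.1 p.2.2) 2 (μ ⊗ₘ M.stateAction m) := by
  have e : (μ ⊗ₘ M.stateAction m).map Prod.snd = μ ⊗ₘ M.policyKernel :=
    (Measure.snd_compProd μ (M.stateAction m)).trans (hc.bind_stateAction m)
  have hh := hc.memLp_reward
  rw [← e] at hh
  exact hh.comp_of_map (by fun_prop)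

theorem memLp_reward_pow (hc : M.ErgodicChain μ rhat) (k : ℕ) (s : S) :
    MemLp (fun p : S × A => M.R p.1 p.2) 2 (M.stateAction k s) := by
  rw [stateAction_apply]
  exact hc.memLp_reward.of_measure_le_smul (hc.inv_ne_top s) (hc.compProd_le _ k s)

theorem integral_reward_stateAction (hc : M.ErgodicChain μ rhat) (k : ℕ) (s : S) :
    ∫ p, M.R p.1 p.2 ∂(M.stateAction k s) = M.powP k M.Rpi s := by
  have hi := (hc.memLp_reward_pow k s).integrable one_le_two
  rw [stateAction_apply] at hi ⊢
  rw [Measure.integral_compProd hi]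
  simp_rw [integral_reward_policyKernel]
  rfl

end ErgodicChain

namespace StableChain

theorem abs_powP_Rpi_sub_le (hs : M.StableChain μ f₁ f₂ f₃ ρ) (hc : M.ErgodicChain μ rhat)
    (s : S) (k : ℕ) : |M.powP k M.Rpi s - M.rbar μ| ≤ ρ ^ k * f₁ s := by
  rw [← hc.integral_reward_stateAction]
  exact hs.reward s k

theorem norm_corr_one_sub_le (hs : M.StableChain μ f₁ f₂ f₃ ρ) (s : S) (j i : ℕ) :
    ‖M.corr (fun _ => 1) j i s - M.PsiTLam μ (M.powP i fun _ => 1)‖ ≤ ρ ^ j * f₁ s := by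
  have := hs.feature s j
  unfold corr PsiTLam
  simpa only [powP_const, one_smul] using this

/-- Integrating out the later reward given S_j turns the assumption on E[ψ(S_j) R(S_{j+i}, A_{j+i})]
into one on `corr`. Domination by μ supplies the integrability. -/
theorem norm_corr_Rpi_sub_le (hs : M.StableChain μ f₁ f₂ f₃ ρ) (hc : M.ErgodicChain μ rhat)
    (hf : M.FeatureMatrix μ psihat) (s : S) (j i : ℕ) :
    ‖M.corr M.Rpi j i s - M.PsiTLam μ (M.powP i M.Rpi)‖ ≤ ρ ^ j * f₁ s := by
  have := hs.feature_reward s j i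
  rw [integral_smul_fst_compProd (r := fun q : S × A => M.R q.1 q.2) (v := M.ψ)
      ((hc.memLp_reward_stateAction i).of_measure_le_smul (hc.inv_ne_top s)
        (hc.compProd_le _ j s)) (hc.memLp_pow hf.memLp j s),
    integral_smul_fst_compProd (r := M.Rpi) (v := M.ψ)
      (hc.memLp_snd_compProd_pow hc.memLp_Rpi i) hf.memLp] at this
  simp_rw [hc.integral_reward_stateAction] at this
  exact this

/-- Apply the expectation of ψ(S_j) ψ(S_{j+i})ᵀ to θ. The assumption bounds the operator norm, so a
single rate serves all θ with a factor ‖θ‖. -/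
theorem norm_corr_Psi_sub_le (hs : M.StableChain μ f₁ f₂ f₃ ρ) (hc : M.ErgodicChain μ rhat)
    (hf : M.FeatureMatrix μ psihat) (θ : EuclideanSpace ℝ (Fin d)) (s : S) (j i : ℕ) :
    ‖M.corr (M.Psi θ) j i s - M.PsiTLam μ (M.powP i (M.Psi θ))‖ ≤ ρ ^ j * f₁ s * ‖θ‖ := by
  have key : ∀ τ : Measure S, IsProbabilityMeasure τ → MemLp M.ψ 2 τ →
      MemLp (fun p : S × S => M.ψ p.2) 2 (τ ⊗ₘ (M.stateKernel ^ i)) →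
      (∫ p, InnerProductSpace.rankOne ℝ (M.ψ p.1) (M.ψ p.2) ∂(τ ⊗ₘ (M.stateKernel ^ i))) θ =
        ∫ t, M.powP i (M.Psi θ) t • M.ψ t ∂τ := by
    intro τ _ h1 h2
    have h3 := memLp_fst_compProd (κ := M.stateKernel ^ i) h1
    have hi : Integrable (fun p : S × S => InnerProductSpace.rankOne ℝ (M.ψ p.1) (M.ψ p.2))
        (τ ⊗ₘ (M.stateKernel ^ i)) := by
      refine (h3.norm.integrable_mul h2.norm).mono' ?_ (Filter.Eventually.of_forall fun p => ?_)
      · exact StronglyMeasurable.of_discrete.aestronglyMeasurable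
      · simp [InnerProductSpace.norm_rankOne]
    have h4 : MemLp (fun p : S × S => M.Psi θ p.2) 2 (τ ⊗ₘ (M.stateKernel ^ i)) := by
      refine (h2.norm.mul_const ‖θ‖).mono' StronglyMeasurable.of_discrete.aestronglyMeasurable
        (Filter.Eventually.of_forall fun p => norm_inner_le_norm _ _)
    rw [ContinuousLinearMap.integral_apply hi]
    exact integral_smul_fst_compProd (r := M.Psi θ) h4 h1
  have h2 := hc.memLp_snd_compProd_pow hf.memLp i
  have e1 := key ((M.stateKernel ^ j) s) inferInstance (hc.memLp_pow hf.memLp j s)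
    (h2.of_measure_le_smul (hc.inv_ne_top s) (hc.compProd_le _ j s))
  have e2 := key μ inferInstance hf.memLp h2
  unfold corr PsiTLam
  rw [← e1, ← e2, ← sub_apply]
  exact ContinuousLinearMap.le_of_opNorm_le _ (hs.feature_feature s j i) θ

theorem tendsto_pow_mul (hs : M.StableChain μ f₁ f₂ f₃ ρ) (c : ℝ) :
    Filter.Tendsto (fun k => ρ ^ k * c) Filter.atTop (nhds 0) := by
  simpa using (tendsto_pow_atTop_nhds_zero_of_lt_one hs.rho_pos.le hs.rho_lt_one).mul_const c

/-- The Gram matrix is the limit of E_s[ψ(S_k) ψ(S_k)ᵀ], each of norm at most √f₃(s). Stationary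
constants can so be absorbed into moments at the initial state. -/
theorem psiPrime_le (hs : M.StableChain μ f₁ f₂ f₃ ρ) (hc : M.ErgodicChain μ rhat)
    (hf : M.FeatureMatrix μ psihat) (s : S) : M.psiPrime μ ≤ √(f₃ s) := by
  refine ContinuousLinearMap.opNorm_le_bound _ (Real.sqrt_nonneg _) fun θ => ?_
  rw [hf.gram_apply]
  have hk : ∀ k, ‖M.PsiTLam μ (M.Psi θ)‖ ≤ √(f₃ s) * ‖θ‖ + ρ ^ k * (f₁ s * ‖θ‖) := by
    intro k
    have h1 := hs.norm_corr_Psi_sub_le hc hf θ s k 0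
    have e : M.powP 0 (M.Psi θ) = M.Psi θ := funext (powP_zero _)
    have h2 : ‖M.corr (M.Psi θ) k 0 s‖ ≤ √(f₃ s) * ‖θ‖ := by
      have h3 := (hs.integralLE_feature s k).sq .of_discrete
      unfold corr
      rw [e]
      refine (norm_integral_le_of_norm_le (h3.1.mul_const ‖θ‖)
        (Filter.Eventually.of_forall fun t => ?_)).trans ?_
      · rw [norm_smul, sq]
        calc _ ≤ ‖M.ψ t‖ * ‖θ‖ * ‖M.ψ t‖ := by gcongr; exact norm_inner_le_norm _ _
          _ = _ := by ring
      · rw [integral_mul_const]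
        gcongr
        exact h3.2
    rw [e] at h1
    have h4 := norm_sub_norm_le (M.PsiTLam μ (M.Psi θ)) (M.corr (M.Psi θ) k 0 s)
    rw [norm_sub_rev] at h4
    linarith
  have := (hs.tendsto_pow_mul (f₁ s * ‖θ‖)).const_add (√(f₃ s) * ‖θ‖)
  rw [add_zero] at this
  exact ge_of_tendsto this (Filter.Eventually.of_forall hk)

/-- By the same limit argument, now for expected rewards from s, with Jensen's inequality for the
square. -/
theorem rbar_sq_le (hs : M.StableChain μ f₁ f₂ f₃ ρ) (hc : M.ErgodicChain μ rhat) (s : S) :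
    M.rbar μ ^ 2 ≤ √(f₃ s) := by
  have h1 : Filter.Tendsto (fun k => M.powP k M.Rpi s) Filter.atTop (nhds (M.rbar μ)) := by
    rw [tendsto_iff_norm_sub_tendsto_zero]
    exact squeeze_zero (fun _ => norm_nonneg _) (fun k => hs.abs_powP_Rpi_sub_le hc s k)
      (hs.tendsto_pow_mul (f₁ s))
  refine le_of_tendsto (h1.pow 2) (Filter.Eventually.of_forall fun k => ?_)
  rw [← hc.integral_reward_stateAction]
  refine (sq_integral_le (hc.memLp_reward_pow k s)).trans ?_
  have h := IntegralLE.of_lintegral (τ := M.stateAction k s)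
    (f := fun p => M.R p.1 p.2 ^ 4) .of_discrete
    (fun _ => by positivity) (hs.f₃_nonneg _) (hs.moment_reward s k)
  exact (h.sq .of_discrete).2

end StableChain

end TDModel

/-! ### Summing the deviations of the weighted trace -/

namespace TDModel

variable {S A : Type*} [Countable S] [MeasurableSpace S] [DiscreteMeasurableSpace S]
  [Fintype A] [MeasurableSpace A] [DiscreteMeasurableSpace A] {d : ℕ} {M : TDModel S A d}
  {μ : Measure S} [IsProbabilityMeasure μ] {rhat psihat lam cα : ℝ}
  {f₁ f₂ f₃ : S → ℝ} {ρ : ℝ}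

variable (M μ) in
/-- The stationary expectation of the trace, weighted by a function of the transition. -/
noncomputable def traceMean (lam : ℝ) (φ : S × A × S → ℝ) : EuclideanSpace ℝ (Fin d) :=
  M.PsiTLam μ (M.resolvent lam (M.condStep φ))

variable (M μ) in
/-- The deviation from stationarity of the expectation of the weighted trace at time `k`. -/
noncomputable def traceGap (lam : ℝ) (φ : S × A × S → ℝ) (k : ℕ) (y : TDState S A d) :
    EuclideanSpace ℝ (Fin d) :=
  ∫ y', φ (transition y') • y'.2.2.2 ∂((M.tdKernel lam ^ k) y) - M.traceMean μ lam φ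

variable (M μ) in
/-- The sum over time of the deviations from stationarity of the expected weighted trace. -/
noncomputable def traceSum (lam : ℝ) (φ : S × A × S → ℝ) (y : TDState S A d) :
    EuclideanSpace ℝ (Fin d) := ∑' k, M.traceGap μ lam φ k y

variable (M μ) in
/-- Rates for the convergence to stationarity of a function of the transition and of its
correlations with the features. -/
structure TraceRate (f₁ : S → ℝ) (ρ : ℝ) (φ : S × A × S → ℝ) (a b c e : ℝ) : Prop where
  memLp : MemLp φ 2 (μ ⊗ₘ M.stepKernel)
  abs_powP_le : ∀ s k, |M.powP k (M.condStep φ) s| ≤ a + b * (ρ ^ k * f₁ s)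
  norm_corr_sub_le : ∀ s j i, ‖M.corr (M.condStep φ) j i s -
    M.PsiTLam μ (M.powP i (M.condStep φ))‖ ≤ c * (ρ ^ j * f₁ s)
  norm_le : ∀ i, ‖M.PsiTLam μ (M.powP i (M.condStep φ))‖ ≤ e

/-- A summable bound for the deviations from stationarity. -/
noncomputable def traceRateBound (lam : ℝ) (f₁ : S → ℝ) (ρ : ℝ) (φ : S × A × S → ℝ)
    (a b c e : ℝ) (y : TDState S A d) : ℕ → ℝ
  | 0 => |φ (transition y)| * ‖y.2.2.2‖ + e / (1 - lam)
  | k + 1 => ‖y.2.2.2‖ * (a * (lam * lam ^ k) + b * f₁ y.2.2.1 * (lam * (lam * ρ) ^ k)) +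
      c * f₁ y.2.2.1 * (∑ i ∈ Finset.range (k + 1), lam ^ i * ρ ^ (k - i)) +
      e * (lam * lam ^ k / (1 - lam))

/-- The sum of the bounds `traceRateBound`. -/
noncomputable def traceSumBound (lam : ℝ) (f₁ : S → ℝ) (ρ : ℝ) (φ : S × A × S → ℝ)
    (a b c e : ℝ) (y : TDState S A d) : ℝ :=
  |φ (transition y)| * ‖y.2.2.2‖ +
    ‖y.2.2.2‖ * (a * (lam * (1 - lam)⁻¹) + b * f₁ y.2.2.1 * (lam * (1 - lam * ρ)⁻¹)) +
    c * f₁ y.2.2.1 * ((1 - lam)⁻¹ * (1 - ρ)⁻¹) + e * (1 - lam)⁻¹ ^ 2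

omit [Countable S] [MeasurableSpace S] [DiscreteMeasurableSpace S] [Fintype A]
  [MeasurableSpace A] [DiscreteMeasurableSpace A] in
theorem hasSum_traceRateBound (h0 : 0 ≤ lam) (h1 : lam < 1) (hρ0 : 0 < ρ) (hρ1 : ρ < 1)
    (φ : S × A × S → ℝ) (a b c e : ℝ) (y : TDState S A d) :
    HasSum (traceRateBound lam f₁ ρ φ a b c e y) (traceSumBound lam f₁ ρ φ a b c e y) := by
  have hl : 1 - lam ≠ 0 := by linarith
  have g1 := hasSum_geometric_of_lt_one h0 h1
  have g2 := hasSum_geometric_of_lt_one (mul_nonneg h0 hρ0.le)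
    (mul_lt_one_of_nonneg_of_lt_one_left h0 h1 hρ1.le)
  have g3 := hasSum_geometric_conv h0 h1 hρ0.le hρ1
  have g := (((((g1.mul_left lam).mul_left a).add
    ((g2.mul_left lam).mul_left (b * f₁ y.2.2.1))).mul_left ‖y.2.2.2‖).add
    (g3.mul_left (c * f₁ y.2.2.1))).add (((g1.mul_left lam).div_const (1 - lam)).mul_left e)
  have g' : HasSum (fun k => traceRateBound lam f₁ ρ φ a b c e y (k + 1)) _ := g
  have := (hasSum_nat_add_iff 1).1 g'
  convert! this using 1
  rw [Finset.sum_range_one]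
  simp only [traceRateBound, traceSumBound]
  field_simp
  ring

theorem norm_traceMean_sub_le (hc : M.ErgodicChain μ rhat) (hf : M.FeatureMatrix μ psihat)
    (h0 : 0 ≤ lam) (h1 : lam < 1) {φ : S × A × S → ℝ} {a b c e : ℝ}
    (h : M.TraceRate μ f₁ ρ φ a b c e) (n : ℕ) :
    ‖∑ i ∈ Finset.range n, lam ^ i • M.PsiTLam μ (M.powP i (M.condStep φ)) -
      M.traceMean μ lam φ‖ ≤ e * lam ^ n / (1 - lam) := by
  refine norm_sub_le_of_geometric_bound_of_hasSum h1 (fun i => ?_)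
    (hc.hasSum_PsiTLam hf h0 h1 (memLp_condStep h.memLp)) n
  rw [norm_smul, Real.norm_of_nonneg (pow_nonneg h0 i), mul_comm]
  exact mul_le_mul_of_nonneg_right (h.norm_le i) (pow_nonneg h0 i)

namespace TraceRate

variable {φ : S × A × S → ℝ} {a b c e : ℝ}

/-- From time 1 on, the unrolled expectation differs from its stationary value in three ways: the
surviving part of the initial trace, the correlations that have not relaxed yet, and the tail of the
resolvent series. At time 0 the transition is prescribed, and the value and the whole series are
bounded separately. -/
theorem norm_traceGap_le (h : M.TraceRate μ f₁ ρ φ a b c e) (hc : M.ErgodicChain μ rhat)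
    (hf : M.FeatureMatrix μ psihat) (h0 : 0 ≤ lam) (h1 : lam < 1) (k : ℕ) (y : TDState S A d) :
    ‖M.traceGap μ lam φ k y‖ ≤ traceRateBound lam f₁ ρ φ a b c e y k := by
  have ht := norm_traceMean_sub_le hc hf h0 h1 h
  cases k with
  | zero =>
    have hφm : Measurable φ := .of_discrete
    have hm : Measurable (fun y : TDState S A d => φ (transition y) • y.2.2.2) :=
      (hφm.comp measurable_transition).smul measurable_trace
    unfold traceGap traceRateBound
    rw [kernel_pow_zero_apply, integral_dirac' _ _ hm.stronglyMeasurable]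
    refine (norm_sub_le _ _).trans (add_le_add ?_ ?_)
    · rw [norm_smul, Real.norm_eq_abs]
    · simpa using ht 0
  | succ k =>
    unfold traceGap traceRateBound
    rw [hc.integral_transition_smul_trace hf h.memLp]
    set g := M.condStep φ
    have e1 : (lam ^ (k + 1) * M.powP k g y.2.2.1) • y.2.2.2 +
        ∑ i ∈ Finset.range (k + 1), lam ^ i • M.corr g (k - i) i y.2.2.1 - M.traceMean μ lam φ =
        (lam ^ (k + 1) * M.powP k g y.2.2.1) • y.2.2.2 +
        ∑ i ∈ Finset.range (k + 1), lam ^ i •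
          (M.corr g (k - i) i y.2.2.1 - M.PsiTLam μ (M.powP i g)) +
        (∑ i ∈ Finset.range (k + 1), lam ^ i • M.PsiTLam μ (M.powP i g) -
          M.traceMean μ lam φ) := by
      simp_rw [smul_sub, Finset.sum_sub_distrib]; abel
    rw [e1]
    refine norm_add₃_le.trans (add_le_add (add_le_add ?_ ?_) ?_)
    · rw [norm_smul, norm_mul, Real.norm_of_nonneg (pow_nonneg h0 _), mul_comm, Real.norm_eq_abs]
      refine mul_le_mul_of_nonneg_left ?_ (norm_nonneg _)
      calc lam ^ (k + 1) * |M.powP k g y.2.2.1|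
          ≤ lam ^ (k + 1) * (a + b * (ρ ^ k * f₁ y.2.2.1)) :=
            mul_le_mul_of_nonneg_left (h.abs_powP_le _ _) (pow_nonneg h0 _)
        _ = _ := by rw [mul_pow]; ring
    · refine (norm_sum_le _ _).trans ?_
      rw [Finset.mul_sum]
      refine Finset.sum_le_sum fun i _ => ?_
      rw [norm_smul, Real.norm_of_nonneg (pow_nonneg h0 _)]
      calc _ ≤ lam ^ i * (c * (ρ ^ (k - i) * f₁ y.2.2.1)) :=
            mul_le_mul_of_nonneg_left (h.norm_corr_sub_le _ _ _) (pow_nonneg h0 _)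
        _ = _ := by ring
    · exact (ht (k + 1)).trans_eq (by ring)

theorem summable_traceGap (h : M.TraceRate μ f₁ ρ φ a b c e) (hc : M.ErgodicChain μ rhat)
    (hf : M.FeatureMatrix μ psihat) (h0 : 0 ≤ lam) (h1 : lam < 1) (hρ0 : 0 < ρ) (hρ1 : ρ < 1)
    (y : TDState S A d) : Summable fun k => M.traceGap μ lam φ k y :=
  Summable.of_norm_bounded (hasSum_traceRateBound h0 h1 hρ0 hρ1 φ a b c e y).summable
    fun k => h.norm_traceGap_le hc hf h0 h1 k y

theorem norm_traceSum_le (h : M.TraceRate μ f₁ ρ φ a b c e) (hc : M.ErgodicChain μ rhat)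
    (hf : M.FeatureMatrix μ psihat) (h0 : 0 ≤ lam) (h1 : lam < 1) (hρ0 : 0 < ρ) (hρ1 : ρ < 1)
    (y : TDState S A d) :
    ‖M.traceSum μ lam φ y‖ ≤ traceSumBound lam f₁ ρ φ a b c e y :=
  tsum_of_norm_bounded (hasSum_traceRateBound h0 h1 hρ0 hρ1 φ a b c e y)
    fun k => h.norm_traceGap_le hc hf h0 h1 k y

end TraceRate

theorem StableChain.integralLE_f₁_sq_next (hs : M.StableChain μ f₁ f₂ f₃ ρ) (k : ℕ)
    (y : TDState S A d) :
    IntegralLE ((M.tdKernel lam ^ k) y) (fun y => f₁ y.2.2.1 ^ 2) (√(f₂ y.2.2.1)) := by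
  have hm : Measurable f₁ := .of_discrete
  exact (integralLE_next_pow hs.integralLE_f₁ k y).sq (hm.comp measurable_next)

theorem StableChain.integrable_f₁_next (hs : M.StableChain μ f₁ f₂ f₃ ρ) (k : ℕ)
    (y : TDState S A d) :
    Integrable (fun y => f₁ y.2.2.1) ((M.tdKernel lam ^ k) y) := by
  have hm : Measurable f₁ := .of_discrete
  exact ((memLp_two_iff_integrable_sq (hm.comp measurable_next).aestronglyMeasurable).2
    (hs.integralLE_f₁_sq_next k y).1).integrable one_le_two

/-- The solution of the Poisson equation for the weighted trace. -/
theorem TraceRate.poisson {φ : S × A × S → ℝ} {a b c e : ℝ}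
    (h : M.TraceRate μ f₁ ρ φ a b c e) (hs : M.StableChain μ f₁ f₂ f₃ ρ)
    (hc : M.ErgodicChain μ rhat)
    (hf : M.FeatureMatrix μ psihat) (h0 : 0 ≤ lam) (h1 : lam < 1) :
    StronglyMeasurable (M.traceSum μ lam φ) ∧
    ∀ y, Integrable (M.traceSum μ lam φ) (M.tdKernel lam y) ∧
      M.traceSum μ lam φ y = φ (transition y) • y.2.2.2 +
        ∫ y', M.traceSum μ lam φ y' ∂(M.tdKernel lam y) - M.traceMean μ lam φ := by
  have hφm : Measurable φ := .of_discrete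
  have hf1 : Measurable f₁ := .of_discrete
  have hm : Measurable (fun y : TDState S A d => φ (transition y) • y.2.2.2) :=
    (hφm.comp measurable_transition).smul measurable_trace
  refine poisson_tsum (M.tdKernel lam) hm.stronglyMeasurable
    (fun k y => hc.integrable_transition_smul_trace hf h.memLp k y)
    (fun k y => h.norm_traceGap_le hc hf h0 h1 k y)
    (fun y => hasSum_traceRateBound h0 h1 hs.rho_pos hs.rho_lt_one φ a b c e y) fun y => ?_
  rw [← pow_one (M.tdKernel lam)]
  have i1 : Integrable (fun y : TDState S A d => |φ (transition y)| * ‖y.2.2.2‖)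
      ((M.tdKernel lam ^ 1) y) := by
    simpa only [norm_smul, Real.norm_eq_abs] using
      (hc.integrable_transition_smul_trace (lam := lam) hf h.memLp 1 y).norm
  have i2 : Integrable (fun y : TDState S A d => ‖y.2.2.2‖) ((M.tdKernel lam ^ 1) y) :=
    ((hc.memLp_trace_pow (lam := lam) hf 1 y).integrable one_le_two).norm
  have i3 := hs.integrable_f₁_next (lam := lam) 1 y
  have i4 := ((hs.integralLE_f₁_sq_next (lam := lam) 1 y).mul (hs.integralLE_trace_sq h0 h1 1 y)
    (hf1.comp measurable_next) measurable_norm_trace (fun y => hs.f₁_nonneg _)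
    fun _ => norm_nonneg _).1
  have i5 := ((i1.add ((i2.mul_const (a * (lam * (1 - lam)⁻¹))).add
    (i4.mul_const (b * (lam * (1 - lam * ρ)⁻¹))))).add
    (i3.mul_const (c * ((1 - lam)⁻¹ * (1 - ρ)⁻¹)))).add (integrable_const (e * (1 - lam)⁻¹ ^ 2))
  refine i5.congr (Filter.Eventually.of_forall fun y => ?_)
  simp only [Pi.add_apply, traceSumBound]
  ring

namespace StableChain

/-- A constant weight is stationary already, so b = 0 and only the mean feature has to relax. -/
theorem traceRate_one (hs : M.StableChain μ f₁ f₂ f₃ ρ) (hf : M.FeatureMatrix μ psihat) :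
    M.TraceRate μ f₁ ρ (fun _ => 1) 1 0 1 (√(M.psiPrime μ)) := by
  have e : M.condStep (fun _ => 1) = fun _ => 1 := condStep_fst fun _ => 1
  refine ⟨memLp_const 1, fun s k => ?_, fun s j i => ?_, fun i => ?_⟩ <;> rw [e]
  · simp [powP_const]
  · rw [one_mul]; exact hs.norm_corr_one_sub_le s j i
  · have e1 : M.powP i (fun _ => 1) = fun _ => 1 := funext fun s => powP_const 1 i s
    rw [e1]
    simpa using hf.norm_PsiTLam_le (memLp_const (1 : ℝ))

/-- The expected reward relaxes to r̄ and not to 0; a = √r̂ bounds |r̄|, as r̂ bounds the stationary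
second moment of the reward. -/
theorem traceRate_reward (hs : M.StableChain μ f₁ f₂ f₃ ρ) (hc : M.ErgodicChain μ rhat)
    (hf : M.FeatureMatrix μ psihat) :
    M.TraceRate μ f₁ ρ (fun t => M.R t.1 t.2.1) (√rhat) 1 1 (√(M.psiPrime μ) * √rhat) := by
  refine ⟨hc.memLp_reward_transition, fun s k => ?_, fun s j i => ?_, fun i => ?_⟩ <;>
    rw [condStep_reward]
  · have h1 := hs.abs_powP_Rpi_sub_le hc s k
    have h2 := hc.abs_rbar_le
    have h3 := abs_sub_abs_le_abs_sub (M.powP k M.Rpi s) (M.rbar μ)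
    linarith
  · rw [one_mul]; exact hs.norm_corr_Rpi_sub_le hc hf s j i
  · exact (hc.norm_PsiTLam_powP_le hf hc.memLp_Rpi i).trans
      (mul_le_mul_of_nonneg_left (Real.sqrt_le_sqrt hc.integral_Rpi_sq_le) (Real.sqrt_nonneg _))

theorem abs_powP_Psi_sub_le (hs : M.StableChain μ f₁ f₂ f₃ ρ) (hc : M.ErgodicChain μ rhat)
    (hf : M.FeatureMatrix μ psihat) (θ : EuclideanSpace ℝ (Fin d)) (s : S) (k : ℕ) :
    |M.powP k (M.Psi θ) s - ⟪∫ s, M.ψ s ∂μ, θ⟫_ℝ| ≤ ρ ^ k * f₁ s * ‖θ‖ := by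
  have hi := hc.integrable_pow (hf.memLp.integrable one_le_two) k s
  have e : M.powP k (M.Psi θ) s = ⟪∫ t, M.ψ t ∂((M.stateKernel ^ k) s), θ⟫_ℝ := by
    rw [real_inner_comm, ← integral_inner hi]
    unfold powP Psi
    simp_rw [real_inner_comm θ]
  rw [e, ← inner_sub_left]
  exact (abs_real_inner_le_norm _ _).trans
    (mul_le_mul_of_nonneg_right (hs.feature s k) (norm_nonneg _))

/-- The conditional mean is (P - I)Ψθ, so every quantity is a difference of the values at lags i + 1
and i, whence the factors 2. Its stationary mean is zero, so a = 0. -/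
theorem traceRate_difference (hs : M.StableChain μ f₁ f₂ f₃ ρ) (hc : M.ErgodicChain μ rhat)
    (hf : M.FeatureMatrix μ psihat) (θ : EuclideanSpace ℝ (Fin d)) :
    M.TraceRate μ f₁ ρ (fun t => M.Psi θ t.2.2 - M.Psi θ t.1) 0 (2 * ‖θ‖) (2 * ‖θ‖)
      (2 * M.psiPrime μ * ‖θ‖) := by
  have hψ := hf.memLp_Psi θ
  have hψi := hψ.integrable one_le_two
  have hp : ∀ i s, M.powP i (fun s => M.powP 1 (M.Psi θ) s - M.Psi θ s) s =
      M.powP (i + 1) (M.Psi θ) s - M.powP i (M.Psi θ) s := fun i s => by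
    rw [hc.powP_sub ((hc.memLp_powP hψ 1).integrable one_le_two) hψi, hc.powP_add hψi]
  have hD : ∀ i, M.PsiTLam μ (M.powP i fun s => M.powP 1 (M.Psi θ) s - M.Psi θ s) =
      M.PsiTLam μ (M.powP (i + 1) (M.Psi θ)) - M.PsiTLam μ (M.powP i (M.Psi θ)) := fun i => by
    rw [← PsiTLam_sub (hf.integrable_smul (hc.memLp_powP hψ _))
      (hf.integrable_smul (hc.memLp_powP hψ _))]
    exact congrArg _ (funext (hp i))
  have hC : ∀ j i s, M.corr (fun s => M.powP 1 (M.Psi θ) s - M.Psi θ s) j i s =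
      M.corr (M.Psi θ) j (i + 1) s - M.corr (M.Psi θ) j i s := fun j i s => by
    unfold corr
    rw [← integral_sub (hc.integrable_smul_pow hf (hc.memLp_powP hψ _) _ _)
      (hc.integrable_smul_pow hf (hc.memLp_powP hψ _) _ _)]
    simp_rw [hp, sub_smul]
  have hnorm : ∀ i, ‖M.PsiTLam μ (M.powP i (M.Psi θ))‖ ≤ M.psiPrime μ * ‖θ‖ := fun i => by
    refine (hc.norm_PsiTLam_powP_le hf hψ i).trans ?_
    have h1 : √(∫ s, M.Psi θ s ^ 2 ∂μ) ≤ √(M.psiPrime μ) * ‖θ‖ := by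
      rw [← Real.sqrt_sq (norm_nonneg θ), ← Real.sqrt_mul psiPrime_nonneg]
      exact Real.sqrt_le_sqrt (hf.integral_Psi_sq θ)
    calc _ ≤ √(M.psiPrime μ) * (√(M.psiPrime μ) * ‖θ‖) := by gcongr
      _ = _ := by rw [← mul_assoc, Real.mul_self_sqrt psiPrime_nonneg]
  refine ⟨(hc.memLp_next hψ).sub (memLp_current hψ), fun s k => ?_, fun s j i => ?_,
    fun i => ?_⟩ <;> rw [hc.condStep_next_sub hψ]
  · rw [hp]
    have h1 := hs.abs_powP_Psi_sub_le hc hf θ s (k + 1)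
    have h2 := hs.abs_powP_Psi_sub_le hc hf θ s k
    have h3 : ρ ^ (k + 1) * f₁ s * ‖θ‖ ≤ ρ ^ k * f₁ s * ‖θ‖ := by
      have := hs.f₁_nonneg s
      gcongr ?_ * _ * _
      exact pow_le_pow_of_le_one hs.rho_pos.le hs.rho_lt_one.le (Nat.le_succ k)
    have h4 := abs_sub (M.powP (k + 1) (M.Psi θ) s - ⟪∫ s, M.ψ s ∂μ, θ⟫_ℝ)
      (M.powP k (M.Psi θ) s - ⟪∫ s, M.ψ s ∂μ, θ⟫_ℝ)
    rw [sub_sub_sub_cancel_right] at h4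
    linarith
  · rw [hC, hD, sub_sub_sub_comm]
    have h1 := hs.norm_corr_Psi_sub_le hc hf θ s j (i + 1)
    have h2 := hs.norm_corr_Psi_sub_le hc hf θ s j i
    refine (norm_sub_le _ _).trans ?_
    linarith
  · rw [hD]
    refine (norm_sub_le _ _).trans ?_
    linarith [hnorm i, hnorm (i + 1)]

/-- At time 0 the assumption on features says that ψ(s) lies within f₁(s) of its stationary mean.
This charges the prescribed initial transition to f₁, like the later times. -/
theorem abs_difference_le (hs : M.StableChain μ f₁ f₂ f₃ ρ)
    (θ : EuclideanSpace ℝ (Fin d)) (s s' : S) :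
    |M.Psi θ s' - M.Psi θ s| ≤ (f₁ s + f₁ s') * ‖θ‖ := by
  have h : ∀ s, ‖M.ψ s - ∫ s, M.ψ s ∂μ‖ ≤ f₁ s := fun s => by
    have := hs.feature s 0
    rw [kernel_pow_zero_apply, integral_dirac] at this
    simpa using this
  unfold Psi
  rw [← inner_sub_left]
  refine (abs_real_inner_le_norm _ _).trans (mul_le_mul_of_nonneg_right ?_ (norm_nonneg _))
  rw [← sub_sub_sub_cancel_right _ _ (∫ s, M.ψ s ∂μ), add_comm]
  exact (norm_sub_le _ _).trans (add_le_add (h s') (h s))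

end StableChain

end TDModel

/-! ### The Poisson equation for `F` -/

namespace TDModel

variable {S A : Type*} [Countable S] [MeasurableSpace S] [DiscreteMeasurableSpace S]
  [Fintype A] [MeasurableSpace A] [DiscreteMeasurableSpace A] {d : ℕ} {M : TDModel S A d}
  {μ : Measure S} [IsProbabilityMeasure μ] {rhat psihat lam cα : ℝ}
  {f₁ f₂ f₃ : S → ℝ} {ρ : ℝ}

theorem F_eq (x : TDParam d) (y : TDState S A d) : M.F cα x y =
    WithLp.toLp 2 (cα * (M.R y.1 y.2.1 - x.fst),
      (M.R y.1 y.2.1 - x.fst + ⟪M.ψ y.2.2.1, x.snd⟫_ℝ - ⟪M.ψ y.1, x.snd⟫_ℝ) •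
        M.proj y.2.2.2) := by
  unfold F b
  rw [T_apply, ← WithLp.toLp_add, Prod.mk_add_mk, inner_sub_left]
  congr 2
  · ring
  · module

theorem traceMean_difference (hc : M.ErgodicChain μ rhat) (hf : M.FeatureMatrix μ psihat)
    (h0 : 0 ≤ lam) (h1 : lam < 1) (θ : EuclideanSpace ℝ (Fin d)) :
    M.traceMean μ lam (fun t => M.Psi θ t.2.2 - M.Psi θ t.1) = M.driftOp μ lam θ := by
  unfold traceMean
  rw [hc.condStep_next_sub (hf.memLp_Psi θ), ← hc.driftOp_apply hf h0 h1]

theorem Tbar_add_bbar_eq (hc : M.ErgodicChain μ rhat) (hf : M.FeatureMatrix μ psihat)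
    (h0 : 0 ≤ lam) (h1 : lam < 1) (x : TDParam d) :
    M.Tbar μ lam cα x + M.bbar μ lam cα = WithLp.toLp 2 (cα * (M.rbar μ - x.fst),
      M.proj (M.traceMean μ lam (fun t => M.R t.1 t.2.1) - x.fst • M.traceMean μ lam (fun _ => 1)
        + M.traceMean μ lam (fun t => M.Psi x.snd t.2.2 - M.Psi x.snd t.1))) := by
  have e1 : M.traceMean μ lam (fun _ => 1) = (1 / (1 - lam)) • M.PsiTLam μ fun _ => 1 := by
    unfold traceMean; rw [resolvent_condStep_one h0 h1, PsiTLam_const_mul]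
  have e2 : M.traceMean μ lam (fun t => M.R t.1 t.2.1) = M.PsiTLam μ (M.RLam lam) := by
    unfold traceMean
    rw [condStep_reward]
    exact congrArg _ (funext fun s => (hc.RLam_eq h0 h1 s).symm)
  rw [traceMean_difference hc hf h0 h1, e1, e2, Tbar_apply]
  unfold bbar
  rw [← WithLp.toLp_add, Prod.mk_add_mk]
  congr 2
  · ring
  · simp only [map_add, map_sub, map_smul]; module

variable (M μ) in
/-- The sum over time of the deviations of the expected rewards from the average reward. -/
noncomputable def rewardSum (lam : ℝ) (y : TDState S A d) : ℝ :=
  ∑' k, (∫ y', M.R y'.1 y'.2.1 ∂((M.tdKernel lam ^ k) y) - M.rbar μ)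

/-- A bound for the function `rewardSum`. -/
noncomputable def rewardSumBound (M : TDModel S A d) (μ : Measure S) (f₁ : S → ℝ) (ρ : ℝ)
    (y : TDState S A d) : ℝ := |M.R y.1 y.2.1| + |M.rbar μ| + f₁ y.2.2.1 / (1 - ρ)

theorem StableChain.rewardSum_poisson (hs : M.StableChain μ f₁ f₂ f₃ ρ)
    (hc : M.ErgodicChain μ rhat) :
    (∀ y, |M.rewardSum μ lam y| ≤ M.rewardSumBound μ f₁ ρ y) ∧
    StronglyMeasurable (M.rewardSum μ lam) ∧
    ∀ y, Integrable (M.rewardSum μ lam) (M.tdKernel lam y) ∧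
      M.rewardSum μ lam y = M.R y.1 y.2.1 +
        ∫ y', M.rewardSum μ lam y' ∂(M.tdKernel lam y) - M.rbar μ := by
  have hf1 : Measurable f₁ := .of_discrete
  have hm := measurable_reward (M := M)
  have hint : ∀ k y, Integrable (fun y : TDState S A d => M.R y.1 y.2.1)
      ((M.tdKernel lam ^ k) y) := fun k y =>
    ((memLp_two_iff_integrable_sq hm.aestronglyMeasurable).2
      ((hs.integralLE_reward k y).sq hm).1).integrable one_le_two
  -- The prescribed reward at time 0 is bounded trivially, and the rate at time k + 1 is ρ^k because
  -- the chain has run k steps from the next state.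
  let κ : ℕ → TDState S A d → ℝ := fun k y => match k with
    | 0 => |M.R y.1 y.2.1| + |M.rbar μ|
    | k + 1 => ρ ^ k * f₁ y.2.2.1
  have hκ : ∀ k y, ‖∫ y', M.R y'.1 y'.2.1 ∂((M.tdKernel lam ^ k) y) - M.rbar μ‖ ≤ κ k y := by
    intro k y
    cases k with
    | zero =>
      rw [kernel_pow_zero_apply, integral_dirac' _ _ hm.stronglyMeasurable]
      exact norm_sub_le _ _
    | succ k =>
      have e : ∫ y', M.R y'.1 y'.2.1 ∂((M.tdKernel lam ^ (k + 1)) y) =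
          M.powP k M.Rpi y.2.2.1 := by
        have hmr : Measurable fun t : S × A × S => (t.1, t.2.1) := by fun_prop
        rw [← hc.integral_reward_stateAction, stateAction_apply,
          ← compProd_stepKernel_map_stateAction, ← tdKernel_pow_succ_map_transition (lam := lam),
          Measure.map_map hmr measurable_transition,
          integral_map (hmr.comp measurable_transition).aemeasurable
            StronglyMeasurable.of_discrete.aestronglyMeasurable]
        rfl
      rw [e]
      exact hs.abs_powP_Rpi_sub_le hc _ k
  have hB : ∀ y, HasSum (fun k => κ k y) (M.rewardSumBound μ f₁ ρ y) := by
    intro y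
    have g : HasSum (fun k => κ (k + 1) y) _ :=
      (hasSum_geometric_of_lt_one hs.rho_pos.le hs.rho_lt_one).mul_right (f₁ y.2.2.1)
    convert! (hasSum_nat_add_iff (f := fun k => κ k y) 1).1 g using 1
    rw [Finset.sum_range_one]
    simp only [κ, rewardSumBound]
    ring
  have hBi : ∀ y, Integrable (M.rewardSumBound μ f₁ ρ) (M.tdKernel lam y) := by
    intro y
    have j1 := hint 1 y
    have j2 := hs.integrable_f₁_next (lam := lam) 1 y
    rw [pow_one] at j1 j2
    have j3 : Integrable (fun y : TDState S A d => |M.R y.1 y.2.1| + |M.rbar μ|)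
        (M.tdKernel lam y) := j1.abs.add (integrable_const _)
    exact j3.add (j2.div_const (1 - ρ))
  obtain ⟨p1, p2⟩ := poisson_tsum (M.tdKernel lam) hm.stronglyMeasurable hint hκ hB hBi
  exact ⟨fun y => tsum_of_norm_bounded (hB y) fun k => hκ k y, p1, p2⟩

variable (M μ) in
/-- The solution of the Poisson equation for the operator `F`. -/
noncomputable def poissonSolution (lam cα : ℝ) (x : TDParam d) (y : TDState S A d) : TDParam d :=
  WithLp.toLp 2 (cα * M.rewardSum μ lam y,
    M.proj (M.traceSum μ lam (fun t => M.R t.1 t.2.1) y - x.fst • M.traceSum μ lam (fun _ => 1) y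
      + M.traceSum μ lam (fun t => M.Psi x.snd t.2.2 - M.Psi x.snd t.1) y))

/-- F(x, ·) combines the reward and three weighted traces with coefficients depending only on x, up
to the fixed map Π. By linearity the four scalar and vector solutions assemble to one for F. -/
theorem StableChain.poissonSolution_eq (hs : M.StableChain μ f₁ f₂ f₃ ρ)
    (hc : M.ErgodicChain μ rhat) (hf : M.FeatureMatrix μ psihat) (h0 : 0 ≤ lam) (h1 : lam < 1)
    (x : TDParam d) : StronglyMeasurable (M.poissonSolution μ lam cα x) ∧
    ∀ y, Integrable (M.poissonSolution μ lam cα x) (M.tdKernel lam y) ∧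
      M.poissonSolution μ lam cα x y = M.F cα x y +
        ∫ y', M.poissonSolution μ lam cα x y' ∂(M.tdKernel lam y) -
          (M.Tbar μ lam cα x + M.bbar μ lam cα) := by
  obtain ⟨-, m0, p0⟩ := hs.rewardSum_poisson (lam := lam) hc
  obtain ⟨m1, p1⟩ := (hs.traceRate_reward hc hf).poisson hs hc hf h0 h1
  obtain ⟨m2, p2⟩ := (hs.traceRate_one hf).poisson hs hc hf h0 h1
  obtain ⟨m3, p3⟩ := (hs.traceRate_difference hc hf x.snd).poisson hs hc hf h0 h1
  refine ⟨?_, fun y => ?_⟩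
  · refine (WithLp.prodContinuousLinearEquiv 2 ℝ ℝ
      (EuclideanSpace ℝ (Fin d))).symm.continuous.comp_stronglyMeasurable ?_
    exact (m0.const_mul cα).prodMk (M.proj.continuous.comp_stronglyMeasurable
      ((m1.sub (m2.const_smul x.fst)).add m3))
  · obtain ⟨i0, q0⟩ := p0 y
    obtain ⟨i1, q1⟩ := p1 y
    obtain ⟨i2, q2⟩ := p2 y
    obtain ⟨i3, q3⟩ := p3 y
    have j2 : Integrable (fun y => x.fst • M.traceSum μ lam (fun _ => 1) y) (M.tdKernel lam y) :=
      i2.smul x.fst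
    have j4 : Integrable (fun y => M.traceSum μ lam (fun t => M.R t.1 t.2.1) y -
      x.fst • M.traceSum μ lam (fun _ => 1) y) (M.tdKernel lam y) := i1.sub j2
    have j5 : Integrable (fun y => M.traceSum μ lam (fun t => M.R t.1 t.2.1) y -
      x.fst • M.traceSum μ lam (fun _ => 1) y +
      M.traceSum μ lam (fun t => M.Psi x.snd t.2.2 - M.Psi x.snd t.1) y) (M.tdKernel lam y) :=
      j4.add i3
    have j6 := M.proj.integrable_comp j5
    have j0 := i0.const_mul cα
    refine ⟨integrable_toLp_prod j0 j6, ?_⟩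
    have e : ∫ y', M.poissonSolution μ lam cα x y' ∂(M.tdKernel lam y) = _ :=
      integral_toLp_prod j0 j6
    rw [e, M.proj.integral_comp_comm j5, integral_add j4 i3, integral_sub i1 j2, integral_smul,
      integral_const_mul, Tbar_add_bbar_eq hc hf h0 h1, F_eq]
    refine WithLp.ofLp_injective 2 (Prod.ext ?_ ?_)
    · change cα * M.rewardSum μ lam y = cα * (M.R y.1 y.2.1 - x.fst) +
        cα * (∫ y', M.rewardSum μ lam y' ∂(M.tdKernel lam y)) - cα * (M.rbar μ - x.fst)
      rw [q0]; ring
    · change M.proj (M.traceSum μ lam (fun t => M.R t.1 t.2.1) y -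
        x.fst • M.traceSum μ lam (fun _ => 1) y
        + M.traceSum μ lam (fun t => M.Psi x.snd t.2.2 - M.Psi x.snd t.1) y) =
        _ • M.proj y.2.2.2 + M.proj _ - M.proj _
      rw [q1, q2, q3]
      simp only [map_add, map_sub, map_smul, transition, Psi]
      module

/-- Linearity in θ makes the solution affine in x, so that increments in x obey the estimate for a
single parameter. -/
theorem StableChain.traceSum_difference_sub (hs : M.StableChain μ f₁ f₂ f₃ ρ)
    (hc : M.ErgodicChain μ rhat) (hf : M.FeatureMatrix μ psihat) (h0 : 0 ≤ lam) (h1 : lam < 1)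
    (θ θ' : EuclideanSpace ℝ (Fin d)) (y : TDState S A d) :
    M.traceSum μ lam (fun t => M.Psi θ t.2.2 - M.Psi θ t.1) y -
      M.traceSum μ lam (fun t => M.Psi θ' t.2.2 - M.Psi θ' t.1) y =
      M.traceSum μ lam (fun t => M.Psi (θ - θ') t.2.2 - M.Psi (θ - θ') t.1) y := by
  have r := hs.traceRate_difference hc hf θ
  have r' := hs.traceRate_difference hc hf θ'
  unfold traceSum
  rw [← (r.summable_traceGap hc hf h0 h1 hs.rho_pos hs.rho_lt_one y).tsum_sub
    (r'.summable_traceGap hc hf h0 h1 hs.rho_pos hs.rho_lt_one y)]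
  refine tsum_congr fun k => ?_
  unfold traceGap
  rw [traceMean_difference hc hf h0 h1, traceMean_difference hc hf h0 h1,
    traceMean_difference hc hf h0 h1, map_sub, sub_sub_sub_comm,
    ← integral_sub (hc.integrable_transition_smul_trace hf r.memLp k y)
      (hc.integrable_transition_smul_trace hf r'.memLp k y)]
  congr 1
  refine integral_congr_ae (Filter.Eventually.of_forall fun y => ?_)
  simp only [Psi, inner_sub_right]
  module

variable (M μ) in
/-- The Lipschitz constant of the solution of the Poisson equation. -/
noncomputable def poissonLip (lam : ℝ) (f₁ : S → ℝ) (ρ : ℝ) (y : TDState S A d) : ℝ :=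
  3 * (f₁ y.2.2.1 / ((1 - lam) * (1 - ρ))) +
    3 * (‖y.2.2.2‖ * (f₁ y.1 + f₁ y.2.2.1) / (1 - lam * ρ)) + ‖y.2.2.2‖ / (1 - lam) +
    √(M.psiPrime μ) / (1 - lam) ^ 2 + 2 * (M.psiPrime μ / (1 - lam) ^ 2)

variable (M μ) in
/-- The part of the bound for `traceSum` of the rewards that comes from positive times. -/
noncomputable def rewardTail (lam rhat : ℝ) (f₁ : S → ℝ) (ρ : ℝ) (y : TDState S A d) : ℝ :=
  f₁ y.2.2.1 / ((1 - lam) * (1 - ρ)) + ‖y.2.2.2‖ * (f₁ y.1 + f₁ y.2.2.1) / (1 - lam * ρ) +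
    √rhat * (‖y.2.2.2‖ / (1 - lam)) + √rhat * (√(M.psiPrime μ) / (1 - lam) ^ 2)

end TDModel

/-! ### Pointwise bounds for the solution -/

namespace TDModel

variable {S A : Type*} [Countable S] [MeasurableSpace S] [DiscreteMeasurableSpace S]
  [Fintype A] [MeasurableSpace A] [DiscreteMeasurableSpace A] {d : ℕ} {M : TDModel S A d}
  {μ : Measure S} [IsProbabilityMeasure μ] {rhat psihat lam cα : ℝ}
  {f₁ f₂ f₃ : S → ℝ} {ρ : ℝ}

theorem toLp_sub_toLp {E F : Type*} [NormedAddCommGroup E] [NormedAddCommGroup F] (u u' : E)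
    (w w' : F) : WithLp.toLp 2 (u, w) - WithLp.toLp 2 (u', w') = WithLp.toLp 2 (u - u', w - w') :=
  rfl

theorem norm_toLp_le {E : Type*} [NormedAddCommGroup E] {u a b : ℝ} {w : E} (hu : |u| ≤ a)
    (hw : ‖w‖ ≤ b) : ‖WithLp.toLp 2 (u, w)‖ ≤ √(a ^ 2 + b ^ 2) := by
  refine Real.le_sqrt_of_sq_le ?_
  rw [WithLp.prod_norm_sq_eq_of_L2]
  change ‖u‖ ^ 2 + ‖w‖ ^ 2 ≤ _
  rw [Real.norm_eq_abs]
  gcongr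

/-- The bound for the solution of the Poisson equation at `xs`. -/
noncomputable def poissonBound (M : TDModel S A d) (μ : Measure S) (lam cα rhat : ℝ) (f₁ : S → ℝ)
    (ρ : ℝ) (xs : TDParam d) (y : TDState S A d) : ℝ :=
  √((cα * M.rewardSumBound μ f₁ ρ y) ^ 2 + (‖xs‖ * M.poissonLip μ lam f₁ ρ y +
    |M.R y.1 y.2.1| * ‖y.2.2.2‖ + M.rewardTail μ lam rhat f₁ ρ y) ^ 2)

namespace StableChain

theorem one_sub_mul_pos (hs : M.StableChain μ f₁ f₂ f₃ ρ) (h0 : 0 ≤ lam) (h1 : lam < 1) :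
    0 < 1 - lam * ρ := by
  have := mul_lt_one_of_nonneg_of_lt_one_left h0 h1 hs.rho_lt_one.le
  linarith

theorem traceSumBound_one (hs : M.StableChain μ f₁ f₂ f₃ ρ) (h0 : 0 ≤ lam) (h1 : lam < 1)
    (y : TDState S A d) :
    traceSumBound lam f₁ ρ (fun _ => 1) 1 0 1 (√(M.psiPrime μ)) y =
      f₁ y.2.2.1 / ((1 - lam) * (1 - ρ)) + ‖y.2.2.2‖ / (1 - lam) +
        √(M.psiPrime μ) / (1 - lam) ^ 2 := by
  have hl : 1 - lam ≠ 0 := by linarith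
  have hr : 1 - ρ ≠ 0 := by linarith [hs.rho_lt_one]
  have hlr := (hs.one_sub_mul_pos h0 h1).ne'
  unfold traceSumBound
  rw [abs_one]
  field_simp
  ring

theorem traceSumBound_difference_le (hs : M.StableChain μ f₁ f₂ f₃ ρ) (h0 : 0 ≤ lam)
    (h1 : lam < 1) (θ : EuclideanSpace ℝ (Fin d)) (y : TDState S A d) :
    traceSumBound lam f₁ ρ (fun t => M.Psi θ t.2.2 - M.Psi θ t.1) 0 (2 * ‖θ‖) (2 * ‖θ‖)
      (2 * M.psiPrime μ * ‖θ‖) y ≤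
      (2 * (f₁ y.2.2.1 / ((1 - lam) * (1 - ρ))) +
        3 * (‖y.2.2.2‖ * (f₁ y.1 + f₁ y.2.2.1) / (1 - lam * ρ)) +
        2 * (M.psiPrime μ / (1 - lam) ^ 2)) * ‖θ‖ := by
  have hl : 0 < 1 - lam := by linarith
  have hr : 0 < 1 - ρ := by linarith [hs.rho_lt_one]
  have hlr := hs.one_sub_mul_pos h0 h1
  have a1 := hs.f₁_nonneg y.1
  have b1 := hs.f₁_nonneg y.2.2.1
  have hφ := hs.abs_difference_le θ y.1 y.2.2.1
  have hlρ : 0 ≤ lam * ρ := mul_nonneg h0 hs.rho_pos.le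
  -- Over the common denominator 1 - λρ the time 0 term contributes 1 - λρ and the later times 2λ;
  -- together at most 3.
  have key : |M.Psi θ y.2.2.1 - M.Psi θ y.1| * ‖y.2.2.2‖ +
      ‖y.2.2.2‖ * (2 * ‖θ‖ * f₁ y.2.2.1 * (lam * (1 - lam * ρ)⁻¹)) ≤
      3 * (‖y.2.2.2‖ * (f₁ y.1 + f₁ y.2.2.1) / (1 - lam * ρ)) * ‖θ‖ := by
    calc _ ≤ (f₁ y.1 + f₁ y.2.2.1) * ‖θ‖ * ‖y.2.2.2‖ +
          ‖y.2.2.2‖ * (2 * ‖θ‖ * (f₁ y.1 + f₁ y.2.2.1) * (lam * (1 - lam * ρ)⁻¹)) := by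
          gcongr; linarith
      _ = (‖y.2.2.2‖ * (f₁ y.1 + f₁ y.2.2.1) * ‖θ‖ * (1 - lam * ρ)⁻¹) *
          (1 - lam * ρ + 2 * lam) := by field_simp
      _ ≤ (‖y.2.2.2‖ * (f₁ y.1 + f₁ y.2.2.1) * ‖θ‖ * (1 - lam * ρ)⁻¹) * 3 := by
          gcongr; linarith
      _ = _ := by field_simp
  have e : traceSumBound lam f₁ ρ (fun t => M.Psi θ t.2.2 - M.Psi θ t.1) 0 (2 * ‖θ‖) (2 * ‖θ‖)
      (2 * M.psiPrime μ * ‖θ‖) y = |M.Psi θ y.2.2.1 - M.Psi θ y.1| * ‖y.2.2.2‖ +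
      ‖y.2.2.2‖ * (2 * ‖θ‖ * f₁ y.2.2.1 * (lam * (1 - lam * ρ)⁻¹)) +
      (2 * (f₁ y.2.2.1 / ((1 - lam) * (1 - ρ))) + 2 * (M.psiPrime μ / (1 - lam) ^ 2)) * ‖θ‖ := by
    simp only [traceSumBound, transition]
    field_simp
    ring
  rw [e]
  linarith

theorem traceSumBound_reward_le (hs : M.StableChain μ f₁ f₂ f₃ ρ) (h0 : 0 ≤ lam) (h1 : lam < 1)
    (y : TDState S A d) :
    traceSumBound lam f₁ ρ (fun t => M.R t.1 t.2.1) (√rhat) 1 1 (√(M.psiPrime μ) * √rhat) y ≤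
      |M.R y.1 y.2.1| * ‖y.2.2.2‖ + M.rewardTail μ lam rhat f₁ ρ y := by
  have hl : 0 < 1 - lam := by linarith
  have hr : 0 < 1 - ρ := by linarith [hs.rho_lt_one]
  have hlr := hs.one_sub_mul_pos h0 h1
  have a1 := hs.f₁_nonneg y.1
  have b1 := hs.f₁_nonneg y.2.2.1
  have k1 : ‖y.2.2.2‖ * (√rhat * (lam * (1 - lam)⁻¹)) ≤ √rhat * (‖y.2.2.2‖ / (1 - lam)) := by
    calc _ ≤ ‖y.2.2.2‖ * (√rhat * (1 * (1 - lam)⁻¹)) := by gcongr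
      _ = _ := by field_simp
  have k2 : ‖y.2.2.2‖ * (1 * f₁ y.2.2.1 * (lam * (1 - lam * ρ)⁻¹)) ≤
      ‖y.2.2.2‖ * (f₁ y.1 + f₁ y.2.2.1) / (1 - lam * ρ) := by
    calc _ ≤ ‖y.2.2.2‖ * (1 * (f₁ y.1 + f₁ y.2.2.1) * (1 * (1 - lam * ρ)⁻¹)) := by
          gcongr; linarith
      _ = _ := by field_simp
  have e : traceSumBound lam f₁ ρ (fun t => M.R t.1 t.2.1) (√rhat) 1 1
      (√(M.psiPrime μ) * √rhat) y = |M.R y.1 y.2.1| * ‖y.2.2.2‖ +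
      (‖y.2.2.2‖ * (√rhat * (lam * (1 - lam)⁻¹)) +
        ‖y.2.2.2‖ * (1 * f₁ y.2.2.1 * (lam * (1 - lam * ρ)⁻¹))) +
      (f₁ y.2.2.1 / ((1 - lam) * (1 - ρ)) +
        √rhat * (√(M.psiPrime μ) / (1 - lam) ^ 2)) := by
    simp only [traceSumBound, transition]
    field_simp
    ring
  rw [e]
  unfold rewardTail
  linarith

theorem poissonLip_nonneg (hs : M.StableChain μ f₁ f₂ f₃ ρ) (h0 : 0 ≤ lam) (h1 : lam < 1)
    (y : TDState S A d) : 0 ≤ M.poissonLip μ lam f₁ ρ y := by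
  have hl : 0 < 1 - lam := by linarith
  have hr : 0 < 1 - ρ := by linarith [hs.rho_lt_one]
  have hlr := hs.one_sub_mul_pos h0 h1
  have a1 := hs.f₁_nonneg y.1
  have b1 := hs.f₁_nonneg y.2.2.1
  have p := psiPrime_nonneg (M := M) (μ := μ)
  unfold poissonLip
  positivity

/-- The part of the solution of the Poisson equation that depends on the parameter. -/
theorem norm_traceSum_linear_le (hs : M.StableChain μ f₁ f₂ f₃ ρ) (hc : M.ErgodicChain μ rhat)
    (hf : M.FeatureMatrix μ psihat) (h0 : 0 ≤ lam) (h1 : lam < 1) {X r : ℝ}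
    {θ : EuclideanSpace ℝ (Fin d)} (hr : |r| ≤ X) (hθ : ‖θ‖ ≤ X) (y : TDState S A d) :
    ‖-(r • M.traceSum μ lam (fun _ => 1) y) +
      M.traceSum μ lam (fun t => M.Psi θ t.2.2 - M.Psi θ t.1) y‖ ≤
      X * M.poissonLip μ lam f₁ ρ y := by
  have hl : 0 < 1 - lam := by linarith
  have hr' : 0 < 1 - ρ := by linarith [hs.rho_lt_one]
  have hlr := hs.one_sub_mul_pos h0 h1
  have a1 := hs.f₁_nonneg y.1
  have b1 := hs.f₁_nonneg y.2.2.1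
  have p := psiPrime_nonneg (M := M) (μ := μ)
  have n1 := (hs.traceRate_one hf).norm_traceSum_le hc hf h0 h1 hs.rho_pos hs.rho_lt_one y
  rw [hs.traceSumBound_one h0 h1] at n1
  have n2 := ((hs.traceRate_difference hc hf θ).norm_traceSum_le hc hf h0 h1 hs.rho_pos
    hs.rho_lt_one y).trans (hs.traceSumBound_difference_le h0 h1 θ y)
  refine (norm_add_le _ _).trans ?_
  rw [norm_neg, norm_smul, Real.norm_eq_abs]
  calc _ ≤ X * (f₁ y.2.2.1 / ((1 - lam) * (1 - ρ)) + ‖y.2.2.2‖ / (1 - lam) +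
        √(M.psiPrime μ) / (1 - lam) ^ 2) + (2 * (f₁ y.2.2.1 / ((1 - lam) * (1 - ρ))) +
        3 * (‖y.2.2.2‖ * (f₁ y.1 + f₁ y.2.2.1) / (1 - lam * ρ)) +
        2 * (M.psiPrime μ / (1 - lam) ^ 2)) * X := by
        refine add_le_add (mul_le_mul hr n1 (norm_nonneg _) ((abs_nonneg _).trans hr))
          (n2.trans (mul_le_mul_of_nonneg_left hθ (by positivity)))
    _ = _ := by unfold poissonLip; ring

/-- The first component and the reward part do not depend on x and cancel; what remains is the
linear part at x₂ - x₁. -/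
theorem norm_poissonSolution_sub_le (hs : M.StableChain μ f₁ f₂ f₃ ρ)
    (hc : M.ErgodicChain μ rhat) (hf : M.FeatureMatrix μ psihat) (h0 : 0 ≤ lam) (h1 : lam < 1)
    (x₁ x₂ : TDParam d) (y : TDState S A d) :
    ‖M.poissonSolution μ lam cα x₂ y - M.poissonSolution μ lam cα x₁ y‖ ≤
      M.poissonLip μ lam f₁ ρ y * ‖x₂ - x₁‖ := by
  have hfst : |x₂.fst - x₁.fst| ≤ ‖x₂ - x₁‖ := WithLp.norm_fst_le _ (x₂ - x₁)
  have hsnd : ‖x₂.snd - x₁.snd‖ ≤ ‖x₂ - x₁‖ := WithLp.norm_snd_le _ (x₂ - x₁)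
  have hL := hs.norm_traceSum_linear_le hc hf h0 h1 hfst hsnd y
  rw [← hs.traceSum_difference_sub hc hf h0 h1] at hL
  have hd : ∀ u v w w' : EuclideanSpace ℝ (Fin d), ∀ r r' : ℝ,
      u - r • v + w - (u - r' • v + w') = -((r - r') • v) + (w - w') := by
    intros; module
  unfold poissonSolution
  rw [toLp_sub_toLp, sub_self, ← map_sub, hd]
  refine (norm_toLp_le abs_zero.le ((norm_proj_le _).trans hL)).trans_eq ?_
  rw [zero_pow two_ne_zero, zero_add, Real.sqrt_sq
    (mul_nonneg (norm_nonneg _) (hs.poissonLip_nonneg h0 h1 y)), mul_comm]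

theorem norm_poissonSolution_le (hs : M.StableChain μ f₁ f₂ f₃ ρ)
    (hc : M.ErgodicChain μ rhat) (hf : M.FeatureMatrix μ psihat) (h0 : 0 ≤ lam) (h1 : lam < 1)
    (hcα : 0 ≤ cα) (x : TDParam d) (y : TDState S A d) :
    ‖M.poissonSolution μ lam cα x y‖ ≤ M.poissonBound μ lam cα rhat f₁ ρ x y := by
  have hL := hs.norm_traceSum_linear_le hc hf h0 h1 (WithLp.norm_fst_le _ x)
    (WithLp.norm_snd_le _ x) y
  have hR := ((hs.traceRate_reward hc hf).norm_traceSum_le hc hf h0 h1 hs.rho_pos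
    hs.rho_lt_one y).trans (hs.traceSumBound_reward_le h0 h1 y)
  refine norm_toLp_le ?_ ((norm_proj_le _).trans ?_)
  · rw [abs_mul, abs_of_nonneg hcα]
    exact mul_le_mul_of_nonneg_left ((hs.rewardSum_poisson hc).1 y) hcα
  · rw [sub_eq_add_neg, add_assoc, add_comm (M.traceSum μ lam (fun t => M.R t.1 t.2.1) y)]
    refine (norm_add_le _ _).trans ?_
    linarith

end StableChain

theorem measurable_f_next {f : S → ℝ} : Measurable fun y : TDState S A d => f y.2.2.1 := by
  have hm : Measurable f := .of_discrete
  exact hm.comp measurable_next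

theorem measurable_f_current {f : S → ℝ} : Measurable fun y : TDState S A d => f y.1 := by
  have hm : Measurable f := .of_discrete
  exact hm.comp measurable_fst

theorem measurable_poissonLip : Measurable (M.poissonLip μ lam f₁ ρ) := by
  have m1 := measurable_f_next (A := A) (d := d) (f := f₁)
  have m2 := measurable_f_current (A := A) (d := d) (f := f₁)
  unfold poissonLip
  fun_prop

theorem measurable_poissonBound {xs : TDParam d} :
    Measurable (M.poissonBound μ lam cα rhat f₁ ρ xs) := by
  have m1 := measurable_f_next (A := A) (d := d) (f := f₁)
  have m2 := measurable_f_current (A := A) (d := d) (f := f₁)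
  have m3 := measurable_reward (M := M)
  have m4 := measurable_poissonLip (M := M) (μ := μ) (lam := lam) (f₁ := f₁) (ρ := ρ)
  unfold poissonBound rewardSumBound rewardTail
  fun_prop

end TDModel

/-! ### Second moments of the bounds -/

namespace TDModel

variable {S A : Type*} [Countable S] [MeasurableSpace S] [DiscreteMeasurableSpace S]
  [Fintype A] [MeasurableSpace A] [DiscreteMeasurableSpace A] {d : ℕ} {M : TDModel S A d}
  {μ : Measure S} [IsProbabilityMeasure μ] {rhat psihat lam cα : ℝ}
  {f₁ f₂ f₃ : S → ℝ} {ρ : ℝ}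

/-- A fourth moment bound for the trace, up to the factor `(1 - lam) ^ 4`. -/
noncomputable def traceMoment (f₃ : S → ℝ) (y : TDState S A d) : ℝ :=
  ‖y.2.2.2‖ ^ 4 + f₃ y.2.2.1

/-- A second moment bound for the bounds on the solution of the Poisson equation, from an arbitrary
initial state. -/
noncomputable def poissonMoment (M : TDModel S A d) (μ : Measure S) (lam rhat : ℝ)
    (f₂ f₃ : S → ℝ) (ρ : ℝ) (y : TDState S A d) : ℝ :=
  4 * (√(f₂ y.2.2.1) / ((1 - lam) ^ 2 * (1 - ρ) ^ 2)) +
    16 * (√(traceMoment f₃ y) * √(f₂ y.1 + f₂ y.2.2.1) / ((1 - lam * ρ) ^ 2 * (1 - lam) ^ 2)) +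
    4 * (1 + rhat) ^ 2 * (√(traceMoment f₃ y) / (1 - lam) ^ 4) +
    4 * (M.psiPrime μ ^ 2 / (1 - lam) ^ 4)

namespace StableChain

theorem traceMoment_nonneg (hs : M.StableChain μ f₁ f₂ f₃ ρ) (y : TDState S A d) :
    0 ≤ traceMoment f₃ y := add_nonneg (by positivity) (hs.f₃_nonneg _)

theorem integralLE_tail_next (hs : M.StableChain μ f₁ f₂ f₃ ρ) (k : ℕ) (y : TDState S A d) :
    IntegralLE ((M.tdKernel lam ^ k) y) (fun y => (f₁ y.2.2.1 / ((1 - lam) * (1 - ρ))) ^ 2)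
      (√(f₂ y.2.2.1) / ((1 - lam) ^ 2 * (1 - ρ) ^ 2)) := by
  have h := (hs.integralLE_f₁_sq_next (lam := lam) k y).const_mul
    (c := (((1 - lam) * (1 - ρ)) ^ 2)⁻¹) (by positivity)
  simp_rw [div_pow, ← mul_pow, div_eq_inv_mul]
  exact h

theorem integralLE_tail_trace (hs : M.StableChain μ f₁ f₂ f₃ ρ) (h0 : 0 ≤ lam) (h1 : lam < 1)
    (k : ℕ) (y : TDState S A d) :
    IntegralLE ((M.tdKernel lam ^ k) y)
      (fun y => (‖y.2.2.2‖ * (f₁ y.1 + f₁ y.2.2.1) / (1 - lam * ρ)) ^ 2)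
      (4 * (√(traceMoment f₃ y) * √(f₂ y.1 + f₂ y.2.2.1) /
        ((1 - lam * ρ) ^ 2 * (1 - lam) ^ 2))) := by
  have m1 := measurable_f_next (A := A) (d := d) (f := f₁)
  have m2 := measurable_f_current (A := A) (d := d) (f := f₁)
  have m3 : Measurable fun y : TDState S A d => f₁ y.1 + f₁ y.2.2.1 := m2.add m1
  have e1 := integralLE_next_pow (lam := lam) hs.integralLE_f₁ k y
  have e2 := integralLE_current_pow (lam := lam) (fun _ => by positivity) hs.f₂_nonneg
    hs.integralLE_f₁ k y
  have a2 := hs.f₂_nonneg y.1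
  -- Again 16 = 8 · 2: the factor 8 is for the fourth power of a sum, and f₂(s') is counted twice.
  have hsum : IntegralLE ((M.tdKernel lam ^ k) y) (fun y => (f₁ y.1 + f₁ y.2.2.1) ^ 4)
      (16 * (f₂ y.1 + f₂ y.2.2.1)) := by
    refine (((e1.add e2).const_mul (c := 8) (by norm_num)).mono (m3.pow_const 4)
      (fun y => by positivity) fun y => ?_).mono_const (by linarith)
    have := add_pow_le (hs.f₁_nonneg y.1) (hs.f₁_nonneg y.2.2.1) 4
    norm_num at this
    linarith
  have h := ((hs.integralLE_trace h0 h1 k y).mul_sq hsum measurable_norm_trace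
    m3).const_mul (c := ((1 - lam * ρ) ^ 2)⁻¹) (by positivity)
  simp_rw [div_pow, mul_pow, div_eq_inv_mul _ ((1 - lam * ρ) ^ 2)]
  refine h.mono_const (le_of_eq ?_)
  rw [sqrt_div_pow_four, Real.sqrt_mul (by norm_num), show (16 : ℝ) = 4 ^ 2 by norm_num,
    Real.sqrt_sq (by norm_num)]
  unfold traceMoment
  field_simp

theorem integralLE_trace_div (hs : M.StableChain μ f₁ f₂ f₃ ρ) (h0 : 0 ≤ lam) (h1 : lam < 1)
    (k : ℕ) (y : TDState S A d) :
    IntegralLE ((M.tdKernel lam ^ k) y) (fun y => (‖y.2.2.2‖ / (1 - lam)) ^ 2)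
      (√(traceMoment f₃ y) / (1 - lam) ^ 4) := by
  have hl : 0 < 1 - lam := by linarith
  have h := (hs.integralLE_trace_sq h0 h1 k y).const_mul
    (c := ((1 - lam) ^ 2)⁻¹) (by positivity)
  simp_rw [div_pow, div_eq_inv_mul _ ((1 - lam) ^ 2)]
  refine h.mono_const (le_of_eq ?_)
  unfold traceMoment
  field_simp

theorem sqrt_psiPrime_div_sq_le (hs : M.StableChain μ f₁ f₂ f₃ ρ) (hc : M.ErgodicChain μ rhat)
    (hf : M.FeatureMatrix μ psihat) (y : TDState S A d) :
    (√(M.psiPrime μ) / (1 - lam) ^ 2) ^ 2 ≤ √(traceMoment f₃ y) / (1 - lam) ^ 4 := by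
  rw [div_pow, Real.sq_sqrt psiPrime_nonneg,
    show ((1 - lam) ^ 2) ^ 2 = (1 - lam) ^ 4 by ring]
  refine div_le_div_of_nonneg_right ?_ (by positivity)
  refine (hs.psiPrime_le hc hf y.2.2.1).trans (Real.sqrt_le_sqrt ?_)
  exact le_add_of_nonneg_left (by positivity)

theorem integralLE_poissonLip (hs : M.StableChain μ f₁ f₂ f₃ ρ) (hc : M.ErgodicChain μ rhat)
    (hf : M.FeatureMatrix μ psihat) (h0 : 0 ≤ lam) (h1 : lam < 1) (k : ℕ) (y : TDState S A d) :
    IntegralLE ((M.tdKernel lam ^ k) y) (fun y => M.poissonLip μ lam f₁ ρ y ^ 2)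
      (9 * M.poissonMoment μ lam rhat f₂ f₃ ρ y) := by
  -- The weights come from (3a + 3b + (c + c') + 2e)² ≤ 4 (9a² + 9b² + (c + c')² + 4e²) and (c +
  -- c')² ≤ 2c² + 2c'². The leading 36 = 9 · 4 explains the factor 9 in front of `poissonMoment`.
  have ea := (hs.integralLE_tail_next (lam := lam) k y).const_mul (c := 36) (by norm_num)
  have eb := (hs.integralLE_tail_trace h0 h1 k y).const_mul (c := 36) (by norm_num)
  have ec := (hs.integralLE_trace_div h0 h1 k y).const_mul (c := 8) (by norm_num)
  have ed := IntegralLE.const (τ := (M.tdKernel lam ^ k) y)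
    (8 * (√(M.psiPrime μ) / (1 - lam) ^ 2) ^ 2 + 16 * (M.psiPrime μ / (1 - lam) ^ 2) ^ 2)
  refine (((((ea.add eb).add ec).add ed).mono (measurable_poissonLip.pow_const 2)
    (fun _ => sq_nonneg _) fun y => ?_)).mono_const ?_
  · unfold poissonLip
    generalize f₁ y.2.2.1 / ((1 - lam) * (1 - ρ)) = a
    generalize ‖y.2.2.2‖ * (f₁ y.1 + f₁ y.2.2.1) / (1 - lam * ρ) = b
    generalize ‖y.2.2.2‖ / (1 - lam) = c
    generalize √(M.psiPrime μ) / (1 - lam) ^ 2 = c'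
    generalize M.psiPrime μ / (1 - lam) ^ 2 = e
    nlinarith [sq_nonneg (3 * a - 3 * b), sq_nonneg (3 * a - (c + c')), sq_nonneg (3 * a - 2 * e),
      sq_nonneg (3 * b - (c + c')), sq_nonneg (3 * b - 2 * e), sq_nonneg (c + c' - 2 * e),
      sq_nonneg (c - c')]
  · have h2 := hs.sqrt_psiPrime_div_sq_le (lam := lam) hc hf y
    have h3 : (M.psiPrime μ / (1 - lam) ^ 2) ^ 2 = M.psiPrime μ ^ 2 / (1 - lam) ^ 4 := by
      rw [div_pow, ← pow_mul]
    have hr := hc.rhat_nonneg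
    have h4 : 0 ≤ √(traceMoment f₃ y) / (1 - lam) ^ 4 := by positivity
    have h5 : 0 ≤ M.psiPrime μ ^ 2 / (1 - lam) ^ 4 := by positivity
    have h6 : 0 ≤ √(traceMoment f₃ y) * √(f₂ y.1 + f₂ y.2.2.1) /
      ((1 - lam * ρ) ^ 2 * (1 - lam) ^ 2) := by positivity
    have h7 : 36 * (√(traceMoment f₃ y) / (1 - lam) ^ 4) ≤
        36 * (1 + rhat) ^ 2 * (√(traceMoment f₃ y) / (1 - lam) ^ 4) := by
      refine mul_le_mul_of_nonneg_right ?_ h4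
      nlinarith
    unfold poissonMoment
    rw [h3]
    linarith

theorem integralLE_rewardTail (hs : M.StableChain μ f₁ f₂ f₃ ρ) (hc : M.ErgodicChain μ rhat)
    (hf : M.FeatureMatrix μ psihat) (h0 : 0 ≤ lam) (h1 : lam < 1) (k : ℕ) (y : TDState S A d) :
    IntegralLE ((M.tdKernel lam ^ k) y) (fun y => M.rewardTail μ lam rhat f₁ ρ y ^ 2)
      (M.poissonMoment μ lam rhat f₂ f₃ ρ y) := by
  have hr := hc.rhat_nonneg
  have m1 := measurable_f_next (A := A) (d := d) (f := f₁)
  have m2 := measurable_f_current (A := A) (d := d) (f := f₁)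
  have hm : Measurable (M.rewardTail μ lam rhat f₁ ρ) := by unfold rewardTail; fun_prop
  -- The square of a sum of four terms costs 4, and the two terms with √r̂ give 8 r̂ ≤ 4 (1 + r̂)²
  -- after `psiPrime_le` has replaced ψ' by the trace moment.
  have ea := (hs.integralLE_tail_next (lam := lam) k y).const_mul (c := 4) (by norm_num)
  have eb := (hs.integralLE_tail_trace h0 h1 k y).const_mul (c := 4) (by norm_num)
  have ec := (hs.integralLE_trace_div h0 h1 k y).const_mul (c := 4 * rhat) (by positivity)
  have ed := IntegralLE.const (τ := (M.tdKernel lam ^ k) y)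
    (4 * rhat * (√(M.psiPrime μ) / (1 - lam) ^ 2) ^ 2)
  refine (((((ea.add eb).add ec).add ed).mono (hm.pow_const 2)
    (fun _ => sq_nonneg _) fun y => ?_)).mono_const ?_
  · unfold rewardTail
    generalize f₁ y.2.2.1 / ((1 - lam) * (1 - ρ)) = a
    generalize ‖y.2.2.2‖ * (f₁ y.1 + f₁ y.2.2.1) / (1 - lam * ρ) = b
    generalize ‖y.2.2.2‖ / (1 - lam) = c
    generalize √(M.psiPrime μ) / (1 - lam) ^ 2 = c'
    have hq := Real.sq_sqrt hr
    generalize √rhat = q at hq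
    subst hq
    nlinarith [sq_nonneg (a - b), sq_nonneg (a - q * c), sq_nonneg (a - q * c'),
      sq_nonneg (b - q * c), sq_nonneg (b - q * c'), sq_nonneg (q * c - q * c')]
  · have h2 := mul_le_mul_of_nonneg_left (hs.sqrt_psiPrime_div_sq_le (lam := lam) hc hf y)
      (a := 4 * rhat) (by positivity)
    have h4 : 0 ≤ √(traceMoment f₃ y) / (1 - lam) ^ 4 := by positivity
    have h5 : 0 ≤ M.psiPrime μ ^ 2 / (1 - lam) ^ 4 := by positivity
    have h7 : 8 * rhat * (√(traceMoment f₃ y) / (1 - lam) ^ 4) ≤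
        4 * (1 + rhat) ^ 2 * (√(traceMoment f₃ y) / (1 - lam) ^ 4) := by
      refine mul_le_mul_of_nonneg_right ?_ h4
      nlinarith
    unfold poissonMoment
    linarith

theorem integralLE_poissonBound (hs : M.StableChain μ f₁ f₂ f₃ ρ) (hc : M.ErgodicChain μ rhat)
    (hf : M.FeatureMatrix μ psihat) (h0 : 0 ≤ lam) (h1 : lam < 1) (xs : TDParam d) (k : ℕ)
    (y : TDState S A d) {φ : ℝ} (hz : traceMoment f₃ y ≤ φ)
    (hR : f₃ y.2.2.1 + M.R y.1 y.2.1 ^ 4 ≤ φ) :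
    IntegralLE ((M.tdKernel lam ^ k) y) (fun y => M.poissonBound μ lam cα rhat f₁ ρ xs y ^ 2)
      (20 * (‖xs‖ ^ 2 + 1) * M.poissonMoment μ lam rhat f₂ f₃ ρ y +
        8 * cα ^ 2 * √(f₂ y.1 + f₂ y.2.2.1) / (1 - ρ) ^ 2 + 8 * tdbHat lam cα φ) := by
  have hρ : 0 < 1 - ρ := by linarith [hs.rho_lt_one]
  have hR4 : 0 ≤ M.R y.1 y.2.1 ^ 4 := by positivity
  have a2 := hs.f₂_nonneg y.1
  have hφ : 0 ≤ φ := (hs.traceMoment_nonneg y).trans hz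
  -- The first component is the square of a three-term sum, hence the factors 3. With u the product
  -- |R| ‖z‖, v the Lipschitz bound, w the reward tail and X = ‖xs‖, the second is (u + Xv + w)² ≤
  -- 2u² + 2(X² + 1)(v² + w²), where v² and w² have moments 9 and 1 times `poissonMoment`; this
  -- gives 2 · 10 = 20. Since r̄² ≤ √φ, the constant term fits under 8 b̂.
  have eb := (hs.integralLE_b (cα := cα) h0 h1 k y hz (hs.integralLE_reward k y) hR).const_mul
    (c := 3) (by norm_num)
  have ef := ((hs.integralLE_f₁_sq_next (lam := lam) k y).mono_const
    (b := √(f₂ y.1 + f₂ y.2.2.1)) (Real.sqrt_le_sqrt (by linarith))).const_mul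
    (c := 3 * cα ^ 2 / (1 - ρ) ^ 2) (by positivity)
  have eL := ((hs.integralLE_poissonLip hc hf h0 h1 k y).add
    (hs.integralLE_rewardTail hc hf h0 h1 k y)).const_mul
    (c := 2 * (‖xs‖ ^ 2 + 1)) (by positivity)
  have ec := IntegralLE.const (τ := (M.tdKernel lam ^ k) y) (3 * cα ^ 2 * M.rbar μ ^ 2)
  refine (((((eb.add ef).add eL).add ec).mono (measurable_poissonBound.pow_const 2)
    (fun _ => sq_nonneg _) fun y => ?_)).mono_const ?_
  · unfold poissonBound
    rw [Real.sq_sqrt (by positivity)]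
    have k1 : (cα * M.rewardSumBound μ f₁ ρ y) ^ 2 ≤ 3 * cα ^ 2 * M.R y.1 y.2.1 ^ 2 +
        3 * cα ^ 2 / (1 - ρ) ^ 2 * f₁ y.2.2.1 ^ 2 + 3 * cα ^ 2 * M.rbar μ ^ 2 := by
      unfold rewardSumBound
      have e1 : 3 * cα ^ 2 / (1 - ρ) ^ 2 * f₁ y.2.2.1 ^ 2 =
          3 * cα ^ 2 * (f₁ y.2.2.1 / (1 - ρ)) ^ 2 := by rw [div_pow]; ring
      rw [e1, ← sq_abs (M.R y.1 y.2.1), ← sq_abs (M.rbar μ), mul_pow]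
      generalize |M.R y.1 y.2.1| = u
      generalize |M.rbar μ| = v
      generalize f₁ y.2.2.1 / (1 - ρ) = w
      have e2 : (u + v + w) ^ 2 ≤ 3 * (u ^ 2 + w ^ 2 + v ^ 2) := by
        nlinarith [sq_nonneg (u - v), sq_nonneg (u - w), sq_nonneg (v - w)]
      have e3 := mul_le_mul_of_nonneg_left e2 (sq_nonneg cα)
      linarith
    have k2 : (‖xs‖ * M.poissonLip μ lam f₁ ρ y + |M.R y.1 y.2.1| * ‖y.2.2.2‖ +
        M.rewardTail μ lam rhat f₁ ρ y) ^ 2 ≤ 2 * (M.R y.1 y.2.1 ^ 2 * ‖y.2.2.2‖ ^ 2) +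
        2 * (‖xs‖ ^ 2 + 1) * (M.poissonLip μ lam f₁ ρ y ^ 2 +
          M.rewardTail μ lam rhat f₁ ρ y ^ 2) := by
      rw [← sq_abs (M.R y.1 y.2.1), ← mul_pow]
      generalize |M.R y.1 y.2.1| * ‖y.2.2.2‖ = u
      generalize M.poissonLip μ lam f₁ ρ y = v
      generalize M.rewardTail μ lam rhat f₁ ρ y = w
      generalize ‖xs‖ = x
      nlinarith [sq_nonneg (x * v + w - u), sq_nonneg (x * w - v)]
    have k3 : 0 ≤ M.R y.1 y.2.1 ^ 2 * ‖y.2.2.2‖ ^ 2 := by positivity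
    linarith
  · have k1 : M.rbar μ ^ 2 ≤ √φ := (hs.rbar_sq_le hc y.2.2.1).trans
      (Real.sqrt_le_sqrt (by linarith))
    have k2 := mul_le_mul_of_nonneg_left k1 (sq_nonneg cα)
    have k3 : 0 ≤ φ / (1 - lam) ^ 2 := by positivity
    have k4 : 0 ≤ cα ^ 2 * √φ := by positivity
    have k5 : 0 ≤ cα ^ 2 * √(f₂ y.1 + f₂ y.2.2.1) / (1 - ρ) ^ 2 := by positivity
    have k6 : 3 * cα ^ 2 / (1 - ρ) ^ 2 * √(f₂ y.1 + f₂ y.2.2.1) =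
      3 * (cα ^ 2 * √(f₂ y.1 + f₂ y.2.2.1) / (1 - ρ) ^ 2) := by ring
    have k7 : 8 * cα ^ 2 * √(f₂ y.1 + f₂ y.2.2.1) / (1 - ρ) ^ 2 =
      8 * (cα ^ 2 * √(f₂ y.1 + f₂ y.2.2.1) / (1 - ρ) ^ 2) := by ring
    unfold tdbHat
    rw [k6, k7]
    linarith

/-- For a trace started at the feature vector of the state, the general moment bound is at most the
constant `gHat`. -/
theorem poissonMoment_le_gHat (hs : M.StableChain μ f₁ f₂ f₃ ρ) (hc : M.ErgodicChain μ rhat)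
    (hf : M.FeatureMatrix μ psihat) (s₀ : S) (a₀ : A) (s₁ : S) :
    M.poissonMoment μ lam rhat f₂ f₃ ρ (s₀, a₀, s₁, M.ψ s₀) ≤
      M.gHat μ lam rhat psihat f₂ f₃ ρ s₀ s₁ := by
  -- The factors ρ⁻² and the terms with ψ̂ in `gHat` are slack: the comparison is termwise, using
  -- ρ⁻² ≥ 1 and nonnegativity.
  have hρ : 1 ≤ ρ⁻¹ ^ 2 := one_le_pow₀ ((one_le_inv₀ hs.rho_pos).2 hs.rho_lt_one.le)
  have hr := hc.rhat_nonneg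
  have hp := hf.psihat_nonneg
  have hψ := psiPrime_nonneg (M := M) (μ := μ)
  unfold poissonMoment gHat traceMoment
  dsimp only
  refine add_le_add (add_le_add (add_le_add ?_ ?_) ?_) ?_
  · calc _ = 4 * 1 * √(f₂ s₁) / ((1 - lam) ^ 2 * (1 - ρ) ^ 2) := by ring
      _ ≤ _ := by gcongr
  · calc _ = 16 * 1 * √(‖M.ψ s₀‖ ^ 4 + f₃ s₁) * √(f₂ s₀ + f₂ s₁) /
          ((1 - lam * ρ) ^ 2 * (1 - lam) ^ 2) := by ring
      _ ≤ _ := by gcongr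
  · calc _ = 4 * (1 + rhat) ^ 2 * √(‖M.ψ s₀‖ ^ 4 + f₃ s₁) / (1 - lam) ^ 4 := by ring
      _ ≤ _ := by
        have : 0 ≤ psihat * √d := by positivity
        gcongr 4 * ?_ * _ / _
        exact pow_le_pow_left₀ (by linarith) (by linarith) 2
  · calc _ = 4 * M.psiPrime μ ^ 2 / (1 - lam) ^ 4 := by ring
      _ ≤ _ := by
        have : 0 ≤ psihat * rhat * √d := by positivity
        gcongr
        linarith

end StableChain

end TDModel

/-! ### The main theorem -/

theorem proposition1 {S A : Type*} [Countable S] [MeasurableSpace S] [DiscreteMeasurableSpace S]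
    [Fintype A] [MeasurableSpace A] [DiscreteMeasurableSpace A] {d : ℕ}
    (M : TDModel S A d) (μ : Measure S) [IsProbabilityMeasure μ]
    (rhat psihat lam cα : ℝ) (hlam₀ : 0 ≤ lam) (hlam₁ : lam < 1) (hcα : 0 < cα)
    (hchain : M.ErgodicChain μ rhat) (hfeature : M.FeatureMatrix μ psihat) :
    -- the operator `F` is the increment of the TD(λ) algorithm
    (∀ (r : ℝ) (θ : EuclideanSpace ℝ (Fin d)) (s : S) (a : A) (s' : S)
        (z : EuclideanSpace ℝ (Fin d)),
      M.F cα (WithLp.toLp 2 (r, θ)) (s, a, s', z) =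
        WithLp.toLp 2 (cα * (M.R s a - r),
          (M.R s a - r + ⟪M.ψ s', θ⟫_ℝ - ⟪M.ψ s, θ⟫_ℝ) • M.proj z)) ∧
    -- the process `Y_k` has a unique stationary distribution, and the mean field is `T̄ x + b̄`
    (∃ ν : Measure (TDState S A d), IsProbabilityMeasure ν ∧
      Kernel.Invariant (M.tdKernel lam) ν ∧
      (∀ ν' : Measure (TDState S A d), IsProbabilityMeasure ν' →
        Kernel.Invariant (M.tdKernel lam) ν' → ν' = ν) ∧
      (Integrable (M.T cα) ν ∧ ∫ y, M.T cα y ∂ν = M.Tbar μ lam cα) ∧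
      (Integrable (M.b cα) ν ∧ ∫ y, M.b cα y ∂ν = M.bbar μ lam cα) ∧
      ∀ x : TDParam d, Integrable (M.F cα x) ν ∧
        ∫ y, M.F cα x y ∂ν = M.Tbar μ lam cα x + M.bbar μ lam cα) ∧
    -- the negative drift
    (M.EPsiᗮ ≠ ⊥ → ∃ Δ : ℝ,
      IsLeast {v : ℝ | ∃ θ ∈ M.EPsiᗮ, ‖θ‖ = 1 ∧ v = ⟪θ, M.proj (M.energyOp μ lam θ)⟫_ℝ} Δ ∧
      0 < Δ ∧
      (Δ + √((d : ℝ) ^ 2 * psihat ^ 4 / (Δ ^ 2 * (1 - lam) ^ 4)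
          - d * psihat ^ 2 / (1 - lam) ^ 2) ≤ cα →
        ∀ x : TDParam d, x.snd ∈ M.EPsiᗮ →
          Δ / 2 * ‖x‖ ^ 2 ≤ -⟪x, M.Tbar μ lam cα x⟫_ℝ)) ∧
    -- the fixed point `x* = (r̄, θ*)`
    ∃ θs ∈ M.EPsiᗮ,
      M.Tbar μ lam cα (WithLp.toLp 2 (M.rbar μ, θs)) + M.bbar μ lam cα = 0 ∧
      (∀ θ ∈ M.EPsiᗮ,
        M.Tbar μ lam cα (WithLp.toLp 2 (M.rbar μ, θ)) + M.bbar μ lam cα = 0 → θ = θs) ∧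
      M.projLam μ (M.bellmanLam μ lam (M.Psi θs)) = M.Psi θs ∧
      ∀ xs : TDParam d, xs = WithLp.toLp 2 (M.rbar μ, θs) →
      (∀ (x : TDParam d) (y : TDState S A d),
        ‖M.F cα x y‖ ≤ ‖M.T cα y‖ * ‖x - xs‖ + (‖M.b cα y‖ + ‖M.T cα y‖ * ‖xs‖)) ∧
      ∀ (f₁ f₂ f₃ : S → ℝ) (ρ : ℝ), M.StableChain μ f₁ f₂ f₃ ρ →
        -- moment bounds on `T(Y_k)` and `b(Y_k)`
        (∀ (s₀ : S) (a₀ : A) (s₁ : S) (k : ℕ),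
          ∫⁻ y, ENNReal.ofReal (‖M.T cα y‖ ^ 2) ∂((M.tdKernel lam ^ k) (s₀, a₀, s₁, M.ψ s₀))
            ≤ ENNReal.ofReal (tdTHat lam cα (f₃ s₀ + f₃ s₁))) ∧
        (∀ (s₀ : S) (a₀ : A) (s₁ : S) (k : ℕ), 1 ≤ k →
          ∫⁻ y, ENNReal.ofReal (‖M.b cα y‖ ^ 2) ∂((M.tdKernel lam ^ k) (s₀, a₀, s₁, M.ψ s₀))
            ≤ ENNReal.ofReal (tdbHat lam cα (f₃ s₀ + f₃ s₁))) ∧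
        (∀ (s₀ : S) (a₀ : A) (s₁ : S) (k : ℕ),
          ∫⁻ y, ENNReal.ofReal (‖M.b cα y‖ ^ 2) ∂((M.tdKernel lam ^ k) (s₀, a₀, s₁, M.ψ s₀))
            ≤ ENNReal.ofReal (tdbHat lam cα (f₃ s₀ + f₃ s₁ + M.R s₀ a₀ ^ 4))) ∧
        (∀ y₀ : TDState S A d, ∃ C : ℝ≥0, ∀ k : ℕ,
          ∫⁻ y, ENNReal.ofReal (‖M.T cα y‖ ^ 2) ∂((M.tdKernel lam ^ k) y₀) ≤ C ∧
          ∫⁻ y, ENNReal.ofReal ((‖M.b cα y‖ + ‖M.T cα y‖ * ‖xs‖) ^ 2)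
            ∂((M.tdKernel lam ^ k) y₀) ≤ C) ∧
        -- the Poisson equation
        ∃ (V : TDParam d → TDState S A d → TDParam d) (A₂ B₂ : TDState S A d → ℝ),
          (∀ x, StronglyMeasurable (V x)) ∧ Measurable A₂ ∧ Measurable B₂ ∧
          (∀ y, 0 ≤ A₂ y) ∧ (∀ y, 0 ≤ B₂ y) ∧
          (∀ x y, Integrable (V x) (M.tdKernel lam y) ∧
            V x y = M.F cα x y + ∫ y', V x y' ∂(M.tdKernel lam y)
              - (M.Tbar μ lam cα x + M.bbar μ lam cα)) ∧
          (∀ x₁ x₂ y, ‖V x₂ y - V x₁ y‖ ≤ A₂ y * ‖x₂ - x₁‖) ∧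
          (∀ y, ‖V xs y‖ ≤ B₂ y) ∧
          (∀ (s₀ : S) (a₀ : A) (s₁ : S) (k : ℕ),
            ∫⁻ y, ENNReal.ofReal (A₂ y ^ 2) ∂((M.tdKernel lam ^ k) (s₀, a₀, s₁, M.ψ s₀))
              ≤ ENNReal.ofReal (9 * M.gHat μ lam rhat psihat f₂ f₃ ρ s₀ s₁)) ∧
          (∀ (s₀ : S) (a₀ : A) (s₁ : S) (k : ℕ),
            ∫⁻ y, ENNReal.ofReal (B₂ y ^ 2) ∂((M.tdKernel lam ^ k) (s₀, a₀, s₁, M.ψ s₀))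
              ≤ ENNReal.ofReal (20 * (‖xs‖ ^ 2 + 1) * M.gHat μ lam rhat psihat f₂ f₃ ρ s₀ s₁
                  + 8 * cα ^ 2 * √(f₂ s₀ + f₂ s₁) / (1 - ρ) ^ 2
                  + 8 * tdbHat lam cα (f₃ s₀ + f₃ s₁ + M.R s₀ a₀ ^ 4))) ∧
          (∀ y₀ : TDState S A d, ∃ C : ℝ≥0, ∀ k : ℕ,
            ∫⁻ y, ENNReal.ofReal (A₂ y ^ 2) ∂((M.tdKernel lam ^ k) y₀) ≤ C ∧
            ∫⁻ y, ENNReal.ofReal (B₂ y ^ 2) ∂((M.tdKernel lam ^ k) y₀) ≤ C) := by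
  refine ⟨fun r θ s a s' z => TDModel.F_eq _ _, ?_, fun hE => ?_, ?_⟩
  · obtain ⟨ν, hν, hinv⟩ := hchain.exists_invariant_tdKernel hfeature hlam₀ hlam₁
    exact ⟨ν, hν, hinv, fun ν' _ hinv' => TDModel.tdKernel_invariant_unique hchain hlam₀ hlam₁
      hinv' hinv, hchain.integral_T hfeature hlam₀ hlam₁ hinv,
      hchain.integral_b hfeature hlam₀ hlam₁ hinv,
      hchain.integral_F hfeature hlam₀ hlam₁ hinv⟩
  · obtain ⟨Δ, hΔ, hpos⟩ := hchain.exists_isLeast_energy hfeature hlam₀ hlam₁ hE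
    exact ⟨Δ, hΔ, hpos, fun hle x hx => hfeature.negative_drift hlam₁ hΔ hpos hle x hx⟩
  · obtain ⟨θs, hθs, hfix, huniq⟩ := hchain.exists_fixedPoint (cα := cα) hfeature hlam₀ hlam₁
    refine ⟨θs, hθs, hfix, huniq, ?_, ?_⟩
    · exact hchain.projected_bellman hfeature hlam₀ hlam₁ hfix
    intro xs _
    refine ⟨fun x y => ?_, fun f₁ f₂ f₃ ρ hs => ?_⟩
    · have h1 : M.F cα x y = M.T cα y (x - xs) + (M.b cα y + M.T cα y xs) := by
        unfold TDModel.F; rw [map_sub]; abel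
      rw [h1]
      exact (norm_add_le _ _).trans (add_le_add ((M.T cα y).le_opNorm _)
        ((norm_add_le _ _).trans (add_le_add le_rfl ((M.T cα y).le_opNorm _))))
    have hψ := hs.norm_feature_le
    have hR : ∀ s a, 0 ≤ M.R s a ^ 4 := fun s a => by positivity
    refine ⟨fun s₀ a₀ s₁ k => ?_, fun s₀ a₀ s₁ k hk => ?_, fun s₀ a₀ s₁ k => ?_,
      hs.exists_bound_T_b hlam₀ hlam₁ cα xs,
      M.poissonSolution μ lam cα, M.poissonLip μ lam f₁ ρ,
      M.poissonBound μ lam cα rhat f₁ ρ xs,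
      fun x => (hs.poissonSolution_eq hchain hfeature hlam₀ hlam₁ x).1,
      TDModel.measurable_poissonLip, TDModel.measurable_poissonBound,
      hs.poissonLip_nonneg hlam₀ hlam₁, fun y => Real.sqrt_nonneg _,
      fun x => (hs.poissonSolution_eq hchain hfeature hlam₀ hlam₁ x).2,
      hs.norm_poissonSolution_sub_le hchain hfeature hlam₀ hlam₁,
      hs.norm_poissonSolution_le hchain hfeature hlam₀ hlam₁ hcα.le xs,
      fun s₀ a₀ s₁ k => ?_, fun s₀ a₀ s₁ k => ?_, fun y₀ => ?_⟩
    · exact hs.lintegral_T_le hlam₀ hlam₁ k _ (add_le_add (hψ s₀) le_rfl) le_rfl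
    · obtain ⟨k, rfl⟩ := Nat.exists_eq_add_of_le' hk
      exact hs.lintegral_b_le hlam₀ hlam₁ (k + 1) _ (add_le_add (hψ s₀) le_rfl)
        (hs.integralLE_reward_succ k _) (le_add_of_nonneg_left (hs.f₃_nonneg s₀))
    · refine hs.lintegral_b_le hlam₀ hlam₁ k _ ?_ (hs.integralLE_reward k _) ?_ <;> dsimp only
      · linarith [hψ s₀, hR s₀ a₀]
      · linarith [hs.f₃_nonneg s₀]
    · exact ((hs.integralLE_poissonLip hchain hfeature hlam₀ hlam₁ k _).mono_const
        (mul_le_mul_of_nonneg_left (hs.poissonMoment_le_gHat hchain hfeature s₀ a₀ s₁)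
          (by norm_num))).lintegral_le fun _ => sq_nonneg _
    · refine ((hs.integralLE_poissonBound hchain hfeature hlam₀ hlam₁ xs k
        (s₀, a₀, s₁, M.ψ s₀) (φ := f₃ s₀ + f₃ s₁ + M.R s₀ a₀ ^ 4) ?_ ?_).mono_const
        ?_).lintegral_le fun _ => sq_nonneg _
      · unfold TDModel.traceMoment
        dsimp only
        linarith [hψ s₀, hR s₀ a₀]
      · dsimp only
        linarith [hs.f₃_nonneg s₀]
      · have := hs.poissonMoment_le_gHat (lam := lam) hchain hfeature s₀ a₀ s₁
        dsimp only
        gcongr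
    · set φ := TDModel.traceMoment f₃ y₀ + (f₃ y₀.2.2.1 + M.R y₀.1 y₀.2.1 ^ 4) with hφ
      have h3 := hs.traceMoment_nonneg y₀
      have h4 := add_nonneg (hs.f₃_nonneg y₀.2.2.1) (hR y₀.1 y₀.2.1)
      refine ⟨(9 * M.poissonMoment μ lam rhat f₂ f₃ ρ y₀).toNNReal +
        (20 * (‖xs‖ ^ 2 + 1) * M.poissonMoment μ lam rhat f₂ f₃ ρ y₀ +
          8 * cα ^ 2 * √(f₂ y₀.1 + f₂ y₀.2.2.1) / (1 - ρ) ^ 2 +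
          8 * tdbHat lam cα φ).toNNReal, fun k => ⟨?_, ?_⟩⟩ <;> rw [ENNReal.coe_add]
      · exact ((hs.integralLE_poissonLip hchain hfeature hlam₀ hlam₁ k y₀).lintegral_le
          fun _ => sq_nonneg _).trans le_self_add
      · exact ((hs.integralLE_poissonBound hchain hfeature hlam₀ hlam₁ xs k y₀ (φ := φ)
          (le_add_of_nonneg_right h4) (le_add_of_nonneg_left h3)).lintegral_le
          fun _ => sq_nonneg _).trans le_add_self
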